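/- Write $\mathbb T^d=\mathbb R^d/\mathbb Z^d$ and use supremum norms. Let $r\ge 0$, $s\ge 0$, $d=r+s$, let $\Omega_0\in\mathbb R^d$ be resonant ($k\cdot\Omega_0\in\mathbb Z$ for some $k\in\mathbb Z^d\setminus\{0\}$), and let $\omega\in\mathbb R^r$ be an intrinsic frequency of $\Omega_0$: there are $A\in \mathrm{SL}(d,\mathbb Z)$ and $L\in\mathbb Z^d$ with $$A\Omega_0=\begin{pmatrix}\omega\\0\end{pmatrix}+L ,$$ and $\omega$ is non-resonant (so $s=d-r$ is the rank of the resonance module $\{k\in\mathbb Z^d : k\cdot\Omega_0\in\mathbb Z\}$, and $s\ge 1$). Fix such $A,L$. Assume that $\omega$ is Diophantine of type $(\nu,\tau)$, $\nu>0$: $|k\cdot\omega-l|\ge\nu|k|^{-\tau}$ for all $k\in\mathbb Z^r\setminus\{0\}$, $l\in\mathbb Z$. Let $n,m\ge1$ be integers, $N=n+m-1$, and let $I\subseteq\mathbb R$ be a non-degenerate interval containing $0$ (e.g. $[0,\varepsilon_1)$ or $(-\varepsilon_1,\varepsilon_1)$). For $\Omega\in\mathbb R^d$, $\varepsilon\in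 I$ let $F_{\Omega,\varepsilon}(x)=x+\Omega+\varepsilon f_\varepsilon(x)$ on $\mathbb T^d$, $f_\varepsilon:\mathbb T^d\to\mathbb R^d$. Assume one of the following. * Analytic case: for some $\rho>0$, $\varepsilon\mapsto \varepsilon f_\varepsilon$ is a $C^{n+m}$ map from $I$ to the space of real analytic functions on $\mathbb T^d$ with a bounded holomorphic extension to the strip $|\mathrm{Im}\, x|<\rho$ (sup norm on the strip). In this case "of class $\kappa$" below means real analytic. * Finitely differentiable case: $p,q\in\mathbb N$, $p>q\ge (n+m-1)(d+\tau)$, and $\varepsilon\mapsto\varepsilon f_\varepsilon$ is a $C^{n+m}$ map from $I$ to $C^p(\mathbb T^d,\mathbb R^d)$. In this case "of class $\kappa$" below means $C^{p-q}$. **(Averaging.)** There are functions $h^0,\dots,h^{N-1},\,p^1,\dots,p^N:\mathbb T^d\to\mathbb R^d$ and $R^1,\dots,R^N:\mathbb T^{s}\to\mathbb R^d$, all of class $\kappa$, such that, with $H^{l}_\varepsilon=\mathrm{Id}+\varepsilon h^0+\dots+\varepsilon^{l}h^{l-1}$ and $(Ax)_2\in\mathbb T^s$ the last $s$ coordinates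 of $Ax$, for every $1\le j\le N$: 1. $p^j$ is the coefficient of $\varepsilon^j$ in $(H^{j-1}_\varepsilon)^{-1}\circ F_{\Omega_0,\varepsilon}\circ H^{j-1}_\varepsilon$, that is, on lifts to $\mathbb R^d$ and for every $x$, $$F_{\Omega_0,\varepsilon}(H^{j-1}_\varepsilon(x))-H^{j-1}_\varepsilon\Big(x+\Omega_0+\sum_{1\le i<j}\varepsilon^iR^i((Ax)_2)+\varepsilon^jp^j(x)\Big)=o(\varepsilon^j)\qquad(\varepsilon\to0,\ \varepsilon\in I);$$ 2. $R^j(x_2)=\int_{\mathbb T^r}p^j(A^{-1}(y,x_2))\,dy$ is the resonant part of $p^j$; 3. $h^{j-1}(x)-h^{j-1}(x+\Omega_0)+p^j(x)=R^j((Ax)_2)$ and $\int_{\mathbb T^r}h^{j-1}(A^{-1}(y,x_2))\,dy=0$ for all $x_2\in\mathbb T^s$. **(Normal form.)** If $R^j\equiv0$ for all $1\le j<n$ (in particular if $n$ is the least index with $R^n\not\equiv0$), put $$\begin{pmatrix}\beta(x_2,\varepsilon)\\ \eta(x_2,\varepsilon)\end{pmatrix}=A\sum_{j=n}^{n+m-1}\varepsilon^{j-n}R^j(x_2)\in\mathbb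 R^r\times\mathbb R^{s}.$$ Then there are $\varepsilon_0>0$ and $C$ such that for all $\varepsilon\in I$ with $|\varepsilon|<\varepsilon_0$: the map $H_\varepsilon=H^{n+m-1}_\varepsilon=\mathrm{Id}+\varepsilon h^0+\dots+\varepsilon^{n+m-1}h^{n+m-2}$ is a bijection of $\mathbb T^d$, it and its inverse are of class $\kappa$, and for all $\Omega\in\mathbb R^d$ and all $(x_1,x_2)\in\mathbb T^r\times\mathbb T^{s}$ $$A\circ H_\varepsilon^{-1}\circ F_{\Omega,\varepsilon}\circ H_\varepsilon\circ A^{-1}\begin{pmatrix}x_1\\x_2\end{pmatrix}=\begin{pmatrix}x_1+\omega+\varepsilon^n\beta(x_2,\varepsilon)+\varepsilon^{n+m}r_1(x_1,x_2;\varepsilon)+\widetilde\Delta_1(\Omega)\\ x_2+\varepsilon^n\eta(x_2,\varepsilon)+\varepsilon^{n+m}r_2(x_1,x_2;\varepsilon)+\widetilde\Delta_2(\Omega)\end{pmatrix}.$$ Here $\beta(\cdot,\varepsilon),\eta(\cdot,\varepsilon)$ are functions of class $\kappa$ on $\mathbb T^{s}$; $r_1,r_2$ do not depend on $\Omega$,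 are of class $\kappa$ on $\mathbb T^d$ and satisfy $|r_1|,|r_2|\le C$; and $\widetilde\Delta_j(\Omega)=\widetilde\Delta_j(\Omega)(x_1,x_2;\varepsilon)$ is of class $\kappa$ on $\mathbb T^d$ with $|\widetilde\Delta_j(\Omega)|\le C|\Omega-\Omega_0|$, $j=1,2$, where $\varepsilon_0$ and $C$ are independent of $\varepsilon$, $\Omega$ and $(x_1,x_2)$. -/

import Mathlib

open Topology Asymptotics Filter BoundedContinuousFunction
open scoped Matrix

/-- The torus `ℝ^d / ℤ^d`. -/
abbrev Torus (d : ℕ) : Type := UnitAddTorus (Fin d)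

/-- The projection `ℝ^d → ℝ^d / ℤ^d`. -/
def torusProj {d : ℕ} (v : Fin d → ℝ) : Torus d := fun i => (v i : UnitAddCircle)

/-- The `ℤ^d`-periodic function on `ℝ^d` given by a function on the torus. -/
def periodicLift {d : ℕ} {X : Type} (g : Torus d → X) : (Fin d → ℝ) → X :=
  fun v => g (torusProj v)

/-- A function on the torus is of class `C^κ`; `κ = ⊤` means real analytic (and not merely smooth). -/
def TorusContDiff {d e : ℕ} (κ : WithTop ℕ∞) (g : Torus d → (Fin e → ℝ)) : Prop :=
  ContDiff ℝ κ (periodicLift g)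

/-- The torus map `x ↦ x + u(x) mod ℤ^d`. -/
def displace {d : ℕ} (u : Torus d → (Fin d → ℝ)) : Torus d → Torus d :=
  fun x => x + torusProj (u x)

/-- The lift `x ↦ x + u(x)` to `ℝ^d` of the torus map `displace u`. -/
def displaceLift {d : ℕ} (u : Torus d → (Fin d → ℝ)) : (Fin d → ℝ) → (Fin d → ℝ) :=
  fun x => x + u (torusProj x)

/-- The action of an integer matrix on the torus. -/
def torusMatrix {d : ℕ} (A : Matrix (Fin d) (Fin d) ℤ) : Torus d → Torus d :=
  fun x i => ∑ j, A i j • x j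

/-- The action of an integer matrix on `ℝ^d`. -/
def realMatrix {d : ℕ} (A : Matrix (Fin d) (Fin d) ℤ) : (Fin d → ℝ) → (Fin d → ℝ) :=
  fun v => (A.map (fun a : ℤ => (a : ℝ))) *ᵥ v

/-- First block of a vector with `r + s` entries. -/
def fstBlock {r s : ℕ} {X : Type} (v : Fin (r + s) → X) : Fin r → X :=
  fun i => v (Fin.castAdd s i)

/-- Second block of a vector with `r + s` entries. -/
def sndBlock {r s : ℕ} {X : Type} (v : Fin (r + s) → X) : Fin s → X :=
  fun i => v (Fin.natAdd r i)

/-- `Ω` is resonant: `k · Ω ∈ ℤ` for some nonzero integer vector `k`. -/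
def IsResonant {d : ℕ} (Ω : Fin d → ℝ) : Prop :=
  ∃ k : Fin d → ℤ, k ≠ 0 ∧ ∃ l : ℤ, (∑ i, (k i : ℝ) * Ω i) - l = 0

/-- `ω` is non-resonant: `k · ω = l` with `k`, `l` integral only for `k = 0`, `l = 0`. -/
def IsNonresonant {r : ℕ} (ω : Fin r → ℝ) : Prop :=
  ∀ (k : Fin r → ℤ) (l : ℤ), (∑ i, (k i : ℝ) * ω i) - l = 0 → k = 0 ∧ l = 0

/-- `ω` is an intrinsic frequency of `Ω`, realized by `A ∈ SL(d, ℤ)` and `L ∈ ℤ^d`: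
`A Ω = (ω, 0) + L` with `ω` non-resonant. -/
def IsIntrinsicFrequency {r s : ℕ} (Ω : Fin (r + s) → ℝ) (ω : Fin r → ℝ)
    (A : Matrix.SpecialLinearGroup (Fin (r + s)) ℤ) (L : Fin (r + s) → ℤ) : Prop :=
  realMatrix (A : Matrix (Fin (r + s)) (Fin (r + s)) ℤ) Ω
      = Fin.append ω (0 : Fin s → ℝ) + (fun i => (L i : ℝ)) ∧
    IsNonresonant ω

/-- The Diophantine condition of type `(ν, τ)`, with the supremum norm on `ℤ^r`. -/
def IsDiophantine {r : ℕ} (ν τ : ℝ) (ω : Fin r → ℝ) : Prop :=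
  ∀ k : Fin r → ℤ, k ≠ 0 → ∀ l : ℤ, ν * ‖k‖ ^ (-τ) ≤ |(∑ i, (k i : ℝ) * ω i) - l|

/-- `ε ↦ u ε` is a map of class `C^M` from the interval `I` to the Banach space
`C^p(𝕋^d, ℝ^d)`.  The norm of `C^p` is the maximum of the sup norms of the derivatives of
order at most `p`, so this means that each of these derivatives is `C^M` in `ε` as an element
of the space of bounded continuous functions. -/
def IsCkFamily {d : ℕ} (M p : ℕ) (I : Set ℝ) (u : ℝ → Torus d → (Fin d → ℝ)) : Prop :=
  (∀ ε ∈ I, TorusContDiff p (u ε)) ∧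
  ∀ k ≤ p, ∃ G : ℝ → ((Fin d → ℝ) →ᵇ ((Fin d → ℝ) [×k]→L[ℝ] (Fin d → ℝ))),
    (∀ ε ∈ I, ∀ x, G ε x = iteratedFDeriv ℝ k (periodicLift (u ε)) x) ∧
    ContDiffOn ℝ M G I

/-- The complex strip `{z : |Im z| < ρ}` around `ℝ^d`. -/
def complexStrip (d : ℕ) (ρ : ℝ) : Set (Fin d → ℂ) := {z | ∀ i, |(z i).im| < ρ}

/-- `ε ↦ u ε` is a map of class `C^M` from the interval `I` to the Banach space of real
analytic functions on `𝕋^d` with a bounded holomorphic extension to a fixed complex strip, with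
the sup norm over the strip. -/
def IsAnalyticFamily {d : ℕ} (M : ℕ) (I : Set ℝ) (u : ℝ → Torus d → (Fin d → ℝ)) : Prop :=
  ∃ ρ : ℝ, 0 < ρ ∧ ∃ G : ℝ → ((complexStrip d ρ) →ᵇ (Fin d → ℂ)),
    (∀ ε ∈ I, ∃ g : (Fin d → ℂ) → (Fin d → ℂ),
      AnalyticOnNhd ℂ g (complexStrip d ρ) ∧
      (∀ z : complexStrip d ρ, G ε z = g z) ∧
      (∀ x : Fin d → ℝ, g (fun i => (x i : ℂ)) = fun i => ((u ε (torusProj x) i : ℝ) : ℂ))) ∧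
    ContDiffOn ℝ M G I

/-- The displacement `Ω + ε f_ε` of the torus map `F_{Ω,ε}(x) = x + Ω + ε f_ε(x)`. -/
def torusFamily {d : ℕ} (f : ℝ → Torus d → (Fin d → ℝ)) (Ω : Fin d → ℝ) (ε : ℝ) :
    Torus d → (Fin d → ℝ) :=
  fun x => Ω + ε • f ε x

/-- The displacement `ε h^0 + ε^2 h^1 + ⋯ + ε^N h^{N-1}` of the near-identity map `H^N_ε`. -/
def nearIdentity {d : ℕ} (h : ℕ → Torus d → (Fin d → ℝ)) (N : ℕ) (ε : ℝ) :
    Torus d → (Fin d → ℝ) :=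
  fun x => ∑ j ∈ Finset.range N, ε ^ (j + 1) • h j x

/-- The normalized Haar measure of the torus. -/
noncomputable def torusHaar (d : ℕ) : MeasureTheory.Measure (Torus d) :=
  MeasureTheory.Measure.pi (fun _ : Fin d => AddCircle.haarAddCircle)

/-- The averaging procedure up to order `N` at the resonant frequency `Ω₀`.  For `1 ≤ j ≤ N`:
`p j` is the coefficient of `ε^j` in `(H^{j-1}_ε)⁻¹ ∘ F_{Ω₀,ε} ∘ H^{j-1}_ε`, the lower ones
being the resonant terms already found; `R j` is the resonant part of `p j`, i.e. in
the coordinates `(x₁, x₂) = A x` its average over `x₁`; and `h (j - 1)` is the solution without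
resonant part of the cohomology equation that removes the rest of `p j`. -/
structure IsAveraging {r s : ℕ} (I : Set ℝ) (f : ℝ → Torus (r + s) → (Fin (r + s) → ℝ))
    (Ω₀ : Fin (r + s) → ℝ) (A : Matrix.SpecialLinearGroup (Fin (r + s)) ℤ) (N : ℕ)
    (h p : ℕ → Torus (r + s) → (Fin (r + s) → ℝ))
    (R : ℕ → Torus s → (Fin (r + s) → ℝ)) : Prop where
  coefficient : ∀ j, 1 ≤ j → j ≤ N → ∀ x : Fin (r + s) → ℝ,
    (fun ε : ℝ =>
      displaceLift (torusFamily f Ω₀ ε) (displaceLift (nearIdentity h (j - 1) ε) x)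
        - displaceLift (nearIdentity h (j - 1) ε)
            (x + Ω₀ + ∑ i ∈ Finset.Ico 1 j,
                ε ^ i • R i (sndBlock (torusMatrix A.1 (torusProj x)))
              + ε ^ j • p j (torusProj x)))
      =o[𝓝[I] 0] (fun ε : ℝ => ε ^ j)
  average : ∀ j, 1 ≤ j → j ≤ N → ∀ x₂ : Torus s,
    R j x₂ = ∫ y : Torus r, p j (torusMatrix (A⁻¹).1 (Fin.append y x₂)) ∂torusHaar r
  cohomology : ∀ j, 1 ≤ j → j ≤ N → ∀ x : Torus (r + s),
    h (j - 1) x - h (j - 1) (x + torusProj Ω₀) + p j x = R j (sndBlock (torusMatrix A.1 x))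
  normalization : ∀ j, 1 ≤ j → j ≤ N → ∀ x₂ : Torus s,
    (∫ y : Torus r, h (j - 1) (torusMatrix (A⁻¹).1 (Fin.append y x₂)) ∂torusHaar r) = 0

/-- The resonant terms `A ∑_{n ≤ j ≤ n+m-1} ε^{j-n} R^j(x₂) = (β(x₂, ε), η(x₂, ε))`. -/
def resonantTerms {r s : ℕ} (A : Matrix.SpecialLinearGroup (Fin (r + s)) ℤ) (n m : ℕ)
    (R : ℕ → Torus s → (Fin (r + s) → ℝ)) (ε : ℝ) (x₂ : Torus s) : Fin (r + s) → ℝ :=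
  realMatrix A.1 (∑ j ∈ Finset.Ico n (n + m), ε ^ (j - n) • R j x₂)

/-- For all small `ε ∈ I` and all `Ω`, the `C^κ` diffeomorphism `H^{n+m-1}_ε` of the torus,
followed by the linear map `A`, conjugates `F_{Ω,ε}` to the resonant normal form of class `C^κ`.
Here `k ε` is the displacement of the inverse of `H^{n+m-1}_ε`. -/
def HasResonantNormalForm {r s : ℕ} (κ : WithTop ℕ∞) (I : Set ℝ)
    (f : ℝ → Torus (r + s) → (Fin (r + s) → ℝ)) (Ω₀ : Fin (r + s) → ℝ) (ω : Fin r → ℝ)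
    (A : Matrix.SpecialLinearGroup (Fin (r + s)) ℤ) (n m : ℕ)
    (h : ℕ → Torus (r + s) → (Fin (r + s) → ℝ))
    (β : ℝ → Torus s → (Fin r → ℝ)) (η : ℝ → Torus s → (Fin s → ℝ)) : Prop :=
  ∃ ε₀ : ℝ, 0 < ε₀ ∧ ∃ C : ℝ,
  ∃ (k : ℝ → Torus (r + s) → (Fin (r + s) → ℝ))
    (r₁ : ℝ → Torus (r + s) → (Fin r → ℝ)) (r₂ : ℝ → Torus (r + s) → (Fin s → ℝ))
    (Δ₁ : (Fin (r + s) → ℝ) → ℝ → Torus (r + s) → (Fin r → ℝ))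
    (Δ₂ : (Fin (r + s) → ℝ) → ℝ → Torus (r + s) → (Fin s → ℝ)),
  ∀ ε ∈ I, |ε| < ε₀ →
    (TorusContDiff κ (nearIdentity h (n + m - 1) ε) ∧ TorusContDiff κ (k ε) ∧
      Function.LeftInverse (displace (k ε)) (displace (nearIdentity h (n + m - 1) ε)) ∧
      Function.RightInverse (displace (k ε)) (displace (nearIdentity h (n + m - 1) ε))) ∧
    (TorusContDiff κ (β ε) ∧ TorusContDiff κ (η ε)) ∧
    (TorusContDiff κ (r₁ ε) ∧ TorusContDiff κ (r₂ ε)) ∧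
    (∀ x, ‖r₁ ε x‖ ≤ C ∧ ‖r₂ ε x‖ ≤ C) ∧
    ∀ Ω : Fin (r + s) → ℝ,
      (TorusContDiff κ (Δ₁ Ω ε) ∧ TorusContDiff κ (Δ₂ Ω ε)) ∧
      (∀ x, ‖Δ₁ Ω ε x‖ ≤ C * ‖Ω - Ω₀‖ ∧ ‖Δ₂ Ω ε x‖ ≤ C * ‖Ω - Ω₀‖) ∧
      ∀ (x₁ : Torus r) (x₂ : Torus s),
        torusMatrix A.1 (displace (k ε) (displace (torusFamily f Ω ε)
            (displace (nearIdentity h (n + m - 1) ε)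
              (torusMatrix (A⁻¹).1 (Fin.append x₁ x₂)))))
          = Fin.append
              (x₁ + torusProj (ω + ε ^ n • β ε x₂
                + ε ^ (n + m) • r₁ ε (Fin.append x₁ x₂) + Δ₁ Ω ε (Fin.append x₁ x₂)))
              (x₂ + torusProj (ε ^ n • η ε x₂
                + ε ^ (n + m) • r₂ ε (Fin.append x₁ x₂) + Δ₂ Ω ε (Fin.append x₁ x₂)))

/-- The averaging procedure up to order `n + m - 1` can be carried out in the class `C^κ`, and if
its resonant terms of order less than `n` vanish, it yields the resonant normal form. -/
def AveragesToNormalForm {r s : ℕ} (κ : WithTop ℕ∞) (I : Set ℝ)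
    (f : ℝ → Torus (r + s) → (Fin (r + s) → ℝ)) (Ω₀ : Fin (r + s) → ℝ) (ω : Fin r → ℝ)
    (A : Matrix.SpecialLinearGroup (Fin (r + s)) ℤ) (n m : ℕ) : Prop :=
  ∃ (h p : ℕ → Torus (r + s) → (Fin (r + s) → ℝ)) (R : ℕ → Torus s → (Fin (r + s) → ℝ)),
    IsAveraging I f Ω₀ A (n + m - 1) h p R ∧
    (∀ j < n + m - 1, TorusContDiff κ (h j)) ∧
    (∀ j, 1 ≤ j → j ≤ n + m - 1 → TorusContDiff κ (p j) ∧ TorusContDiff κ (R j)) ∧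
    ((∀ j, 1 ≤ j → j < n → R j = 0) →
      HasResonantNormalForm κ I f Ω₀ ω A n m h
        (fun ε x₂ => fstBlock (resonantTerms A n m R ε x₂))
        (fun ε x₂ => sndBlock (resonantTerms A n m R ε x₂)))

/-! Let F be the map at Ω₀. One seeks H = Id + ε h⁰ + … such that F ∘ H and H ∘ (Id + Ω₀ + Σ ε^i
R^i) agree up to O(ε^{N+1}). At each order the equation to solve is h − h(· + Ω₀) + p = R. On the
character of index k its divisor is e^{2πi k·Ω₀} − 1. Since A Ω₀ is (ω, 0) modulo integers, this
divisor depends only on the first r entries of k A⁻¹ (`mFourier_frequency`). Where these entries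
vanish, the coefficient must stay in R, which is therefore the average of p over the first r
coordinates of A x. Elsewhere the Diophantine condition bounds the inverse divisor by a multiple of
|k|^τ.

Regularity is measured by summability of W(k)^t |a_k| over Fourier coefficients. The weight 1 + |k|
serves finite differentiability and exp(c |k|) serves analyticity, so that one argument covers both
cases. These classes are algebras; a derivative lowers t by 1 and the cohomology equation lowers it
by τ.

The coefficient p is not computed by a formula. Families that agree up to O(ε^M) with a polynomial
in ε over such an algebra again form an algebra, and composition with near-identity maps stays in it
(`pow_mul_comp_mem`). Hence a defect F ∘ H^j − H^j ∘ (…) of order ε^{j+1} has a leading coefficient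
in a known class (`exists_defect_coefficient`). Removing its nonresonant part
(`exists_cohomology_solution`) raises the order by one (`uniformO_defect_succ`). One step costs τ +
1 and the last one only τ, so an initial exponent T ends as T − Nτ − (N − 1)
(`exists_averaging_steps`).

The data enter as follows. The Taylor coefficients in ε lie in the closure of the given function
space. Bounds on iterated differences pass to this closure, and Parseval turns them into decay of
Fourier coefficients: C^p gives the exponent p − d, and Cauchy's estimates give exponential decay.
The assumption q ≥ N(d + τ) pays for d + Nτ + N − 1.

For small ε the displacement of H is 1/2-Lipschitz, so H has an inverse with a 2-Lipschitz lift.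
Applied to the defect and to the constant Ω − Ω₀, this inverse yields the two error terms
(`hasResonantNormalForm`). If r = 0 there is nothing to average out. -/

namespace ResonantAveraging

open UnitAddTorus MeasureTheory

/-! ### The torus, its covering space and its characters. -/

section Torus

variable {d : ℕ}

theorem torusProj_add (v w : Fin d → ℝ) : torusProj (v + w) = torusProj v + torusProj w := by
  ext i; simp [torusProj]

theorem torusProj_zero : torusProj (0 : Fin d → ℝ) = 0 := by
  ext i; simp [torusProj]

theorem torusProj_sub (v w : Fin d → ℝ) : torusProj (v - w) = torusProj v - torusProj w := by
  ext i; simp [torusProj]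

theorem torusProj_intCast (m : Fin d → ℤ) : torusProj (fun i => (m i : ℝ)) = 0 := by
  ext i
  simp only [torusProj, Pi.zero_apply]
  rw [AddCircle.coe_eq_zero_iff]
  exact ⟨m i, by simp⟩

theorem torusProj_surjective : Function.Surjective (torusProj (d := d)) := by
  intro x
  have h : ∀ i, ∃ t : ℝ, (t : UnitAddCircle) = x i := fun i => QuotientAddGroup.mk_surjective (x i)
  choose v hv using h
  exact ⟨v, funext hv⟩

/-- A representative in `ℝ^d` of a point of the torus. -/
noncomputable def torusSection (x : Torus d) : Fin d → ℝ :=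
  Function.surjInv torusProj_surjective x

@[simp] theorem torusProj_section (x : Torus d) : torusProj (torusSection x) = x :=
  Function.surjInv_eq torusProj_surjective x

theorem continuous_torusProj : Continuous (torusProj (d := d)) :=
  continuous_pi fun i => (AddCircle.continuous_mk' (1 : ℝ)).comp (continuous_apply i)

/-- Continuity on the torus can thus be tested on the periodic lift, as differentiability is by
definition. -/
theorem isQuotientMap_torusProj : IsQuotientMap (torusProj (d := d)) := by
  refine IsOpenMap.isQuotientMap ?_ continuous_torusProj torusProj_surjective
  exact IsOpenMap.piMap (fun _ => QuotientAddGroup.isOpenMap_coe)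
    (Eventually.of_forall fun _ => QuotientAddGroup.mk_surjective)

theorem continuous_iff_periodicLift {X : Type} [TopologicalSpace X] {g : Torus d → X} :
    Continuous g ↔ Continuous (periodicLift g) :=
  isQuotientMap_torusProj.continuous_iff

theorem _root_.TorusContDiff.continuous {e : ℕ} {κ : WithTop ℕ∞} {g : Torus d → (Fin e → ℝ)}
    (h : TorusContDiff κ g) : Continuous g :=
  continuous_iff_periodicLift.2 (ContDiff.continuous h)

/-- The linear form `v ↦ 2π k · v`. -/
noncomputable def phase (k : Fin d → ℤ) : (Fin d → ℝ) →L[ℝ] ℝ :=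
  ∑ i, (2 * Real.pi * (k i : ℝ)) • ContinuousLinearMap.proj i

theorem phase_apply (k : Fin d → ℤ) (v : Fin d → ℝ) :
    phase k v = ∑ i, 2 * Real.pi * (k i : ℝ) * v i := by
  simp [phase]

theorem phase_eq (k : Fin d → ℤ) (v : Fin d → ℝ) :
    phase k v = 2 * Real.pi * ∑ i, (k i : ℝ) * v i := by
  rw [phase_apply, Finset.mul_sum]
  exact Finset.sum_congr rfl fun i _ => by ring

theorem abs_coord_le_norm (k : Fin d → ℤ) (i : Fin d) : |(k i : ℝ)| ≤ ‖k‖ := by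
  have := norm_le_pi_norm k i
  rwa [Int.norm_eq_abs] at this

theorem abs_phase_le (k : Fin d → ℤ) (v : Fin d → ℝ) :
    |phase k v| ≤ 2 * Real.pi * d * (‖k‖ * ‖v‖) := by
  rw [phase_apply]
  refine (Finset.abs_sum_le_sum_abs _ _).trans ?_
  have : ∀ i ∈ Finset.univ, |2 * Real.pi * (k i : ℝ) * v i| ≤ 2 * Real.pi * (‖k‖ * ‖v‖) := by
    intro i _
    rw [abs_mul, abs_mul, abs_of_pos Real.two_pi_pos, mul_assoc]
    have h1 := abs_coord_le_norm k i
    have h2 : |v i| ≤ ‖v‖ := norm_le_pi_norm v i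
    gcongr
  refine (Finset.sum_le_sum this).trans ?_
  simp only [Finset.sum_const, Finset.card_univ, Fintype.card_fin, nsmul_eq_mul]
  linarith [mul_comm (d : ℝ) (2 * Real.pi * (‖k‖ * ‖v‖))]

theorem norm_phase_le (k : Fin d → ℤ) : ‖phase k‖ ≤ 2 * Real.pi * d * ‖k‖ :=
  ContinuousLinearMap.opNorm_le_bound _ (by positivity) fun v => by
    have := abs_phase_le k v
    rw [Real.norm_eq_abs]; linarith

theorem mFourier_torusProj (k : Fin d → ℤ) (v : Fin d → ℝ) :
    mFourier k (torusProj v) = Complex.exp (Complex.I * (phase k v : ℝ)) := by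
  simp only [mFourier, ContinuousMap.coe_mk, torusProj, fourier_coe_apply]
  rw [← Complex.exp_sum, phase_apply]
  congr 1
  push_cast
  rw [Finset.mul_sum]
  exact Finset.sum_congr rfl fun i _ => by ring

theorem norm_mFourier_apply (k : Fin d → ℤ) (x : Torus d) : ‖mFourier k x‖ = 1 := by
  obtain ⟨v, rfl⟩ := torusProj_surjective x
  rw [mFourier_torusProj, mul_comm]
  exact Complex.norm_exp_ofReal_mul_I _

theorem mFourier_add_apply (k : Fin d → ℤ) (x y : Torus d) :
    mFourier k (x + y) = mFourier k x * mFourier k y := by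
  obtain ⟨v, rfl⟩ := torusProj_surjective x
  obtain ⟨w, rfl⟩ := torusProj_surjective y
  rw [← torusProj_add, mFourier_torusProj, mFourier_torusProj, mFourier_torusProj, ← Complex.exp_add]
  congr 1
  push_cast [map_add]
  ring

end Torus

/-! ### Weighted Wiener algebras of Fourier series. -/

section Wiener

variable {d : ℕ}

/-- A symmetric submultiplicative weight on `ℤ^d` that grows at least linearly. -/
structure IsWeight (W : (Fin d → ℤ) → ℝ) : Prop where
  one_le : ∀ k, 1 ≤ W k
  submul : ∀ k l, W (k + l) ≤ W k * W l
  neg : ∀ k, W (-k) = W k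
  linear : ∃ C, 0 < C ∧ ∀ k, 1 + ‖k‖ ≤ C * W k

/-- The coefficient condition of the weighted Wiener class of exponent `t`. -/
def HasDecay (W : (Fin d → ℤ) → ℝ) (t : ℝ) (a : (Fin d → ℤ) → ℂ) : Prop :=
  Summable fun k => W k ^ t * ‖a k‖

/-- The function on the torus with Fourier coefficients `a`. -/
noncomputable def fourierSum (a : (Fin d → ℤ) → ℂ) (x : Torus d) : ℂ := ∑' k, a k * mFourier k x

/-- The weighted Wiener class of exponent `t`. -/
def WienerClass (W : (Fin d → ℤ) → ℝ) (t : ℝ) : Set (Torus d → ℂ) :=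
  {g | ∃ a, HasDecay W t a ∧ g = fourierSum a}

variable {W : (Fin d → ℤ) → ℝ} {t : ℝ} {a b : (Fin d → ℤ) → ℂ}

theorem IsWeight.pos (hW : IsWeight W) (k) : 0 < W k := zero_lt_one.trans_le (hW.one_le k)

theorem HasDecay.mono (hW : IsWeight W) {t' : ℝ} (h : t' ≤ t) (ha : HasDecay W t a) :
    HasDecay W t' a :=
  Summable.of_nonneg_of_le (fun k => mul_nonneg (Real.rpow_nonneg (hW.pos k).le _) (norm_nonneg _))
    (fun k => mul_le_mul_of_nonneg_right (Real.rpow_le_rpow_of_exponent_le (hW.one_le k) h)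
      (norm_nonneg _)) ha

theorem WienerClass.mono (hW : IsWeight W) {t' : ℝ} (h : t' ≤ t) :
    WienerClass W t ⊆ WienerClass W t' := by
  rintro _ ⟨a, ha, rfl⟩
  exact ⟨a, ha.mono hW h, rfl⟩

theorem HasDecay.summable_norm (hW : IsWeight W) (ht : 0 ≤ t) (ha : HasDecay W t a) :
    Summable fun k => ‖a k‖ := by
  have := ha.mono hW ht
  simpa [HasDecay] using this

theorem summable_norm_mul_mFourier (ha : Summable fun k => ‖a k‖) (x : Torus d) :
    Summable fun k => ‖a k * mFourier k x‖ := by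
  simpa [norm_mul, norm_mFourier_apply] using ha

theorem hasSum_fourierSum (ha : Summable fun k => ‖a k‖) (x : Torus d) :
    HasSum (fun k => a k * mFourier k x) (fourierSum a x) :=
  (summable_norm_mul_mFourier ha x).of_norm.hasSum

theorem norm_fourierSum_le (ha : Summable fun k => ‖a k‖) (x : Torus d) :
    ‖fourierSum a x‖ ≤ ∑' k, ‖a k‖ := by
  refine (norm_tsum_le_tsum_norm (summable_norm_mul_mFourier ha x)).trans_eq ?_
  simp [norm_mFourier_apply]

theorem WienerClass.bounded (hW : IsWeight W) (ht : 0 ≤ t) {g : Torus d → ℂ}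
    (hg : g ∈ WienerClass W t) : ∃ C, ∀ x, ‖g x‖ ≤ C := by
  obtain ⟨a, ha, rfl⟩ := hg
  exact ⟨_, norm_fourierSum_le (ha.summable_norm hW ht)⟩

theorem HasDecay.add (ha : HasDecay W t a) (hb : HasDecay W t b) (hW : IsWeight W) :
    HasDecay W t (a + b) := by
  refine Summable.of_nonneg_of_le
    (fun k => mul_nonneg (Real.rpow_nonneg (hW.pos k).le _) (norm_nonneg _)) (fun k => ?_)
    (Summable.add ha hb)
  rw [← mul_add]
  exact mul_le_mul_of_nonneg_left (norm_add_le _ _) (Real.rpow_nonneg (hW.pos k).le _)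

/-- If the coefficients are multiplied by factors of at most polynomial size `σ`, the exponent
drops by `σ`. -/
theorem HasDecay.mul_factor (hW : IsWeight W) {σ K : ℝ} {m : (Fin d → ℤ) → ℂ} 
    (hm : ∀ k, ‖m k‖ ≤ K * W k ^ σ) (ha : HasDecay W t a) :
    HasDecay W (t - σ) fun k => m k * a k := by
  refine Summable.of_nonneg_of_le
    (fun k => mul_nonneg (Real.rpow_nonneg (hW.pos k).le _) (norm_nonneg _)) (fun k => ?_)
    (Summable.mul_left K ha)
  rw [norm_mul, Real.rpow_sub (hW.pos k)]
  have h1 := Real.rpow_pos_of_pos (hW.pos k) σ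
  have h2 := Real.rpow_pos_of_pos (hW.pos k) t
  calc W k ^ t / W k ^ σ * (‖m k‖ * ‖a k‖) ≤ W k ^ t / W k ^ σ * (K * W k ^ σ * ‖a k‖) := by
        gcongr; exact hm k
    _ = K * (W k ^ t * ‖a k‖) := by field_simp

theorem HasDecay.bounded_factor (hW : IsWeight W) {K : ℝ} {m : (Fin d → ℤ) → ℂ} 
    (hm : ∀ k, ‖m k‖ ≤ K) (ha : HasDecay W t a) : HasDecay W t fun k => m k * a k := by
  simpa using ha.mul_factor hW (σ := 0) (K := K) (m := m) (by simpa using hm)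

/-- Convolution of coefficient families. -/
noncomputable def convolve (a b : (Fin d → ℤ) → ℂ) (k : Fin d → ℤ) : ℂ := ∑' l, a (k - l) * b l

/-- The shear `(k, l) ↦ (k - l, l)` of pairs. -/
def shearEquiv (G : Type*) [AddCommGroup G] : G × G ≃ G × G where
  toFun z := (z.1 - z.2, z.2)
  invFun z := (z.1 + z.2, z.2)
  left_inv z := by simp
  right_inv z := by simp

/-- Submultiplicativity gives `W k ^ t ≤ W (k - l) ^ t * W l ^ t` for `t ≥ 0`, so the weighted norm
of a convolution is at most the product of the weighted norms. -/
theorem HasDecay.convolve (hW : IsWeight W) (ht : 0 ≤ t) (ha : HasDecay W t a)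
    (hb : HasDecay W t b) : HasDecay W t (convolve a b) := by
  have h1 : Summable fun z : (Fin d → ℤ) × (Fin d → ℤ) =>
      (W (z.1 - z.2) ^ t * ‖a (z.1 - z.2)‖) * (W z.2 ^ t * ‖b z.2‖) := by
    have := Summable.mul_of_nonneg ha hb
      (fun k => mul_nonneg (Real.rpow_nonneg (hW.pos k).le _) (norm_nonneg _))
      (fun k => mul_nonneg (Real.rpow_nonneg (hW.pos k).le _) (norm_nonneg _))
    exact (shearEquiv (Fin d → ℤ)).summable_iff.2 this
  have h0 : Summable fun z : (Fin d → ℤ) × (Fin d → ℤ) => ‖a (z.1 - z.2) * b z.2‖ := by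
    have := (ha.summable_norm hW ht).mul_norm (hb.summable_norm hW ht)
    have := (shearEquiv (Fin d → ℤ)).summable_iff.2 this
    simpa [Function.comp_def, shearEquiv] using this
  refine Summable.of_nonneg_of_le
    (fun k => mul_nonneg (Real.rpow_nonneg (hW.pos k).le _) (norm_nonneg _)) (fun k => ?_) h1.prod
  have h2 := h0.prod_factor k
  calc W k ^ t * ‖ResonantAveraging.convolve a b k‖ ≤ W k ^ t * ∑' l, ‖a (k - l) * b l‖ := by
        gcongr
        · exact Real.rpow_nonneg (hW.pos k).le _
        · exact norm_tsum_le_tsum_norm h2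
    _ = ∑' l, W k ^ t * ‖a (k - l) * b l‖ := by rw [tsum_mul_left]
    _ ≤ _ := by
        refine Summable.tsum_le_tsum (fun l => ?_) (h2.mul_left _) (h1.prod_factor k)
        have : W k ^ t ≤ W (k - l) ^ t * W l ^ t := by
          rw [← Real.mul_rpow (hW.pos _).le (hW.pos _).le]
          exact Real.rpow_le_rpow (hW.pos k).le (by simpa using hW.submul (k - l) l) ht
        rw [norm_mul]
        calc W k ^ t * (‖a (k - l)‖ * ‖b l‖)
            ≤ (W (k - l) ^ t * W l ^ t) * (‖a (k - l)‖ * ‖b l‖) := by gcongr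
          _ = _ := by ring

theorem tsum_mul_tsum_eq_tsum_sub {G : Type*} [AddCommGroup G] {u v : G → ℂ}
    (hu : Summable fun k => ‖u k‖) (hv : Summable fun k => ‖v k‖) :
    (∑' k, u k) * (∑' k, v k) = ∑' k, ∑' l, u (k - l) * v l := by
  rw [tsum_mul_tsum_of_summable_norm hu hv, ← (shearEquiv G).tsum_eq]
  exact ((shearEquiv G).summable_iff.2 (summable_mul_of_summable_norm hu hv)).tsum_prod

theorem fourierSum_mul (ha : Summable fun k => ‖a k‖) (hb : Summable fun k => ‖b k‖) :
    fourierSum a * fourierSum b = fourierSum (convolve a b) := by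
  funext x
  refine (tsum_mul_tsum_eq_tsum_sub (summable_norm_mul_mFourier ha x)
    (summable_norm_mul_mFourier hb x)).trans (tsum_congr fun k => ?_)
  rw [convolve, ← tsum_mul_right]
  refine tsum_congr fun l => ?_
  have h6 : mFourier k x = mFourier (k - l) x * mFourier l x := by
    rw [← mFourier_add, sub_add_cancel]
  rw [h6]
  ring

theorem fourierSum_add (ha : Summable fun k => ‖a k‖) (hb : Summable fun k => ‖b k‖) :
    fourierSum a + fourierSum b = fourierSum (a + b) := by
  funext x
  have := (hasSum_fourierSum ha x).add (hasSum_fourierSum hb x)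
  rw [Pi.add_apply, ← this.tsum_eq]
  exact tsum_congr fun k => by simp [add_mul]

theorem fourierSum_single (c : ℂ) : fourierSum (Pi.single (0 : Fin d → ℤ) c) = fun _ => c := by
  funext x
  rw [fourierSum, tsum_eq_single 0]
  · simp [mFourier_zero]
  · intro k hk; simp [hk]

/-- The weighted Wiener class is an algebra. -/
noncomputable def wienerAlgebra (hW : IsWeight W) (ht : 0 ≤ t) : Subalgebra ℂ (Torus d → ℂ) where
  carrier := WienerClass W t
  mul_mem' := by
    rintro _ _ ⟨a, ha, rfl⟩ ⟨b, hb, rfl⟩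
    exact ⟨_, ha.convolve hW ht hb, fourierSum_mul (ha.summable_norm hW ht) (hb.summable_norm hW ht)⟩
  add_mem' := by
    rintro _ _ ⟨a, ha, rfl⟩ ⟨b, hb, rfl⟩
    exact ⟨_, ha.add hb hW, fourierSum_add (ha.summable_norm hW ht) (hb.summable_norm hW ht)⟩
  algebraMap_mem' := by
    intro c
    refine ⟨Pi.single 0 c, ?_, (fourierSum_single c).symm⟩
    refine summable_of_ne_finset_zero (s := {0}) fun k hk => ?_
    rw [Finset.mem_singleton] at hk
    simp [hk]

@[simp] theorem mem_wienerAlgebra (hW : IsWeight W) (ht : 0 ≤ t) {g : Torus d → ℂ} :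
    g ∈ wienerAlgebra hW ht ↔ g ∈ WienerClass W t := Iff.rfl

theorem WienerClass.translate (hW : IsWeight W) {g : Torus d → ℂ} (hg : g ∈ WienerClass W t)
    (y : Torus d) : (fun x => g (x + y)) ∈ WienerClass W t := by
  obtain ⟨a, ha, rfl⟩ := hg
  refine ⟨fun k => mFourier k y * a k,
    ha.bounded_factor hW (K := 1) fun k => (norm_mFourier_apply k y).le, ?_⟩
  funext x
  exact tsum_congr fun k => by rw [mFourier_add_apply]; ring

/-- Conjugation reflects the index, which is harmless for a symmetric weight. It serves to take real
parts. -/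
theorem WienerClass.conj (hW : IsWeight W) {g : Torus d → ℂ} (hg : g ∈ WienerClass W t) :
    (fun x => (starRingEnd ℂ) (g x)) ∈ WienerClass W t := by
  obtain ⟨a, ha, rfl⟩ := hg
  refine ⟨fun k => (starRingEnd ℂ) (a (-k)), ?_, ?_⟩
  · have := (Equiv.neg (Fin d → ℤ)).summable_iff.2 ha
    simpa [HasDecay, Function.comp_def, hW.neg] using this
  · funext x
    simp only [fourierSum]
    rw [Complex.conj_tsum, ← (Equiv.neg (Fin d → ℤ)).tsum_eq]
    refine tsum_congr fun k => ?_
    rw [map_mul, Equiv.neg_apply, ← mFourier_neg, neg_neg]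

theorem WienerClass.re (hW : IsWeight W) (ht : 0 ≤ t) {g : Torus d → ℂ}
    (hg : g ∈ WienerClass W t) : (fun x => ((g x).re : ℂ)) ∈ WienerClass W t := by
  have h := (wienerAlgebra hW ht).smul_mem
    ((wienerAlgebra hW ht).add_mem (x := g) hg (WienerClass.conj hW hg)) (1 / 2 : ℂ)
  have h' : (fun x => ((g x).re : ℂ)) = (1 / 2 : ℂ) • (g + fun x => (starRingEnd ℂ) (g x)) := by
    funext x
    simp only [Pi.smul_apply, Pi.add_apply, smul_eq_mul]
    rw [Complex.add_conj]; push_cast; ring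
  rw [h']
  exact h

theorem norm_mFourier_sub_le (k : Fin d → ℤ) (x : Torus d) (v w : Fin d → ℝ) :
    ‖mFourier k (x + torusProj v) - mFourier k (x + torusProj w)‖
      ≤ 2 * Real.pi * d * (‖k‖ * ‖v - w‖) := by
  have h : mFourier k (x + torusProj v) - mFourier k (x + torusProj w)
      = mFourier k (x + torusProj w) * (Complex.exp (Complex.I * (phase k (v - w) : ℝ)) - 1) := by
    rw [← mFourier_torusProj, mul_sub, ← mFourier_add_apply, torusProj_sub]
    simp
  rw [h, norm_mul, norm_mFourier_apply, one_mul]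
  exact Real.norm_exp_I_mul_ofReal_sub_one_le.trans (abs_phase_le _ _)

theorem HasDecay.summable_one_add_norm_pow (hW : IsWeight W) {n : ℕ} (ht : (n : ℝ) ≤ t)
    (ha : HasDecay W t a) : Summable fun k => (1 + ‖k‖) ^ n * ‖a k‖ := by
  obtain ⟨C, hC, h⟩ := hW.linear
  refine Summable.of_nonneg_of_le (fun k => by positivity) (fun k => ?_)
    ((ha.mono hW ht).mul_left (C ^ n))
  rw [Real.rpow_natCast, ← mul_assoc, ← mul_pow]
  gcongr
  exact h k

/-- Functions of a Wiener class of exponent at least one are Lipschitz. -/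
theorem WienerClass.lipschitz (hW : IsWeight W) (ht : 1 ≤ t) {g : Torus d → ℂ}
    (hg : g ∈ WienerClass W t) : ∃ K, 0 ≤ K ∧ ∀ (x : Torus d) (v w : Fin d → ℝ),
      ‖g (x + torusProj v) - g (x + torusProj w)‖ ≤ K * ‖v - w‖ := by
  obtain ⟨a, ha, rfl⟩ := hg
  have h1 := ha.summable_one_add_norm_pow hW (n := 1) (by simpa using ht)
  have h0 := ha.summable_norm hW (zero_le_one.trans ht)
  refine ⟨2 * Real.pi * d * ∑' k, (1 + ‖k‖) ^ 1 * ‖a k‖, by positivity, fun x v w => ?_⟩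
  have hs := (hasSum_fourierSum h0 (x + torusProj v)).sub (hasSum_fourierSum h0 (x + torusProj w))
  rw [mul_right_comm, ← tsum_mul_left]
  refine hs.norm_le_of_bounded (h1.mul_left _).hasSum fun k => ?_
  rw [← mul_sub, norm_mul]
  calc ‖a k‖ * ‖mFourier k (x + torusProj v) - mFourier k (x + torusProj w)‖
      ≤ ‖a k‖ * (2 * Real.pi * d * (‖k‖ * ‖v - w‖)) := by
        gcongr; exact norm_mFourier_sub_le k x v w
    _ ≤ ‖a k‖ * (2 * Real.pi * d * ((1 + ‖k‖) * ‖v - w‖)) := by gcongr; linarith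
    _ = _ := by ring

end Wiener

/-! ### Differentiability of functions in Wiener classes. -/

section Smooth

variable {d : ℕ} {W : (Fin d → ℤ) → ℝ} {t : ℝ} {a : (Fin d → ℤ) → ℂ}

theorem hasFDerivAt_mFourier (k : Fin d → ℤ) (v : Fin d → ℝ) :
    HasFDerivAt (fun v => mFourier k (torusProj v))
      ((phase k).smulRight (Complex.I * mFourier k (torusProj v))) v := by
  simp only [mFourier_torusProj]
  have h1 : HasFDerivAt (fun v => Complex.I * ((phase k v : ℝ) : ℂ))
      (Complex.I • (Complex.ofRealCLM.comp (phase k))) v :=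
    ((Complex.ofRealCLM.comp (phase k)).hasFDerivAt).const_mul Complex.I
  refine h1.cexp.congr_fderiv ?_
  ext w
  simp [mul_comm, mul_left_comm]

/-- The coefficients of the `i`-th partial derivative. -/
noncomputable def derivCoeff (i : Fin d) (a : (Fin d → ℤ) → ℂ) (k : Fin d → ℤ) : ℂ :=
  (2 * Real.pi * (k i : ℝ) * Complex.I) * a k

theorem HasDecay.derivCoeff (hW : IsWeight W) (ha : HasDecay W t a) (i : Fin d) :
    HasDecay W (t - 1) (derivCoeff i a) := by
  obtain ⟨C, hC, h⟩ := hW.linear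
  refine ha.mul_factor hW (σ := 1) (K := 2 * Real.pi * C) fun k => ?_
  have h1 := abs_coord_le_norm k i
  have h2 := h k
  simp only [norm_mul, Complex.norm_I, mul_one, Complex.norm_ofNat, Complex.norm_real,
    Real.norm_eq_abs, abs_of_pos Real.pi_pos, Real.rpow_one]
  rw [mul_assoc (2 * Real.pi)]
  gcongr
  linarith

/-- The series is differentiated term by term: the derivatives are bounded by a constant times `‖k‖
* ‖a k‖`, which is summable because `t ≥ 1`. -/
theorem hasFDerivAt_fourierSum (hW : IsWeight W) (ht : 1 ≤ t) (ha : HasDecay W t a)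
    (v : Fin d → ℝ) :
    HasFDerivAt (periodicLift (fourierSum a))
      (∑ i, (ContinuousLinearMap.proj i : (Fin d → ℝ) →L[ℝ] ℝ).smulRight
        (fourierSum (derivCoeff i a) (torusProj v))) v := by
  have h1 := ha.summable_one_add_norm_pow hW (n := 1) (by simpa using ht)
  have h0 := ha.summable_norm hW (zero_le_one.trans ht)
  have hd : ∀ i, Summable fun k => ‖derivCoeff i a k‖ := fun i =>
    (ha.derivCoeff hW i).summable_norm hW (by linarith)
  have key := hasFDerivAt_tsum (𝕜 := ℝ) (u := fun k => (2 * Real.pi * d) * ((1 + ‖k‖) ^ 1 * ‖a k‖))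
    (f := fun (k : Fin d → ℤ) v => a k * mFourier k (torusProj v))
    (f' := fun k v => a k • (phase k).smulRight (Complex.I * mFourier k (torusProj v)))
    (x₀ := 0) (h1.mul_left _) (fun k v => (hasFDerivAt_mFourier k v).const_mul (a k)) (fun k v => by
      rw [norm_smul, ContinuousLinearMap.norm_smulRight_apply, norm_mul, norm_mFourier_apply,
        Complex.norm_I, mul_one, mul_one]
      calc ‖a k‖ * ‖phase k‖ ≤ ‖a k‖ * (2 * Real.pi * d * ‖k‖) := by
            gcongr; exact norm_phase_le k
        _ ≤ ‖a k‖ * (2 * Real.pi * d * (1 + ‖k‖)) := by gcongr; linarith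
        _ = _ := by ring)
    (summable_norm_mul_mFourier h0 _).of_norm v
  refine HasFDerivAt.congr_fderiv key ?_
  refine HasSum.tsum_eq ?_
  have h2 : ∀ i ∈ Finset.univ, HasSum (fun k =>
      (ContinuousLinearMap.proj i : (Fin d → ℝ) →L[ℝ] ℝ).smulRight
        (derivCoeff i a k * mFourier k (torusProj v)))
      ((ContinuousLinearMap.proj i : (Fin d → ℝ) →L[ℝ] ℝ).smulRight
        (fourierSum (derivCoeff i a) (torusProj v))) := fun i _ =>
    (hasSum_fourierSum (hd i) (torusProj v)).mapL
      (ContinuousLinearMap.smulRightL ℝ (Fin d → ℝ) ℂ (ContinuousLinearMap.proj i))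
  convert hasSum_sum h2 using 1
  funext k
  ext w
  simp only [_root_.smul_apply, ContinuousLinearMap.smulRight_apply,
    _root_.sum_apply, phase_apply, ContinuousLinearMap.proj_apply, derivCoeff,
    Complex.real_smul, smul_eq_mul]
  push_cast
  rw [Finset.sum_mul, Finset.mul_sum]
  exact Finset.sum_congr rfl fun i _ => by ring

theorem continuous_fourierSum (ha : Summable fun k => ‖a k‖) : Continuous (fourierSum a) := by
  refine continuous_tsum (fun k => ?_) ha fun k x => ?_
  · exact continuous_const.mul (mFourier k).continuous
  · rw [norm_mul, norm_mFourier_apply, mul_one]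

theorem WienerClass.continuous (hW : IsWeight W) (ht : 0 ≤ t) {g : Torus d → ℂ}
    (hg : g ∈ WienerClass W t) : Continuous g := by
  obtain ⟨a, ha, rfl⟩ := hg
  exact continuous_fourierSum (ha.summable_norm hW ht)

/-- Functions of a Wiener class of exponent `t ≥ n` are of class `C^n`. -/
theorem WienerClass.contDiff (hW : IsWeight W) (n : ℕ) : ∀ {t : ℝ}, (n : ℝ) ≤ t →
    ∀ {g : Torus d → ℂ}, g ∈ WienerClass W t → ContDiff ℝ n (periodicLift g) := by
  induction n with
  | zero =>
    intro t ht g hg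
    exact contDiff_zero.2 (continuous_iff_periodicLift.1
      (WienerClass.continuous hW (by simpa using ht) hg))
  | succ n ih =>
    rintro t ht _ ⟨a, ha, rfl⟩
    push_cast at ht ⊢
    have hn : (0 : ℝ) ≤ n := n.cast_nonneg
    rw [contDiff_succ_iff_hasFDerivAt]
    refine ⟨_, ?_, hasFDerivAt_fourierSum hW (by linarith) ha⟩
    refine ContDiff.sum fun i _ => ?_
    have h1 := ih (t := t - 1) (by linarith) ⟨_, ha.derivCoeff hW i, rfl⟩
    exact (ContinuousLinearMap.smulRightL ℝ (Fin d → ℝ) ℂ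
      (ContinuousLinearMap.proj i)).contDiff.comp h1

/-- A vector-valued function all of whose components belong to a Wiener class. -/
def VectorClass {e : ℕ} (W : (Fin d → ℤ) → ℝ) (t : ℝ) (g : Torus d → (Fin e → ℝ)) : Prop :=
  ∀ i, (fun x => ((g x i : ℝ) : ℂ)) ∈ WienerClass W t

theorem VectorClass.mono (hW : IsWeight W) {e : ℕ} {g : Torus d → (Fin e → ℝ)} {t' : ℝ}
    (hg : VectorClass W t g) (h : t' ≤ t) : VectorClass W t' g :=
  fun i => WienerClass.mono hW h (hg i)

theorem torusContDiff_of_complex {e : ℕ} {κ : WithTop ℕ∞} {g : Torus d → (Fin e → ℝ)}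
    (h : ∀ i, ContDiff ℝ κ (periodicLift fun x => ((g x i : ℝ) : ℂ))) : TorusContDiff κ g := by
  refine contDiff_pi.2 fun i => ?_
  exact Complex.reCLM.contDiff.comp (h i)

theorem VectorClass.torusContDiff (hW : IsWeight W) {e : ℕ} {g : Torus d → (Fin e → ℝ)} {n : ℕ}
    (hg : VectorClass W t g) (h : (n : ℝ) ≤ t) : TorusContDiff n g :=
  torusContDiff_of_complex fun i => WienerClass.contDiff hW n h (hg i)

theorem VectorClass.lipschitz (hW : IsWeight W) {e : ℕ} {g : Torus d → (Fin e → ℝ)}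
    (hg : VectorClass W t g) (ht : 1 ≤ t) : ∃ K, 0 ≤ K ∧ ∀ (x : Torus d) (v w : Fin d → ℝ),
      ‖g (x + torusProj v) - g (x + torusProj w)‖ ≤ K * ‖v - w‖ := by
  choose K hK0 hK using fun i => WienerClass.lipschitz hW ht (hg i)
  refine ⟨∑ i, K i, Finset.sum_nonneg fun i _ => hK0 i, fun x v w => ?_⟩
  refine (pi_norm_le_iff_of_nonneg (mul_nonneg (Finset.sum_nonneg fun i _ => hK0 i)
    (norm_nonneg _))).2 fun i => ?_
  have h1 := hK i x v w
  rw [← Complex.ofReal_sub, Complex.norm_real] at h1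
  refine h1.trans (mul_le_mul_of_nonneg_right ?_ (norm_nonneg _))
  exact Finset.single_le_sum (f := K) (fun i _ => hK0 i) (Finset.mem_univ i)

theorem VectorClass.bounded (hW : IsWeight W) {e : ℕ} {g : Torus d → (Fin e → ℝ)}
    (hg : VectorClass W t g) (ht : 0 ≤ t) : ∃ K, 0 ≤ K ∧ ∀ x, ‖g x‖ ≤ K := by
  choose K hK using fun i => WienerClass.bounded hW ht (hg i)
  have hK0 : ∀ i, 0 ≤ K i := fun i => (norm_nonneg _).trans (hK i 0)
  refine ⟨∑ i, K i, Finset.sum_nonneg fun i _ => hK0 i, fun x => ?_⟩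
  refine (pi_norm_le_iff_of_nonneg (Finset.sum_nonneg fun i _ => hK0 i)).2 fun i => ?_
  have h1 := hK i x
  rw [Complex.norm_real] at h1
  exact h1.trans (Finset.single_le_sum (f := K) (fun i _ => hK0 i) (Finset.mem_univ i))

end Smooth

/-! ### The two weights, and analyticity under exponential decay. -/

section Analytic

variable {d : ℕ}

/-- The weight of real analytic functions. -/
noncomputable def expWeight (d : ℕ) (c : ℝ) (k : Fin d → ℤ) : ℝ := Real.exp (c * ‖k‖)

theorem isWeight_expWeight {c : ℝ} (hc : 0 < c) : IsWeight (expWeight d c) where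
  one_le k := Real.one_le_exp (by positivity)
  submul k l := by
    rw [expWeight, expWeight, expWeight, ← Real.exp_add, ← mul_add]
    exact Real.exp_le_exp.2 (mul_le_mul_of_nonneg_left (norm_add_le k l) hc.le)
  neg k := by simp [expWeight]
  linear := by
    refine ⟨1 + 1 / c, by positivity, fun k => ?_⟩
    have h1 := Real.add_one_le_exp (c * ‖k‖)
    have h2 : ‖k‖ = 1 / c * (c * ‖k‖) := by field_simp
    have h3 : 1 ≤ Real.exp (c * ‖k‖) := Real.one_le_exp (by positivity)
    have h4 : 1 / c * (c * ‖k‖) ≤ 1 / c * Real.exp (c * ‖k‖) := by gcongr; linarith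
    unfold expWeight
    linarith

/-- The polynomial weight. -/
noncomputable def polyWeight (d : ℕ) (k : Fin d → ℤ) : ℝ := 1 + ‖k‖

theorem isWeight_polyWeight : IsWeight (polyWeight d) where
  one_le k := by simp [polyWeight]
  submul k l := by
    have := norm_add_le k l
    have := mul_nonneg (norm_nonneg k) (norm_nonneg l)
    simp only [polyWeight]; nlinarith
  neg k := by simp [polyWeight]
  linear := ⟨1, one_pos, fun k => by simp [polyWeight]⟩

/-- The `n`-th term of the exponential series of the form `i φ`. -/
noncomputable def expTerm (φ : (Fin d → ℝ) →L[ℝ] ℝ) (n : ℕ) :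
    (Fin d → ℝ) [×n]→L[ℝ] ℂ :=
  ((n.factorial : ℝ)⁻¹) • (ContinuousMultilinearMap.mkPiAlgebraFin ℝ n ℂ).compContinuousLinearMap
    fun _ => Complex.I • Complex.ofRealCLM.comp φ

theorem expTerm_apply (φ : (Fin d → ℝ) →L[ℝ] ℝ) (n : ℕ) (y : Fin d → ℝ) :
    expTerm φ n (fun _ => y) = (Complex.I * (φ y : ℝ)) ^ n / n.factorial := by
  simp [expTerm, div_eq_inv_mul]

theorem norm_expTerm_le (φ : (Fin d → ℝ) →L[ℝ] ℝ) (n : ℕ) :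
    ‖expTerm φ n‖ ≤ ‖φ‖ ^ n / n.factorial := by
  rw [expTerm, norm_smul, div_eq_inv_mul, norm_inv, Real.norm_natCast]
  gcongr
  refine (ContinuousMultilinearMap.norm_compContinuousLinearMap_le _ _).trans ?_
  have h : ‖Complex.I • Complex.ofRealCLM.comp φ‖ ≤ ‖φ‖ := by
    rw [norm_smul, Complex.norm_I, one_mul]
    refine (ContinuousLinearMap.opNorm_comp_le _ _).trans ?_
    simp
  rw [ContinuousMultilinearMap.norm_mkPiAlgebraFin, one_mul, Finset.prod_const]
  simp only [Finset.card_univ, Fintype.card_fin]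
  gcongr

/-- Expanding every exponential gives a double series that converges absolutely on the ball of
radius `r`. Summing over the index set first produces the power series. -/
theorem analyticAt_tsum_exp {ι : Type*} {b : ι → ℂ} {φ : ι → (Fin d → ℝ) →L[ℝ] ℝ} {r : ℝ}
    (hr : 0 < r) (hb : Summable fun k => ‖b k‖ * Real.exp (‖φ k‖ * r)) :
    AnalyticAt ℝ (fun y : Fin d → ℝ => ∑' k, b k * Complex.exp (Complex.I * (φ k y : ℝ))) 0 := by
  have hn : ∀ n k, ‖b k • expTerm (φ k) n‖ * r ^ n ≤ ‖b k‖ * Real.exp (‖φ k‖ * r) := by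
    intro n k
    rw [norm_smul, mul_assoc]
    gcongr
    calc ‖expTerm (φ k) n‖ * r ^ n ≤ ‖φ k‖ ^ n / n.factorial * r ^ n := by
          gcongr; exact norm_expTerm_le _ _
      _ = (‖φ k‖ * r) ^ n / n.factorial := by rw [mul_pow]; ring
      _ ≤ Real.exp (‖φ k‖ * r) := Real.pow_div_factorial_le_exp _ (by positivity) n
  have hs : ∀ n, Summable fun k => ‖b k • expTerm (φ k) n‖ := fun n => by
    have h := Summable.of_nonneg_of_le (fun k => by positivity) (hn n) hb
    exact (summable_mul_right_iff (pow_ne_zero n hr.ne')).1 h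
  let p : FormalMultilinearSeries ℝ (Fin d → ℝ) ℂ := fun n => ∑' k, b k • expTerm (φ k) n
  have hp : ∀ n y, HasSum (fun k => b k * ((Complex.I * (φ k y : ℝ)) ^ n / n.factorial))
      (p n fun _ => y) := fun n y => by
    have h := (hs n).of_norm.hasSum.mapL
      (ContinuousMultilinearMap.apply ℝ (fun _ : Fin n => Fin d → ℝ) ℂ (fun _ => y))
    simpa [expTerm_apply] using h
  refine ⟨p, ENNReal.ofReal r, ?_, by simpa using hr, ?_⟩
  · refine p.le_radius_of_bound (∑' k, ‖b k‖ * Real.exp (‖φ k‖ * r)) fun n => ?_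
    rw [Real.coe_toNNReal r hr.le]
    have h := norm_tsum_le_tsum_norm (hs n)
    calc ‖p n‖ * r ^ n ≤ (∑' k, ‖b k • expTerm (φ k) n‖) * r ^ n := by gcongr
      _ = ∑' k, ‖b k • expTerm (φ k) n‖ * r ^ n := by rw [tsum_mul_right]
      _ ≤ _ := Summable.tsum_le_tsum (hn n) ((hs n).mul_right _) hb
  · intro y hy
    have hy' : ‖y‖ < r := by
      rwa [Metric.eball_ofReal, mem_ball_zero_iff] at hy
    have hsum : Summable fun z : ι × ℕ =>
        b z.1 * ((Complex.I * (φ z.1 y : ℝ)) ^ z.2 / z.2.factorial) := by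
      refine Summable.of_norm ?_
      have hz : ∀ k, HasSum (fun n : ℕ => ‖b k * ((Complex.I * (φ k y : ℝ)) ^ n / n.factorial)‖)
          (‖b k‖ * Real.exp |φ k y|) := by
        intro k
        have h := (NormedSpace.expSeries_div_hasSum_exp |φ k y|).mul_left ‖b k‖
        rw [← Real.exp_eq_exp_ℝ] at h
        simpa using h
      rw [summable_prod_of_nonneg fun _ => norm_nonneg _]
      refine ⟨fun k => (hz k).summable, ?_⟩
      simp only [fun k => (hz k).tsum_eq]
      refine Summable.of_nonneg_of_le (fun k => by positivity) (fun k => ?_) hb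
      gcongr
      refine ((φ k).le_opNorm y).trans ?_
      gcongr
    have h1 := hsum.prod_symm.hasSum.prod_fiberwise fun n => hp n y
    suffices h2 : (∑' k, b k * Complex.exp (Complex.I * (φ k (0 + y) : ℝ))) =
        ∑' z : ℕ × ι, b z.swap.1 * ((Complex.I * (φ z.swap.1 y : ℝ)) ^ z.swap.2
          / z.swap.2.factorial) by
      rw [h2]; exact h1
    rw [zero_add, ← (Equiv.prodComm ι ℕ).tsum_eq]
    simp only [Equiv.prodComm_apply, Prod.swap_swap]
    rw [hsum.tsum_prod]
    refine tsum_congr fun k => ?_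
    dsimp only
    rw [tsum_mul_left, Complex.exp_eq_exp_ℂ, NormedSpace.exp_eq_tsum_div]

/-- Functions with exponentially decaying Fourier coefficients are real analytic. -/
theorem WienerClass.analytic {c t : ℝ} (hc : 0 < c) (ht : 0 < t) {g : Torus d → ℂ}
    (hg : g ∈ WienerClass (expWeight d c) t) : ContDiff ℝ ⊤ (periodicLift g) := by
  obtain ⟨a, ha, rfl⟩ := hg
  have h : AnalyticOnNhd ℝ (periodicLift (fourierSum a)) Set.univ := by
    intro x _
    -- This radius makes `‖phase k‖ * r ≤ c * t * ‖k‖`; the added `1` keeps the denominator positive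
    -- when `d = 0`.
    let r : ℝ := c * t / (2 * Real.pi * d + 1)
    have hr : 0 < r := by positivity
    have h1 : AnalyticAt ℝ (fun y : Fin d → ℝ => ∑' k, (a k * mFourier k (torusProj x)) *
        Complex.exp (Complex.I * (phase k y : ℝ))) 0 := by
      refine analyticAt_tsum_exp hr (Summable.of_nonneg_of_le (fun k => by positivity)
        (fun k => ?_) ha)
      rw [norm_mul, norm_mFourier_apply, mul_one, mul_comm, expWeight, ← Real.exp_mul]
      refine mul_le_mul_of_nonneg_right (Real.exp_le_exp.2 ?_) (norm_nonneg _)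
      calc ‖phase k‖ * r ≤ (2 * Real.pi * d * ‖k‖) * r := by gcongr; exact norm_phase_le k
        _ ≤ ((2 * Real.pi * d + 1) * ‖k‖) * r := by gcongr; linarith
        _ = c * ‖k‖ * t := by simp only [r]; field_simp
    have h2 : periodicLift (fourierSum a) = (fun y : Fin d → ℝ =>
        ∑' k, (a k * mFourier k (torusProj x)) * Complex.exp (Complex.I * (phase k y : ℝ))) ∘
          fun z => z - x := by
      funext z
      simp only [periodicLift, fourierSum, Function.comp]
      refine tsum_congr fun k => ?_
      rw [← mFourier_torusProj, mul_assoc, ← mFourier_add_apply, ← torusProj_add]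
      simp
    rw [h2]
    refine AnalyticAt.comp (by simpa using h1) (by fun_prop)
  exact h.contDiff

theorem VectorClass.analytic {e : ℕ} {c t : ℝ} (hc : 0 < c) (ht : 0 < t)
    {g : Torus d → (Fin e → ℝ)} (hg : VectorClass (expWeight d c) t g) : TorusContDiff ⊤ g :=
  torusContDiff_of_complex fun i => WienerClass.analytic hc ht (hg i)

end Analytic

/-! ### Order estimates in `ε`, uniform in the space variable. -/

section Uniform

variable {X : Type} {I : Set ℝ}

/-- `u ε x = O(ε^M)` as `ε → 0` in `I`, uniformly in `x`. -/
def UniformO {E : Type} [Norm E] (I : Set ℝ) (u : ℝ → X → E) (M : ℕ) : Prop :=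
  (fun q : ℝ × X => u q.1 q.2) =O[𝓝[I] 0 ×ˢ ⊤] fun q => q.1 ^ M

/-- The only member of the filter `⊤` is the whole space, so the product filter encodes a threshold
in `ε` that does not depend on `x`. -/
theorem eventually_param_iff {P : ℝ → X → Prop} :
    (∀ᶠ q : ℝ × X in 𝓝[I] 0 ×ˢ ⊤, P q.1 q.2) ↔
      ∃ δ > 0, ∀ ε ∈ I, |ε| < δ → ∀ x, P ε x := by
  rw [eventually_prod_iff]
  constructor
  · rintro ⟨pa, ha, pb, hb, h⟩
    rw [eventually_nhdsWithin_iff, Metric.eventually_nhds_iff] at ha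
    obtain ⟨δ, hδ, ha⟩ := ha
    rw [eventually_top] at hb
    exact ⟨δ, hδ, fun ε hε hεδ x => h (ha (by simpa using hεδ) hε) (hb x)⟩
  · rintro ⟨δ, hδ, h⟩
    refine ⟨fun ε => ∀ x, P ε x, ?_, fun _ => True, by simp, fun hx y _ => hx y⟩
    rw [eventually_nhdsWithin_iff, Metric.eventually_nhds_iff]
    exact ⟨δ, hδ, fun ε hε hI => h ε hI (by simpa using hε)⟩

theorem uniformO_iff {E : Type} [SeminormedAddCommGroup E] {u : ℝ → X → E} {M : ℕ} :
    UniformO I u M ↔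
      ∃ K, 0 ≤ K ∧ ∃ δ > 0, ∀ ε ∈ I, |ε| < δ → ∀ x, ‖u ε x‖ ≤ K * |ε| ^ M := by
  rw [UniformO, isBigO_iff']
  constructor
  · rintro ⟨K, hK, h⟩
    rw [eventually_param_iff (P := fun ε x => ‖u ε x‖ ≤ K * ‖ε ^ M‖)] at h
    obtain ⟨δ, hδ, h⟩ := h
    exact ⟨K, hK.le, δ, hδ, fun ε hε hεδ x => by simpa using h ε hε hεδ x⟩
  · rintro ⟨K, hK, δ, hδ, h⟩
    refine ⟨K + 1, by positivity, (eventually_param_iff (P := fun ε x => _ ≤ _ * ‖ε ^ M‖)).2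
      ⟨δ, hδ, fun ε hε hεδ x => (h ε hε hεδ x).trans ?_⟩⟩
    rw [norm_pow, Real.norm_eq_abs]
    gcongr
    linarith

theorem uniformO_of_bound {E : Type} [SeminormedAddCommGroup E] {u : ℝ → X → E} {M : ℕ} {K : ℝ}
    (hK : 0 ≤ K) (h : ∀ ε ∈ I, ∀ x, ‖u ε x‖ ≤ K * |ε| ^ M) : UniformO I u M :=
  uniformO_iff.2 ⟨K, hK, 1, one_pos, fun ε hε _ x => h ε hε x⟩

variable {E : Type} [SeminormedAddCommGroup E] {u v : ℝ → X → E} {M M' : ℕ}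

theorem UniformO.add (hu : UniformO I u M) (hv : UniformO I v M) :
    UniformO I (fun ε x => u ε x + v ε x) M := IsBigO.add hu hv

theorem UniformO.sub (hu : UniformO I u M) (hv : UniformO I v M) :
    UniformO I (fun ε x => u ε x - v ε x) M := IsBigO.sub hu hv

theorem UniformO.sum {ι : Type*} {s : Finset ι} {u : ι → ℝ → X → E}
    (h : ∀ i ∈ s, UniformO I (u i) M) : UniformO I (fun ε x => ∑ i ∈ s, u i ε x) M :=
  IsBigO.fun_sum h

theorem UniformO.mono (hu : UniformO I u M) (h : M' ≤ M) : UniformO I u M' := by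
  obtain ⟨K, hK, δ, hδ, hu⟩ := uniformO_iff.1 hu
  -- Powers of `|ε|` decrease with the exponent only for `|ε| ≤ 1`.
  refine uniformO_iff.2 ⟨K, hK, min δ 1, by positivity, fun ε hε hεδ x => ?_⟩
  refine (hu ε hε (hεδ.trans_le (min_le_left _ _)) x).trans ?_
  gcongr K * ?_
  exact pow_le_pow_of_le_one (abs_nonneg _) (hεδ.trans_le (min_le_right _ _)).le h

theorem UniformO.congr (hu : UniformO I u M) (h : ∀ ε x, u ε x = v ε x) : UniformO I v M := by
  have : u = v := funext fun ε => funext fun x => h ε x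
  rwa [← this]

theorem UniformO.norm_le (hu : UniformO I u M) {F : Type} [SeminormedAddCommGroup F]
    {w : ℝ → X → F} {K : ℝ} (h : ∀ ε ∈ I, ∀ x, ‖w ε x‖ ≤ K * ‖u ε x‖) : UniformO I w M := by
  obtain ⟨L, hL, δ, hδ, hu⟩ := uniformO_iff.1 hu
  refine uniformO_iff.2 ⟨|K| * L, by positivity, δ, hδ, fun ε hε hεδ x => ?_⟩
  calc ‖w ε x‖ ≤ K * ‖u ε x‖ := h ε hε x
    _ ≤ |K| * (L * |ε| ^ M) := by
        gcongr
        · exact le_abs_self K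
        · exact hu ε hε hεδ x
    _ = _ := by ring

theorem UniformO.mul {u v : ℝ → X → ℂ} (hu : UniformO I u M) (hv : UniformO I v M') :
    UniformO I (fun ε x => u ε x * v ε x) (M + M') := by
  have := IsBigO.mul hu hv
  simpa only [UniformO, pow_add] using this

theorem UniformO.pow_smul [NormedSpace ℝ E] (hu : UniformO I u M) (i : ℕ) :
    UniformO I (fun ε x => ε ^ i • u ε x) (i + M) := by
  obtain ⟨K, hK, δ, hδ, hu⟩ := uniformO_iff.1 hu
  refine uniformO_iff.2 ⟨K, hK, δ, hδ, fun ε hε hεδ x => ?_⟩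
  rw [norm_smul, norm_pow, Real.norm_eq_abs, pow_add]
  have := hu ε hε hεδ x
  calc |ε| ^ i * ‖u ε x‖ ≤ |ε| ^ i * (K * |ε| ^ M) := by gcongr
    _ = _ := by ring

theorem uniformO_const {E : Type} [SeminormedAddCommGroup E] {g : X → E} {C : ℝ}
    (h : ∀ x, ‖g x‖ ≤ C) : UniformO I (fun _ x => g x) 0 := by
  refine uniformO_of_bound (abs_nonneg C) fun ε _ x => ?_
  simpa using (h x).trans (le_abs_self C)

theorem uniformO_pi {e : ℕ} {u : ℝ → X → (Fin e → ℝ)}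
    (h : ∀ i, UniformO I (fun ε x => u ε x i) M) : UniformO I u M := isBigO_pi.2 h

theorem UniformO.apply {e : ℕ} {u : ℝ → X → (Fin e → ℝ)} (h : UniformO I u M) (i : Fin e) :
    UniformO I (fun ε x => u ε x i) M := isBigO_pi.1 h i

theorem uniformO_ofReal {u : ℝ → X → ℝ} :
    UniformO I (fun ε x => (u ε x : ℂ)) M ↔ UniformO I u M := by
  rw [UniformO, UniformO, ← isBigO_norm_left]
  simp only [Complex.norm_real]
  rw [isBigO_norm_left]

theorem UniformO.re {u : ℝ → X → ℂ} (h : UniformO I u M) :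
    UniformO I (fun ε x => (u ε x).re) M :=
  h.norm_le (K := 1) fun ε _ x => by
    rw [one_mul]; exact Complex.abs_re_le_norm _

end Uniform

/-! ### Expansions in `ε` over an algebra of functions. -/

section Expansion

variable {X : Type} {I : Set ℝ} {S : Subalgebra ℂ (X → ℂ)} {M : ℕ}

/-- Evaluation of a polynomial in `ε` with coefficients in an algebra of functions. -/
noncomputable def polyEval (P : Polynomial S) (ε : ℝ) (x : X) : ℂ :=
  P.eval₂ ((Pi.evalRingHom (fun _ : X => ℂ) x).comp S.val.toRingHom) (ε : ℂ)

theorem uniformO_polyEval (hS : ∀ g ∈ S, ∃ C, ∀ x, ‖g x‖ ≤ C) (P : Polynomial S) :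
    UniformO I (polyEval P) 0 := by
  induction P using Polynomial.induction_on' with
  | add p q hp hq =>
    exact (hp.add hq).congr fun ε x => by simp [polyEval, Polynomial.eval₂_add]
  | monomial n g =>
    obtain ⟨C, hC⟩ := hS g.1 g.2
    have h := ((uniformO_const (I := I) hC).pow_smul n).mono (Nat.zero_le _)
    exact h.congr fun ε x => by simp [polyEval, mul_comm]

/-- The families that coincide up to `O(ε^M)` with a polynomial in `ε` with coefficients in `S`. -/
noncomputable def expansionAlgebra (I : Set ℝ) (S : Subalgebra ℂ (X → ℂ))
    (hS : ∀ g ∈ S, ∃ C, ∀ x, ‖g x‖ ≤ C) (M : ℕ) : Subalgebra ℂ (ℝ → X → ℂ) where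
  carrier := {u | ∃ P : Polynomial S, UniformO I (fun ε x => u ε x - polyEval P ε x) M}
  add_mem' := by
    rintro u v ⟨P, hP⟩ ⟨Q, hQ⟩
    refine ⟨P + Q, (hP.add hQ).congr fun ε x => ?_⟩
    simp only [polyEval, Polynomial.eval₂_add, Pi.add_apply]; ring
  mul_mem' := by
    rintro u v ⟨P, hP⟩ ⟨Q, hQ⟩
    have hv : UniformO I v 0 :=
      ((hQ.mono (Nat.zero_le _)).add (uniformO_polyEval hS Q)).congr fun ε x => by ring
    refine ⟨P * Q, ((hP.mul hv).add (M := M)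
      (((uniformO_polyEval hS P).mul hQ).mono (by omega))).congr fun ε x => ?_⟩
    simp only [polyEval, Polynomial.eval₂_mul, Pi.mul_apply]; ring
  algebraMap_mem' := by
    intro c
    refine ⟨Polynomial.C (algebraMap ℂ S c), ?_⟩
    refine uniformO_of_bound le_rfl fun ε _ x => ?_
    simp [polyEval]

variable {hS : ∀ g ∈ S, ∃ C, ∀ x, ‖g x‖ ≤ C}

theorem const_mem_expansionAlgebra {g : X → ℂ} (hg : g ∈ S) :
    (fun _ x => g x) ∈ expansionAlgebra I S hS M := by
  refine ⟨Polynomial.C ⟨g, hg⟩, uniformO_of_bound le_rfl fun ε _ x => ?_⟩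
  simp [polyEval]

theorem param_mem_expansionAlgebra : (fun (ε : ℝ) _ => (ε : ℂ)) ∈ expansionAlgebra I S hS M := by
  refine ⟨Polynomial.X, uniformO_of_bound le_rfl fun ε _ x => ?_⟩
  simp [polyEval]

theorem UniformO.mem_expansionAlgebra {u : ℝ → X → ℂ} (h : UniformO I u M) :
    u ∈ expansionAlgebra I S hS M := by
  refine ⟨0, h.congr fun ε x => ?_⟩
  simp [polyEval]

/-- The factors `X` are split off one at a time: after division by `ε ^ M` the quotient is still
`O(ε)`, so its constant term is zero. -/
theorem X_pow_dvd_of_isBigO {l : Filter ℝ} [l.NeBot] (hl : Tendsto id l (𝓝 0))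
    (hl' : ∀ᶠ ε in l, ε ≠ 0) (p : Polynomial ℂ) : ∀ M : ℕ,
    (fun ε : ℝ => p.eval (ε : ℂ)) =O[l] (fun ε => ε ^ M) → Polynomial.X ^ M ∣ p := by
  intro M
  induction M with
  | zero => intro _; simp
  | succ M ih =>
    intro h
    have hle : (fun ε : ℝ => ε ^ (M + 1)) =O[l] fun ε : ℝ => ε ^ M := by
      have := (isBigO_refl (fun ε : ℝ => ε ^ M) l).mul (hl.isBigO_one ℝ)
      simpa [pow_succ] using this
    obtain ⟨q, rfl⟩ := ih (h.trans hle)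
    have h1 : (fun ε : ℝ => q.eval (ε : ℂ)) =O[l] fun ε => ε := by
      obtain ⟨K, hK⟩ := h.bound
      refine IsBigO.of_bound K ?_
      filter_upwards [hK, hl'] with ε h2 h3
      have h4 : 0 < ‖ε ^ M‖ := norm_pos_iff.2 (pow_ne_zero M h3)
      rw [Polynomial.eval_mul, norm_mul, Polynomial.eval_pow, Polynomial.eval_X, norm_pow,
        Complex.norm_real, ← norm_pow, pow_succ, norm_mul] at h2
      refine le_of_mul_le_mul_left ?_ h4
      linarith
    have h2 : Tendsto (fun ε : ℝ => q.eval (ε : ℂ)) l (𝓝 0) := h1.trans_tendsto hl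
    have h3 : Tendsto (fun ε : ℝ => q.eval (ε : ℂ)) l (𝓝 (q.eval ((0 : ℝ) : ℂ))) :=
      ((q.continuous.comp Complex.continuous_ofReal).tendsto 0).comp hl
    have h4 := tendsto_nhds_unique h3 h2
    rw [Complex.ofReal_zero, ← Polynomial.coeff_zero_eq_eval_zero, ← Polynomial.X_dvd_iff] at h4
    rw [pow_succ]
    exact mul_dvd_mul_left _ h4

/-- The leading coefficient of a family of order `ε^M` with an expansion up to `O(ε^{M+1})`. -/
theorem exists_leading_coefficient [hI : (𝓝[I \ {0}] (0 : ℝ)).NeBot] {u : ℝ → X → ℂ}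
    (hu : u ∈ expansionAlgebra I S hS (M + 1)) (h : UniformO I u M) :
    ∃ c ∈ S, UniformO I (fun ε x => u ε x - (ε : ℂ) ^ M * c x) (M + 1) := by
  obtain ⟨P, hP⟩ := hu
  -- The approximating polynomial inherits the order of the family. Evaluated at each point along
  -- nonzero `ε`, its coefficients below order `M` must vanish there, hence they vanish as
  -- functions.
  have h1 : UniformO I (polyEval P) M := (h.sub (hP.mono M.le_succ)).congr fun ε x => by ring
  have h2 : Polynomial.X ^ M ∣ P := by
    rw [Polynomial.X_pow_dvd_iff]
    intro i hi
    refine Subtype.ext (funext fun x => ?_)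
    have h3 : Polynomial.X ^ M ∣ P.map ((Pi.evalRingHom (fun _ : X => ℂ) x).comp S.val.toRingHom) := by
      refine X_pow_dvd_of_isBigO (l := 𝓝[I \ {0}] (0 : ℝ)) ?_ ?_ _ _ ?_
      · exact tendsto_id.mono_left nhdsWithin_le_nhds
      · filter_upwards [self_mem_nhdsWithin] with ε hε using fun h0 => hε.2 h0
      · have h4 : Tendsto (fun ε : ℝ => (ε, x)) (𝓝[I \ {0}] (0 : ℝ)) (𝓝[I] 0 ×ˢ ⊤) :=
          (tendsto_id.mono_left (nhdsWithin_mono _ Set.sdiff_subset)).prodMk tendsto_top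
        have h5 := IsBigO.comp_tendsto h1 h4
        simpa [Function.comp_def, polyEval, Polynomial.eval_map] using h5
    rw [Polynomial.X_pow_dvd_iff] at h3
    simpa using h3 i hi
  obtain ⟨Q, rfl⟩ := h2
  refine ⟨(Q.coeff 0).1, (Q.coeff 0).2, ?_⟩
  have h3 := ((uniformO_polyEval (I := I) hS Q.divX).pow_smul (M + 1))
  rw [add_zero] at h3
  refine (hP.add h3).congr fun ε x => ?_
  have h4 : polyEval (Polynomial.X ^ M * Q) ε x
      = (ε : ℂ) ^ M * (polyEval Q.divX ε x * ε + (Q.coeff 0).1 x) := by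
    conv_lhs => rw [← Q.divX_mul_X_add]
    simp [polyEval, Polynomial.eval₂_mul, Polynomial.eval₂_add]
  rw [h4, Complex.real_smul]
  push_cast
  ring

end Expansion

/-! ### Composition with near-identity families. -/

section Composition

variable {d : ℕ} {W : (Fin d → ℤ) → ℝ} {t : ℝ} {a : (Fin d → ℤ) → ℂ} {I : Set ℝ} {M : ℕ}

/-- The bound has to hold for all real `θ`, because `phase k v` is unbounded in `k` even for small
`v`. For `|θ| > 1` the exponential and the Taylor terms are separately controlled by `|θ| ^ n`. -/
theorem norm_exp_sub_sum_le (θ : ℝ) {n : ℕ} (hn : 0 < n) :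
    ‖Complex.exp (Complex.I * θ) - ∑ b ∈ Finset.range n, (Complex.I * θ) ^ b / b.factorial‖
      ≤ (1 + Real.exp 1) * |θ| ^ n := by
  have hnorm : ‖Complex.I * (θ : ℂ)‖ = |θ| := by simp
  by_cases h : |θ| ≤ 1
  · refine (Complex.exp_bound (by rwa [hnorm]) hn).trans ?_
    rw [hnorm, mul_comm]
    gcongr
    have h1 : (1 : ℝ) ≤ n.factorial := by exact_mod_cast n.factorial_pos
    have h2 : (1 : ℝ) ≤ n := by exact_mod_cast hn
    have h3 : (n.succ : ℝ) * (n.factorial * n : ℝ)⁻¹ ≤ 2 := by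
      rw [← div_eq_mul_inv, div_le_iff₀ (by positivity)]
      push_cast
      nlinarith
    have := Real.add_one_le_exp (1 : ℝ)
    linarith
  · push Not at h
    refine (norm_sub_le _ _).trans ?_
    have h1 : ‖Complex.exp (Complex.I * θ)‖ = 1 := by
      rw [mul_comm]; exact Complex.norm_exp_ofReal_mul_I θ
    have h2 : ‖∑ b ∈ Finset.range n, (Complex.I * (θ : ℂ)) ^ b / b.factorial‖
        ≤ Real.exp 1 * |θ| ^ n := by
      refine (norm_sum_le _ _).trans ?_
      calc ∑ b ∈ Finset.range n, ‖(Complex.I * (θ : ℂ)) ^ b / b.factorial‖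
          ≤ ∑ b ∈ Finset.range n, (1 : ℝ) ^ b / b.factorial * |θ| ^ n := by
            refine Finset.sum_le_sum fun b hb => ?_
            rw [norm_div, norm_pow, hnorm, Complex.norm_natCast, one_pow, div_mul_eq_mul_div,
              one_mul]
            gcongr
            · exact h.le
            · exact (Finset.mem_range.1 hb).le
        _ = (∑ b ∈ Finset.range n, (1 : ℝ) ^ b / b.factorial) * |θ| ^ n := by
            rw [Finset.sum_mul]
        _ ≤ _ := by
            gcongr
            exact Real.sum_le_exp_of_nonneg zero_le_one n
    have h3 : (1 : ℝ) ≤ |θ| ^ n := one_le_pow₀ h.le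
    rw [h1]
    linarith

/-- The `b`-th term of the Taylor expansion of `fourierSum a (x + v)` in `v`, times `b!`. -/
noncomputable def taylorTerm (a : (Fin d → ℤ) → ℂ) (b : ℕ) (v : Fin d → ℝ) (x : Torus d) : ℂ :=
  fourierSum (fun k => (Complex.I * (phase k v : ℝ)) ^ b * a k) x

theorem norm_phase_pow_mul_le (b : ℕ) (v : Fin d → ℝ) (k : Fin d → ℤ) :
    |phase k v| ^ b * ‖a k‖ ≤ (2 * Real.pi * d * ‖v‖) ^ b * ((1 + ‖k‖) ^ b * ‖a k‖) := by
  rw [← mul_assoc, ← mul_pow]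
  gcongr
  refine (abs_phase_le k v).trans ?_
  calc 2 * Real.pi * d * (‖k‖ * ‖v‖) ≤ 2 * Real.pi * d * ((1 + ‖k‖) * ‖v‖) := by
        gcongr; linarith
    _ = _ := by ring

theorem summable_taylorTerm (hW : IsWeight W) {b : ℕ} (ht : (b : ℝ) ≤ t) (ha : HasDecay W t a)
    (v : Fin d → ℝ) : Summable fun k => ‖(Complex.I * (phase k v : ℝ)) ^ b * a k‖ := by
  refine Summable.of_nonneg_of_le (fun k => norm_nonneg _) (fun k => ?_)
    ((ha.summable_one_add_norm_pow hW ht).mul_left ((2 * Real.pi * d * ‖v‖) ^ b))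
  rw [norm_mul, norm_pow, norm_mul, Complex.norm_I, one_mul, Complex.norm_real, Real.norm_eq_abs]
  exact norm_phase_pow_mul_le b v k

/-- One factor `phase k v` is distributed over the coordinates and exchanged for partial
derivatives. By recursion the Taylor term is polynomial in `v`, with coefficients whose exponent has
dropped by its degree; this keeps it in the expansion algebra. -/
theorem taylorTerm_succ (hW : IsWeight W) {b : ℕ} (ht : ((b + 1 : ℕ) : ℝ) ≤ t)
    (ha : HasDecay W t a) (v : Fin d → ℝ) (x : Torus d) :
    taylorTerm a (b + 1) v x = ∑ i, (v i : ℂ) * taylorTerm (derivCoeff i a) b v x := by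
  have h : ∀ i ∈ Finset.univ, HasSum (fun k => (v i : ℂ) *
      ((Complex.I * (phase k v : ℝ)) ^ b * derivCoeff i a k * mFourier k x))
      ((v i : ℂ) * taylorTerm (derivCoeff i a) b v x) := fun i _ =>
    (hasSum_fourierSum (summable_taylorTerm hW (b := b) (t := t - 1)
      (by push_cast at ht; linarith) (ha.derivCoeff hW i) v) x).mul_left _
  rw [← (hasSum_sum h).tsum_eq]
  refine tsum_congr fun k => ?_
  have hP : ((phase k v : ℝ) : ℂ) = ∑ i, 2 * (Real.pi : ℂ) * ((k i : ℝ) : ℂ) * (v i : ℂ) := by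
    rw [phase_apply]; push_cast; rfl
  calc (Complex.I * (phase k v : ℝ)) ^ (b + 1) * a k * mFourier k x
      = (phase k v : ℝ) * ((Complex.I * (phase k v : ℝ)) ^ b * Complex.I * a k * mFourier k x) := by
        ring
    _ = (∑ i, 2 * (Real.pi : ℂ) * ((k i : ℝ) : ℂ) * (v i : ℂ)) *
          ((Complex.I * (phase k v : ℝ)) ^ b * Complex.I * a k * mFourier k x) := by rw [← hP]
    _ = _ := by
        rw [Finset.sum_mul]
        refine Finset.sum_congr rfl fun i _ => ?_
        simp only [derivCoeff]
        ring

theorem norm_fourierSum_sub_taylor_le (hW : IsWeight W) {B : ℕ} (ht : ((B + 1 : ℕ) : ℝ) ≤ t)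
    (ha : HasDecay W t a) : ∃ K, 0 ≤ K ∧ ∀ (v : Fin d → ℝ) (x : Torus d),
      ‖fourierSum a (x + torusProj v) -
        ∑ b ∈ Finset.range (B + 1), (b.factorial : ℂ)⁻¹ * taylorTerm a b v x‖
        ≤ K * ‖v‖ ^ (B + 1) := by
  have h1 := ha.summable_one_add_norm_pow hW ht
  have hB : ∀ b ∈ Finset.range (B + 1), (b : ℝ) ≤ t := fun b hb => by
    refine le_trans ?_ ht
    exact_mod_cast (Finset.mem_range.1 hb).le
  refine ⟨(1 + Real.exp 1) * (2 * Real.pi * d) ^ (B + 1) * ∑' k, (1 + ‖k‖) ^ (B + 1) * ‖a k‖,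
    by positivity, fun v x => ?_⟩
  have h2 := hasSum_sum fun b hb =>
    (hasSum_fourierSum (summable_taylorTerm hW (hB b hb) ha v) x).mul_left ((b.factorial : ℂ)⁻¹)
  have h3 := (hasSum_fourierSum (ha.summable_norm hW
    ((Nat.cast_nonneg _).trans ht)) (x + torusProj v)).sub h2
  rw [mul_right_comm, ← tsum_mul_left]
  refine h3.norm_le_of_bounded (h1.mul_left _).hasSum fun k => ?_
  have h4 : a k * mFourier k (x + torusProj v) - ∑ b ∈ Finset.range (B + 1),
      (b.factorial : ℂ)⁻¹ * ((Complex.I * (phase k v : ℝ)) ^ b * a k * mFourier k x)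
      = a k * mFourier k x * (Complex.exp (Complex.I * (phase k v : ℝ)) -
        ∑ b ∈ Finset.range (B + 1), (Complex.I * (phase k v : ℝ)) ^ b / b.factorial) := by
    rw [mFourier_add_apply, mFourier_torusProj, mul_sub, Finset.mul_sum, mul_assoc]
    congr 1
    exact Finset.sum_congr rfl fun b _ => by ring
  rw [h4, norm_mul, norm_mul, norm_mFourier_apply, mul_one]
  calc ‖a k‖ * _ ≤ ‖a k‖ * ((1 + Real.exp 1) * |phase k v| ^ (B + 1)) := by
        gcongr; exact norm_exp_sub_sum_le _ B.succ_pos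
    _ = (1 + Real.exp 1) * (|phase k v| ^ (B + 1) * ‖a k‖) := by ring
    _ ≤ (1 + Real.exp 1) * ((2 * Real.pi * d * ‖v‖) ^ (B + 1) * ((1 + ‖k‖) ^ (B + 1) * ‖a k‖)) :=
        mul_le_mul_of_nonneg_left (norm_phase_pow_mul_le (B + 1) v k) (by positivity)
    _ = _ := by rw [mul_pow _ ‖v‖]; ring

theorem wienerAlgebra_bounded (hW : IsWeight W) (ht : 0 ≤ t) :
    ∀ g ∈ wienerAlgebra hW ht, ∃ C, ∀ x, ‖g x‖ ≤ C := fun _ hg => WienerClass.bounded hW ht hg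

/-- The families with an expansion up to `O(ε^M)` in the Wiener class of exponent `t`. -/
noncomputable abbrev wienerExpansion (I : Set ℝ) (hW : IsWeight W) (ht : 0 ≤ t) (M : ℕ) :
    Subalgebra ℂ (ℝ → Torus d → ℂ) :=
  expansionAlgebra I (wienerAlgebra hW ht) (wienerAlgebra_bounded hW ht) M

theorem taylorTerm_mem (hW : IsWeight W) (ht : 0 ≤ t) {v : ℝ → Torus d → (Fin d → ℝ)}
    (hv : ∀ i, (fun ε x => ((v ε x i : ℝ) : ℂ)) ∈ wienerExpansion I hW ht M) (b : ℕ) :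
    ∀ a, HasDecay W (t + b) a →
      (fun ε x => taylorTerm a b (v ε x) x) ∈ wienerExpansion I hW ht M := by
  induction b with
  | zero =>
    intro a ha
    have h : (fun ε x => taylorTerm a 0 (v ε x) x) = fun (_ : ℝ) => fourierSum a := by
      funext ε x
      simp [taylorTerm]
    rw [h]
    refine const_mem_expansionAlgebra (g := fourierSum a) ?_
    exact (mem_wienerAlgebra hW ht).2 ⟨a, by simpa using ha, rfl⟩
  | succ b ih =>
    intro a ha
    have h : (fun ε x => taylorTerm a (b + 1) (v ε x) x)
        = ∑ i, (fun ε x => ((v ε x i : ℝ) : ℂ)) *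
            (fun ε x => taylorTerm (derivCoeff i a) b (v ε x) x) := by
      funext ε x
      rw [taylorTerm_succ hW (by linarith) ha, Finset.sum_apply, Finset.sum_apply]
      rfl
    rw [h]
    refine Subalgebra.sum_mem _ fun i _ => Subalgebra.mul_mem _ (hv i) (ih _ ?_)
    have := ha.derivCoeff hW i
    push_cast at this
    rwa [show t + (b + 1) - 1 = t + b by ring] at this

/-- Composition of a function of a Wiener class with a near-identity family. -/
theorem pow_mul_comp_mem (hW : IsWeight W) (ht : 1 ≤ t) {v : ℝ → Torus d → (Fin d → ℝ)}
    (hv : ∀ i, (fun ε x => ((v ε x i : ℝ) : ℂ)) ∈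
      wienerExpansion I hW (zero_le_one.trans ht) M) (hv1 : UniformO I v 1)
    {i B : ℕ} (hM : M ≤ i + B + 1) {g : Torus d → ℂ} (hg : g ∈ WienerClass W (t + B)) :
    (fun (ε : ℝ) x => (ε : ℂ) ^ i * g (x + torusProj (v ε x))) ∈
      wienerExpansion I hW (zero_le_one.trans ht) M := by
  obtain ⟨a, ha, rfl⟩ := hg
  -- The `B` derivatives in the main terms leave the exponent `t`; the remainder needs one more
  -- derivative, available since `t ≥ 1`.
  obtain ⟨K, hK, hrem⟩ := norm_fourierSum_sub_taylor_le hW (B := B) (t := t + B)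
    (by push_cast; linarith) ha
  have h1 : UniformO I (fun ε x => fourierSum a (x + torusProj (v ε x)) -
      ∑ b ∈ Finset.range (B + 1), (b.factorial : ℂ)⁻¹ * taylorTerm a b (v ε x) x) (B + 1) := by
    obtain ⟨L, hL, δ, hδ, h⟩ := uniformO_iff.1 hv1
    refine uniformO_iff.2 ⟨K * L ^ (B + 1), by positivity, δ, hδ, fun ε hε hεδ x => ?_⟩
    refine (hrem _ x).trans ?_
    rw [mul_assoc, ← mul_pow]
    gcongr
    simpa using h ε hε hεδ x
  have h2 : (fun (ε : ℝ) x => (ε : ℂ) ^ i * fourierSum a (x + torusProj (v ε x))) =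
      (fun (ε : ℝ) _ => (ε : ℂ)) ^ i * (∑ b ∈ Finset.range (B + 1), (b.factorial : ℂ)⁻¹ •
        fun ε x => taylorTerm a b (v ε x) x) +
      fun ε x => ε ^ i • (fourierSum a (x + torusProj (v ε x)) -
      ∑ b ∈ Finset.range (B + 1), (b.factorial : ℂ)⁻¹ * taylorTerm a b (v ε x) x) := by
    funext ε x
    simp only [Pi.add_apply, Pi.mul_apply, Pi.pow_apply, Finset.sum_apply, Pi.smul_apply,
      smul_eq_mul, Complex.real_smul]
    push_cast
    ring
  rw [h2]
  refine Subalgebra.add_mem _ (Subalgebra.mul_mem _ (Subalgebra.pow_mem _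
    param_mem_expansionAlgebra i) (Subalgebra.sum_mem _ fun b hb => Subalgebra.smul_mem _
      (taylorTerm_mem hW _ hv b a (ha.mono hW ?_)) _)) ?_
  · have : (b : ℝ) ≤ B := by exact_mod_cast Nat.lt_succ_iff.1 (Finset.mem_range.1 hb)
    linarith
  · exact ((h1.pow_smul i).mono (by omega)).mem_expansionAlgebra

end Composition

/-! ### Integration over the torus. -/

section Haar

variable {d : ℕ}

instance : IsProbabilityMeasure (torusHaar d) := by
  unfold torusHaar; infer_instance

instance : (torusHaar d).IsAddLeftInvariant := by
  unfold torusHaar; infer_instance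

theorem integrable_torusHaar {E : Type*} [NormedAddCommGroup E] [SecondCountableTopology E]
    {g : Torus d → E} (hg : Continuous g) : Integrable g (torusHaar d) :=
  hg.integrable_of_hasCompactSupport (HasCompactSupport.of_compactSpace g)

theorem integral_torusHaar_apply {e : ℕ} {F : Torus d → (Fin e → ℝ)}
    (hF : ∀ i, Continuous fun y => F y i) (i : Fin e) :
    (∫ y, F y ∂torusHaar d) i = ∫ y, F y i ∂torusHaar d :=
  eval_integral (f := F) (fun i => integrable_torusHaar (hF i)) i

theorem exists_mFourier_ne_one {k : Fin d → ℤ} (hk : k ≠ 0) :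
    ∃ v : Fin d → ℝ, mFourier k (torusProj v) ≠ 1 := by
  obtain ⟨i, hi⟩ := Function.ne_iff.1 hk
  have hi' : (k i : ℝ) ≠ 0 := by exact_mod_cast hi
  refine ⟨Pi.single i (1 / (2 * k i)), ?_⟩
  have h : phase k (Pi.single i (1 / (2 * k i))) = Real.pi := by
    rw [phase_apply, Finset.sum_eq_single i]
    · rw [Pi.single_eq_same]; field_simp
    · intro j _ hj; rw [Pi.single_eq_of_ne hj, mul_zero]
    · simp
  rw [mFourier_torusProj, h, mul_comm, Complex.exp_pi_mul_I]
  norm_num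

/-- Translation preserves the integral but multiplies it by `mFourier k (torusProj v)`, which
differs from one for a suitable `v` when `k ≠ 0`. -/
theorem integral_mFourier (k : Fin d → ℤ) :
    ∫ y, mFourier k y ∂torusHaar d = if k = 0 then 1 else 0 := by
  split_ifs with hk
  · subst hk; simp [mFourier_zero]
  · obtain ⟨v, hv⟩ := exists_mFourier_ne_one hk
    have h := integral_add_left_eq_self (μ := torusHaar d) (fun y => mFourier k y) (torusProj v)
    simp only [mFourier_add_apply] at h
    rw [integral_const_mul] at h
    have h2 : (mFourier k (torusProj v) - 1) * ∫ y, mFourier k y ∂torusHaar d = 0 := by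
      rw [sub_mul, h, one_mul, sub_self]
    exact (mul_eq_zero.1 h2).resolve_left (sub_ne_zero.2 hv)

end Haar

/-! ### Unimodular changes of coordinates and their action on characters. -/

section Matrix

variable {d : ℕ}

theorem torusMatrix_torusProj (B : Matrix (Fin d) (Fin d) ℤ) (v : Fin d → ℝ) :
    torusMatrix B (torusProj v) = torusProj (realMatrix B v) := by
  funext i
  simp only [torusMatrix, torusProj, realMatrix, Matrix.mulVec, dotProduct, Matrix.map_apply]
  rw [← QuotientAddGroup.mk'_apply, map_sum]
  refine Finset.sum_congr rfl fun j _ => ?_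
  rw [← QuotientAddGroup.mk'_apply, ← map_zsmul, zsmul_eq_mul]

theorem realMatrix_mul (B C : Matrix (Fin d) (Fin d) ℤ) (v : Fin d → ℝ) :
    realMatrix (B * C) v = realMatrix B (realMatrix C v) := by
  unfold realMatrix
  rw [Matrix.mulVec_mulVec]
  congr 1
  exact Matrix.map_mul (f := Int.castRingHom ℝ)

theorem realMatrix_one (v : Fin d → ℝ) : realMatrix 1 v = v := by
  unfold realMatrix
  rw [Matrix.map_one _ (by simp) (by simp), Matrix.one_mulVec]

theorem torusMatrix_mul (B C : Matrix (Fin d) (Fin d) ℤ) (x : Torus d) :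
    torusMatrix (B * C) x = torusMatrix B (torusMatrix C x) := by
  obtain ⟨v, rfl⟩ := torusProj_surjective x
  simp only [torusMatrix_torusProj, realMatrix_mul]

theorem torusMatrix_one (x : Torus d) : torusMatrix 1 x = x := by
  obtain ⟨v, rfl⟩ := torusProj_surjective x
  rw [torusMatrix_torusProj, realMatrix_one]

theorem torusMatrix_add (B : Matrix (Fin d) (Fin d) ℤ) (x y : Torus d) :
    torusMatrix B (x + y) = torusMatrix B x + torusMatrix B y := by
  funext i
  simp [torusMatrix, smul_add, Finset.sum_add_distrib]

theorem continuous_torusMatrix (B : Matrix (Fin d) (Fin d) ℤ) : Continuous (torusMatrix B) :=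
  continuous_pi fun _ => continuous_finsetSum _ fun j _ => (continuous_apply j).zsmul _

variable (A : Matrix.SpecialLinearGroup (Fin d) ℤ)

theorem torusMatrix_inv_apply (x : Torus d) : torusMatrix (A⁻¹).1 (torusMatrix A.1 x) = x := by
  rw [← torusMatrix_mul, ← Matrix.SpecialLinearGroup.coe_mul, inv_mul_cancel]
  exact torusMatrix_one x

theorem torusMatrix_apply_inv (x : Torus d) : torusMatrix A.1 (torusMatrix (A⁻¹).1 x) = x := by
  rw [← torusMatrix_mul, ← Matrix.SpecialLinearGroup.coe_mul, mul_inv_cancel]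
  exact torusMatrix_one x

/-- The index of a character in the coordinates `A x`. -/
def dualIndex (k : Fin d → ℤ) : Fin d → ℤ := k ᵥ* (A⁻¹).1

theorem phase_realMatrix (B : Matrix (Fin d) (Fin d) ℤ) (k : Fin d → ℤ) (v : Fin d → ℝ) :
    phase k (realMatrix B v) = phase (k ᵥ* B) v := by
  rw [phase_eq, phase_eq]
  congr 1
  simp only [realMatrix, Matrix.mulVec, Matrix.vecMul, dotProduct, Matrix.map_apply]
  push_cast
  simp only [Finset.mul_sum, Finset.sum_mul]
  rw [Finset.sum_comm]
  exact Finset.sum_congr rfl fun j _ => Finset.sum_congr rfl fun i _ => by ring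

theorem mFourier_torusMatrix (B : Matrix (Fin d) (Fin d) ℤ) (k : Fin d → ℤ) (x : Torus d) :
    mFourier k (torusMatrix B x) = mFourier (k ᵥ* B) x := by
  obtain ⟨v, rfl⟩ := torusProj_surjective x
  rw [torusMatrix_torusProj, mFourier_torusProj, mFourier_torusProj, phase_realMatrix]

theorem mFourier_inv_apply (k : Fin d → ℤ) (x : Torus d) :
    mFourier k (torusMatrix (A⁻¹).1 x) = mFourier (dualIndex A k) x := mFourier_torusMatrix _ k x

theorem mFourier_eq_dual (k : Fin d → ℤ) (x : Torus d) :
    mFourier k x = mFourier (dualIndex A k) (torusMatrix A.1 x) := by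
  rw [← mFourier_inv_apply, torusMatrix_inv_apply]

/-- The small divisors are governed by the dual index and the weights by `k`; this comparison links
the two. -/
theorem norm_dualIndex_le : ∃ C, 0 < C ∧ ∀ k : Fin d → ℤ, ‖dualIndex A k‖ ≤ C * ‖k‖ := by
  refine ⟨(∑ i, ∑ j, ‖(A⁻¹).1 i j‖) + 1, by positivity, fun k => ?_⟩
  refine (pi_norm_le_iff_of_nonneg (by positivity)).2 fun j => ?_
  have h0 : ‖dualIndex A k j‖ ≤ ∑ i, ‖k i * (A⁻¹).1 i j‖ :=
    norm_sum_le Finset.univ fun i => k i * (A⁻¹).1 i j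
  refine h0.trans ?_
  calc ∑ i, ‖k i * (A⁻¹).1 i j‖ ≤ ∑ i, ‖k‖ * ∑ j, ‖(A⁻¹).1 i j‖ := by
        refine Finset.sum_le_sum fun i _ => (norm_mul_le _ _).trans ?_
        gcongr
        · exact norm_le_pi_norm k i
        · exact Finset.single_le_sum (f := fun j => ‖(A⁻¹).1 i j‖) (fun _ _ => norm_nonneg _)
            (Finset.mem_univ j)
    _ = (∑ i, ∑ j, ‖(A⁻¹).1 i j‖) * ‖k‖ := by rw [← Finset.mul_sum, mul_comm]
    _ ≤ _ := by gcongr; linarith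

end Matrix

/-! ### Splitting into frequency variables and resonant variables. -/

section Blocks

variable {r s : ℕ}

theorem mFourier_append (k : Fin (r + s) → ℤ) (y : Torus r) (z : Torus s) :
    mFourier k (Fin.append y z : Torus (r + s)) =
      mFourier (fstBlock k) y * mFourier (sndBlock k) z := by
  simp only [mFourier, ContinuousMap.coe_mk]
  rw [Fin.prod_univ_add]
  simp [fstBlock, sndBlock]

theorem append_blocks {X : Type} (x : Fin (r + s) → X) : Fin.append (fstBlock x) (sndBlock x) = x := by
  funext i
  refine Fin.addCases (fun j => ?_) (fun j => ?_) i <;> simp [fstBlock, sndBlock]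

theorem mFourier_blocks (k : Fin (r + s) → ℤ) (x : Torus (r + s)) :
    mFourier k x = mFourier (fstBlock k) (fstBlock x) * mFourier (sndBlock k) (sndBlock x) := by
  rw [← mFourier_append]
  congr 1
  exact (append_blocks x).symm

theorem continuous_append_left (z : Torus s) :
    Continuous fun y : Torus r => (Fin.append y z : Torus (r + s)) := by
  refine continuous_pi fun i => ?_
  refine Fin.addCases (fun j => ?_) (fun j => ?_) i
  · simpa using continuous_apply j
  · simpa using continuous_const

theorem norm_fstBlock_le (k : Fin (r + s) → ℤ) : ‖fstBlock k‖ ≤ ‖k‖ :=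
  (pi_norm_le_iff_of_nonneg (norm_nonneg _)).2 fun i => norm_le_pi_norm k (Fin.castAdd s i)

end Blocks

/-! ### Resonant averages and the cohomology equation. -/

section Average

variable {r s : ℕ} (A : Matrix.SpecialLinearGroup (Fin (r + s)) ℤ)

/-- The characters that depend only on the last `s` coordinates of `A x`. -/
def IsResonantIndex (k : Fin (r + s) → ℤ) : Prop := fstBlock (dualIndex A k) = 0

open Classical in
/-- Restriction of a coefficient family to the resonant indices. -/
noncomputable def resonantCoeff (a : (Fin (r + s) → ℤ) → ℂ) (k : Fin (r + s) → ℤ) : ℂ :=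
  if IsResonantIndex A k then a k else 0

/-- In the coordinates `A x` each character splits into a product over the two blocks, and
integration over the first block keeps exactly the indices whose first dual block is zero. -/
theorem integral_fourierSum {a : (Fin (r + s) → ℤ) → ℂ} (ha : Summable fun k => ‖a k‖)
    (z : Torus s) :
    ∫ y : Torus r, fourierSum a (torusMatrix (A⁻¹).1 (Fin.append y z)) ∂torusHaar r =
      ∑' k, resonantCoeff A a k * mFourier (sndBlock (dualIndex A k)) z := by
  have hF : ∀ (k : Fin (r + s) → ℤ) (y : Torus r),
      a k * mFourier k (torusMatrix (A⁻¹).1 (Fin.append y z)) =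
        (a k * mFourier (sndBlock (dualIndex A k)) z) * mFourier (fstBlock (dualIndex A k)) y := by
    intro k y
    rw [mFourier_inv_apply, mFourier_append]; ring
  have hc : ∀ k : Fin (r + s) → ℤ, Continuous fun y : Torus r =>
      a k * mFourier k (torusMatrix (A⁻¹).1 (Fin.append y z)) := fun k =>
    continuous_const.mul ((mFourier k).continuous.comp
      ((continuous_torusMatrix _).comp (continuous_append_left z)))
  have h := integral_tsum_of_summable_integral_norm (μ := torusHaar r)
    (F := fun (k : Fin (r + s) → ℤ) y => a k * mFourier k (torusMatrix (A⁻¹).1 (Fin.append y z)))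
    (fun k => integrable_torusHaar (hc k)) (by
      simpa [norm_mFourier_apply] using ha)
  rw [show (fun y : Torus r => fourierSum a (torusMatrix (A⁻¹).1 (Fin.append y z))) =
    fun y => ∑' k, a k * mFourier k (torusMatrix (A⁻¹).1 (Fin.append y z)) from rfl, ← h]
  refine tsum_congr fun k => ?_
  simp only [hF]
  rw [integral_const_mul, integral_mFourier, resonantCoeff]
  by_cases hk : IsResonantIndex A k
  · rw [if_pos hk, if_pos (show fstBlock (dualIndex A k) = 0 from hk), mul_one]
  · rw [if_neg hk, if_neg (show ¬ fstBlock (dualIndex A k) = 0 from hk), mul_zero, zero_mul]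

theorem fourierSum_resonantCoeff (a : (Fin (r + s) → ℤ) → ℂ) (x : Torus (r + s)) :
    fourierSum (resonantCoeff A a) x = ∑' k, resonantCoeff A a k *
      mFourier (sndBlock (dualIndex A k)) (sndBlock (torusMatrix A.1 x)) := by
  refine tsum_congr fun k => ?_
  by_cases hk : IsResonantIndex A k
  · rw [mFourier_eq_dual A, mFourier_blocks, show fstBlock (dualIndex A k) = 0 from hk, mFourier_zero]
    simp
  · simp [resonantCoeff, hk]

variable {W : (Fin (r + s) → ℤ) → ℝ} {t τ : ℝ}

/-- The small divisors of `Ω₀` at the non-resonant indices are bounded below. -/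
def SmallDivisorBound (W : (Fin (r + s) → ℤ) → ℝ) (τ : ℝ) (Ω₀ : Fin (r + s) → ℝ) : Prop :=
  ∃ K, ∀ k, ¬ IsResonantIndex A k →
    mFourier k (torusProj Ω₀) ≠ 1 ∧ ‖(mFourier k (torusProj Ω₀) - 1)⁻¹‖ ≤ K * W k ^ τ

variable {A}

open Classical in
-- Comparison of coefficients forces `b k = a k / (mFourier k (torusProj Ω₀) - 1)` at the
-- nonresonant indices. At the resonant ones `b k = 0`, which is the normalization, and `a k` passes
-- to the average.
theorem exists_complex_solution (hW : IsWeight W) (hτ : 0 ≤ τ) (ht : 0 ≤ t)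
    {Ω₀ : Fin (r + s) → ℝ} (hdiv : SmallDivisorBound A W τ Ω₀)
    {p : Torus (r + s) → ℂ} (hp : p ∈ WienerClass W (t + τ)) :
    ∃ h ∈ WienerClass W t, 
      (fun x => ∫ y : Torus r, p (torusMatrix (A⁻¹).1 (Fin.append y (sndBlock (torusMatrix A.1 x))))
        ∂torusHaar r) ∈ WienerClass W (t + τ) ∧
      (∀ x, h x - h (x + torusProj Ω₀) + p x = ∫ y : Torus r,
        p (torusMatrix (A⁻¹).1 (Fin.append y (sndBlock (torusMatrix A.1 x)))) ∂torusHaar r) ∧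
      ∀ z : Torus s, ∫ y : Torus r, h (torusMatrix (A⁻¹).1 (Fin.append y z)) ∂torusHaar r = 0 := by
  obtain ⟨a, ha, rfl⟩ := hp
  obtain ⟨K, hK⟩ := hdiv
  have ha0 := ha.summable_norm hW (add_nonneg ht hτ)
  let m : (Fin (r + s) → ℤ) → ℂ := fun k =>
    if IsResonantIndex A k then 0 else (mFourier k (torusProj Ω₀) - 1)⁻¹
  have hm : ∀ k, ‖m k‖ ≤ |K| * W k ^ τ := by
    intro k
    have hpos := Real.rpow_nonneg (hW.pos k).le τ
    by_cases hk : IsResonantIndex A k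
    · simp only [m, hk, if_true, norm_zero]; positivity
    · simp only [m, hk, if_false]
      exact (hK k hk).2.trans (mul_le_mul_of_nonneg_right (le_abs_self K) hpos)
  have hb : HasDecay W t fun k => m k * a k := by
    have := ha.mul_factor hW hm
    rwa [add_sub_cancel_right] at this
  have hb0 := hb.summable_norm hW ht
  have hR : HasDecay W (t + τ) (resonantCoeff A a) := by
    have h := ha.bounded_factor hW (K := 1) (m := fun k => if IsResonantIndex A k then 1 else 0)
      (fun k => by split_ifs <;> simp)
    convert h using 1
    funext k
    simp [resonantCoeff]
  have hR0 := hR.summable_norm hW (add_nonneg ht hτ)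
  have hav : (fun x => ∫ y : Torus r, fourierSum a (torusMatrix (A⁻¹).1
      (Fin.append y (sndBlock (torusMatrix A.1 x)))) ∂torusHaar r) =
      fourierSum (resonantCoeff A a) := by
    funext x
    rw [integral_fourierSum A ha0, fourierSum_resonantCoeff]
  refine ⟨_, ⟨_, hb, rfl⟩, ?_, fun x => ?_, fun z => ?_⟩
  · rw [hav]; exact ⟨_, hR, rfl⟩
  · rw [congrFun hav x]
    have h1 := ((hasSum_fourierSum hb0 x).sub (hasSum_fourierSum hb0 (x + torusProj Ω₀))).add
      (hasSum_fourierSum ha0 x)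
    rw [← h1.tsum_eq]
    refine tsum_congr fun k => ?_
    rw [mFourier_add_apply]
    by_cases hk : IsResonantIndex A k
    · simp [m, hk, resonantCoeff]
    · have h2 := sub_ne_zero.2 (hK k hk).1
      simp only [m, hk, if_false, resonantCoeff]
      field_simp
      ring
  · rw [integral_fourierSum A hb0]
    have : ∀ k, resonantCoeff A (fun k => m k * a k) k = 0 := by
      intro k
      by_cases hk : IsResonantIndex A k <;> simp [resonantCoeff, hk, m]
    simp [this]

/-- The cohomology equation: its solution without resonant part loses `τ` in the exponent. -/
theorem exists_cohomology_solution (hW : IsWeight W) (hτ : 0 ≤ τ) (ht : 0 ≤ t)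
    {Ω₀ : Fin (r + s) → ℝ} (hdiv : SmallDivisorBound A W τ Ω₀)
    {e : ℕ}
    {p : Torus (r + s) → (Fin e → ℝ)} (hp : VectorClass W (t + τ) p) :
    ∃ (h : Torus (r + s) → (Fin e → ℝ)) (R : Torus s → (Fin e → ℝ)),
      VectorClass W t h ∧ VectorClass W (t + τ) (fun x => R (sndBlock (torusMatrix A.1 x))) ∧
      (∀ z, R z = ∫ y : Torus r, p (torusMatrix (A⁻¹).1 (Fin.append y z)) ∂torusHaar r) ∧
      (∀ x, h x - h (x + torusProj Ω₀) + p x = R (sndBlock (torusMatrix A.1 x))) ∧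
      ∀ z : Torus s, ∫ y : Torus r, h (torusMatrix (A⁻¹).1 (Fin.append y z)) ∂torusHaar r = 0 := by
  choose h hh hav heq hint using fun i =>
    exists_complex_solution (A := A) hW hτ ht hdiv (hp i)
  have hcA : ∀ z : Torus s, Continuous fun y : Torus r =>
      (torusMatrix (A⁻¹).1 (Fin.append y z) : Torus (r + s)) := fun z =>
    (continuous_torusMatrix _).comp (continuous_append_left z)
  have hpc : ∀ i, Continuous fun x => p x i := fun i =>
    Complex.continuous_re.comp (WienerClass.continuous hW (add_nonneg ht hτ) (hp i))
  have hhc : ∀ i, Continuous (h i) := fun i => WienerClass.continuous hW ht (hh i)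
  have hRi : ∀ z i, (∫ y : Torus r, p (torusMatrix (A⁻¹).1 (Fin.append y z)) ∂torusHaar r) i =
      ∫ y : Torus r, p (torusMatrix (A⁻¹).1 (Fin.append y z)) i ∂torusHaar r := fun z i =>
    integral_torusHaar_apply (F := fun y => p (torusMatrix (A⁻¹).1 (Fin.append y z)))
      (fun i => (hpc i).comp (hcA z)) i
  -- Since `p` is real, the real part of a complex solution solves the same equation with the same
  -- normalization.
  refine ⟨fun x i => (h i x).re, fun z => ∫ y : Torus r,
    p (torusMatrix (A⁻¹).1 (Fin.append y z)) ∂torusHaar r, fun i => WienerClass.re hW ht (hh i),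
    fun i => ?_, fun _ => rfl, fun x => ?_, fun z => ?_⟩
  · convert hav i using 2 with x
    exact (congrArg _ (hRi _ i)).trans integral_ofReal.symm
  · funext i
    have h1 := congrArg Complex.re ((heq i x).trans integral_ofReal)
    refine Eq.trans ?_ (hRi _ i).symm
    simpa using h1
  · funext i
    refine (integral_torusHaar_apply
      (F := fun y i => (h i (torusMatrix (A⁻¹).1 (Fin.append y z))).re)
      (fun i => Complex.continuous_re.comp ((hhc i).comp (hcA z))) i).trans ?_
    have h1 := integral_re (𝕜 := ℂ) (integrable_torusHaar ((hhc i).comp (hcA z)))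
    have h2 : RCLike.re (∫ y : Torus r, h i (torusMatrix (A⁻¹).1 (Fin.append y z)) ∂torusHaar r)
        = 0 := by rw [hint i z]; simp
    exact h1.trans h2

end Average

/-! ### Small divisors of the resonant frequency. -/

section Diophantine

variable {r s : ℕ} {Ω₀ : Fin (r + s) → ℝ} {ω : Fin r → ℝ}
  {A : Matrix.SpecialLinearGroup (Fin (r + s)) ℤ} {L : Fin (r + s) → ℤ} {ν τ : ℝ}

/-- `A Ω₀` equals `(ω, 0)` modulo integers, so only the first dual block meets the frequency: the
divisors of `Ω₀` are those of `ω`. -/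
theorem mFourier_frequency (hω : IsIntrinsicFrequency Ω₀ ω A L) (k : Fin (r + s) → ℤ) :
    mFourier k (torusProj Ω₀) = mFourier (fstBlock (dualIndex A k)) (torusProj ω) := by
  rw [mFourier_eq_dual A, torusMatrix_torusProj, hω.1, torusProj_add, torusProj_intCast, add_zero]
  have h : torusProj (Fin.append ω (0 : Fin s → ℝ)) = Fin.append (torusProj ω) (0 : Torus s) := by
    funext i
    refine Fin.addCases (fun j => ?_) (fun j => ?_) i <;> simp [torusProj]
  rw [h, mFourier_append]
  simp [mFourier]

/-- The chord has length `2 |sin (π φ)|` with `φ` the signed distance to the nearest integer, and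
Jordan's inequality applies because `|φ| ≤ 1 / 2`. -/
theorem le_norm_exp_sub_one (θ : ℝ) :
    4 * |θ - round θ| ≤ ‖Complex.exp (Complex.I * (2 * Real.pi * θ : ℝ)) - 1‖ := by
  have h1 : Complex.exp (Complex.I * (2 * Real.pi * θ : ℝ))
      = Complex.exp (Complex.I * (2 * Real.pi * (θ - round θ) : ℝ)) := by
    rw [Complex.exp_eq_exp_iff_exists_int]
    exact ⟨round θ, by push_cast; ring⟩
  have h2 := abs_sub_round θ
  rw [h1, Complex.norm_exp_I_mul_ofReal_sub_one]
  set φ := θ - round θ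
  have h3 : 2 * Real.pi * φ / 2 = Real.pi * φ := by ring
  rw [h3, norm_mul, Real.norm_ofNat, Real.norm_eq_abs]
  have h4 : |Real.pi * φ| ≤ Real.pi / 2 := by
    rw [abs_mul, abs_of_pos Real.pi_pos]
    nlinarith [Real.pi_pos]
  have h5 := Real.mul_abs_le_abs_sin h4
  rw [abs_mul, abs_of_pos Real.pi_pos] at h5
  have h6 : 2 / Real.pi * (Real.pi * |φ|) = 2 * |φ| := by field_simp
  linarith

theorem smallDivisorBound (hω : IsIntrinsicFrequency Ω₀ ω A L) (hν : 0 < ν) (hτ : 0 ≤ τ)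
    (hD : IsDiophantine ν τ ω) {W : (Fin (r + s) → ℤ) → ℝ} (hW : IsWeight W) :
    SmallDivisorBound A W τ Ω₀ := by
  obtain ⟨C, hC, hdual⟩ := norm_dualIndex_le A
  obtain ⟨C', hC', hlin⟩ := hW.linear
  -- The factor `4 * ν` combines the chord estimate with the Diophantine bound; `C * C'` compares
  -- the first dual block with `W k`.
  refine ⟨(C * C') ^ τ / (4 * ν), fun k hk => ?_⟩
  have hk' : fstBlock (dualIndex A k) ≠ 0 := hk
  rw [mFourier_frequency hω, mFourier_torusProj, phase_eq]
  set θ : ℝ := ∑ i, ((fstBlock (dualIndex A k) i : ℤ) : ℝ) * ω i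
  have h1 := hD _ hk' (round θ)
  have h2 := le_norm_exp_sub_one θ
  have hn : 0 < ‖fstBlock (dualIndex A k)‖ := norm_pos_iff.2 hk'
  have h3 : ‖fstBlock (dualIndex A k)‖ ≤ C * C' * W k := by
    calc _ ≤ ‖dualIndex A k‖ := norm_fstBlock_le _
      _ ≤ C * ‖k‖ := hdual k
      _ ≤ C * (C' * W k) := by gcongr; linarith [hlin k]
      _ = _ := by ring
  have h4 : (C * C' * W k) ^ (-τ) ≤ ‖fstBlock (dualIndex A k)‖ ^ (-τ) :=
    Real.rpow_le_rpow_of_nonpos hn h3 (by linarith)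
  have hWk := hW.pos k
  have h5 : 0 < 4 * (ν * (C * C' * W k) ^ (-τ)) := by positivity
  have h6 : 4 * (ν * (C * C' * W k) ^ (-τ)) ≤
      ‖Complex.exp (Complex.I * (2 * Real.pi * θ : ℝ)) - 1‖ := by
    refine le_trans ?_ h2
    gcongr
    exact (mul_le_mul_of_nonneg_left h4 hν.le).trans h1
  refine ⟨fun h => ?_, ?_⟩
  · rw [h, sub_self, norm_zero] at h6
    linarith
  · rw [norm_inv]
    refine (inv_anti₀ h5 h6).trans_eq ?_
    rw [Real.rpow_neg (by positivity), Real.mul_rpow (by positivity) hWk.le]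
    field_simp

/-- Some integer lies within `1 / 2` of any real number, whereas for `τ < 0` the Diophantine lower
bound would grow without limit along the multiples of a coordinate vector. -/
theorem _root_.IsDiophantine.exponent_nonneg (hD : IsDiophantine ν τ ω) (hν : 0 < ν) (hr : 0 < r) :
    0 ≤ τ := by
  by_contra! hτ
  have h1 : ∀ K : ℕ, 0 < K → ν * (K : ℝ) ^ (-τ) ≤ 1 / 2 := by
    intro K hK
    have hk : (Pi.single ⟨0, hr⟩ (K : ℤ) : Fin r → ℤ) ≠ 0 := by
      simpa using hK.ne'
    have h := hD _ hk (round (∑ i, ((Pi.single ⟨0, hr⟩ (K : ℤ) : Fin r → ℤ) i : ℝ) * ω i))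
    have hn : ‖(Pi.single ⟨0, hr⟩ (K : ℤ) : Fin r → ℤ)‖ = K := by
      rw [Pi.norm_single]; simp
    rw [hn] at h
    exact h.trans (abs_sub_round _)
  have h2 : Tendsto (fun K : ℕ => ν * (K : ℝ) ^ (-τ)) atTop atTop :=
    ((tendsto_rpow_atTop (by linarith)).comp tendsto_natCast_atTop_atTop).const_mul_atTop hν
  obtain ⟨K, hK1, hK2⟩ := ((h2.eventually_gt_atTop (1 / 2)).and (eventually_gt_atTop 0)).exists
  exact absurd (h1 K hK2) (not_le.2 hK1)

/-- A resonant frequency has a nontrivial resonant block. -/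
theorem _root_.IsIntrinsicFrequency.pos_of_resonant (hω : IsIntrinsicFrequency Ω₀ ω A L)
    (h : IsResonant Ω₀) : 0 < s := by
  by_contra! hs
  obtain rfl : s = 0 := by omega
  obtain ⟨k, hk, l, hl⟩ := h
  -- If `s = 0`, the first block is the whole dual index, so a resonance of `Ω₀` becomes one of `ω`;
  -- nonresonance then makes the dual index, and with it `k`, vanish.
  have h1 : mFourier k (torusProj Ω₀) = 1 := by
    rw [mFourier_torusProj, phase_eq, show ∑ i, (k i : ℝ) * Ω₀ i = l by linarith,
      Complex.exp_eq_one_iff]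
    exact ⟨l, by push_cast; ring⟩
  rw [mFourier_frequency hω, mFourier_torusProj, phase_eq, Complex.exp_eq_one_iff] at h1
  obtain ⟨n, hn⟩ := h1
  have hn' : 2 * Real.pi * ∑ i, ((fstBlock (dualIndex A k) i : ℤ) : ℝ) * ω i = 2 * Real.pi * n := by
    have h2 := congrArg Complex.im hn
    have h3 : ((n : ℂ) * (2 * Real.pi * Complex.I)).im = 2 * Real.pi * n := by
      simp [mul_comm]
    rw [h3] at h2
    rw [← h2]
    rw [mul_comm Complex.I, Complex.im_ofReal_mul]; simp
  have hn2 := mul_left_cancel₀ Real.two_pi_pos.ne' hn'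
  have h3 := (hω.2 _ n (sub_eq_zero.2 hn2)).1
  have h4 : dualIndex A k = 0 := by
    rw [← append_blocks (dualIndex A k), h3]
    funext i
    exact Fin.addCases (fun j => Fin.append_left _ _ j) (fun j => j.elim0) i
  refine hk ?_
  have h5 : k = (dualIndex A k) ᵥ* A.1 := by
    rw [dualIndex, Matrix.vecMul_vecMul, ← Matrix.SpecialLinearGroup.coe_mul, inv_mul_cancel]
    simp
  rw [h5, h4, Matrix.zero_vecMul]

end Diophantine

/-! ### The conjugation defect, its order and its leading coefficient. -/

section Defect

variable {d : ℕ} {I : Set ℝ} {M : ℕ}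

/-- The sum `∑_{1 ≤ i < j} ε^i ρ_i`. -/
def resonantShift (ρ : ℕ → Torus d → (Fin d → ℝ)) (j : ℕ) (ε : ℝ) (x : Torus d) : Fin d → ℝ :=
  ∑ i ∈ Finset.Ico 1 j, ε ^ i • ρ i x

/-- The displacement of `F ∘ H^j - H^j ∘ (Id + Ω₀ + ∑_{1 ≤ i ≤ j} ε^i ρ_i)`, where
`F = Id + Ω₀ + u_ε`. -/
def defect (u : ℝ → Torus d → (Fin d → ℝ)) (Ω₀ : Fin d → ℝ) (h ρ : ℕ → Torus d → (Fin d → ℝ))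
    (j : ℕ) (ε : ℝ) (x : Torus d) : Fin d → ℝ :=
  nearIdentity h j ε x + u ε (x + torusProj (nearIdentity h j ε x)) - resonantShift ρ (j + 1) ε x
    - nearIdentity h j ε (x + torusProj (Ω₀ + resonantShift ρ (j + 1) ε x))

theorem nearIdentity_congr {h h' : ℕ → Torus d → (Fin d → ℝ)} {j : ℕ} (hh : ∀ i < j, h i = h' i) :
    nearIdentity h j = nearIdentity h' j := by
  funext ε x
  exact Finset.sum_congr rfl fun i hi => by rw [hh i (Finset.mem_range.1 hi)]

theorem resonantShift_congr {ρ ρ' : ℕ → Torus d → (Fin d → ℝ)} {j : ℕ}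
    (hρ : ∀ i, 1 ≤ i → i < j → ρ i = ρ' i) : resonantShift ρ j = resonantShift ρ' j := by
  funext ε x
  exact Finset.sum_congr rfl fun i hi => by
    rw [hρ i (Finset.mem_Ico.1 hi).1 (Finset.mem_Ico.1 hi).2]

theorem defect_congr {u : ℝ → Torus d → (Fin d → ℝ)} {Ω₀ : Fin d → ℝ}
    {h h' ρ ρ' : ℕ → Torus d → (Fin d → ℝ)} {j : ℕ} (hh : ∀ i < j, h i = h' i)
    (hρ : ∀ i, 1 ≤ i → i < j + 1 → ρ i = ρ' i) : defect u Ω₀ h ρ j = defect u Ω₀ h' ρ' j := by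
  funext ε x
  simp only [defect, nearIdentity_congr hh, resonantShift_congr hρ]

theorem nearIdentity_succ (h : ℕ → Torus d → (Fin d → ℝ)) (j : ℕ) (ε : ℝ) (x : Torus d) :
    nearIdentity h (j + 1) ε x = nearIdentity h j ε x + ε ^ (j + 1) • h j x :=
  Finset.sum_range_succ _ _

theorem resonantShift_succ (ρ : ℕ → Torus d → (Fin d → ℝ)) {j : ℕ} (hj : 1 ≤ j) (ε : ℝ)
    (x : Torus d) : resonantShift ρ (j + 1) ε x = resonantShift ρ j ε x + ε ^ j • ρ j x :=
  Finset.sum_Ico_succ_top hj _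

theorem UniformO.comp {X : Type} {E : Type} [SeminormedAddCommGroup E] {e : ℝ → X → E}
    (h : UniformO I e M) (φ : ℝ → X → X) : UniformO I (fun ε x => e ε (φ ε x)) M := by
  obtain ⟨K, hK, δ, hδ, h⟩ := uniformO_iff.1 h
  exact uniformO_iff.2 ⟨K, hK, δ, hδ, fun ε hε hεδ x => h ε hε hεδ _⟩

/-- Lipschitz continuity of a function on the torus, in terms of lifts of the displacements. -/
def IsTorusLipschitz (g : Torus d → (Fin d → ℝ)) : Prop :=
  ∃ K, 0 ≤ K ∧ ∀ (x : Torus d) (v w : Fin d → ℝ),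
    ‖g (x + torusProj v) - g (x + torusProj w)‖ ≤ K * ‖v - w‖

theorem IsTorusLipschitz.uniformO {g : Torus d → (Fin d → ℝ)} (hg : IsTorusLipschitz g)
    {a b : ℝ → Torus d → (Fin d → ℝ)} (hab : UniformO I (fun ε x => a ε x - b ε x) M) :
    UniformO I (fun ε x => g (x + torusProj (a ε x)) - g (x + torusProj (b ε x))) M := by
  obtain ⟨K, _, hK⟩ := hg
  exact hab.norm_le fun ε _ x => hK x _ _

/-- Every term of the displacement carries a factor `ε`, hence the gain of one order over the change
of the argument. -/
theorem uniformO_nearIdentity_sub {h : ℕ → Torus d → (Fin d → ℝ)} {j : ℕ}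
    (hh : ∀ i < j, IsTorusLipschitz (h i)) {a b : ℝ → Torus d → (Fin d → ℝ)}
    (hab : UniformO I (fun ε x => a ε x - b ε x) M) :
    UniformO I (fun ε x => nearIdentity h j ε (x + torusProj (a ε x)) -
      nearIdentity h j ε (x + torusProj (b ε x))) (M + 1) := by
  have h1 : ∀ i ∈ Finset.range j, UniformO I (fun ε x =>
      ε ^ (i + 1) • (h i (x + torusProj (a ε x)) - h i (x + torusProj (b ε x)))) (M + 1) :=
    fun i hi => (((hh i (Finset.mem_range.1 hi)).uniformO hab).pow_smul (i + 1)).mono (by omega)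
  refine (UniformO.sum h1).congr fun ε x => ?_
  simp only [nearIdentity, smul_sub, Finset.sum_sub_distrib]

theorem uniformO_nearIdentity {h : ℕ → Torus d → (Fin d → ℝ)} {j : ℕ}
    (hh : ∀ i < j, ∃ C, ∀ x, ‖h i x‖ ≤ C) : UniformO I (nearIdentity h j) 1 := by
  refine UniformO.sum (s := Finset.range j) (u := fun i ε x => ε ^ (i + 1) • h i x) fun i hi => ?_
  obtain ⟨C, hC⟩ := hh i (Finset.mem_range.1 hi)
  exact ((uniformO_const hC).pow_smul (i + 1)).mono (by omega)

theorem uniformO_resonantShift {ρ : ℕ → Torus d → (Fin d → ℝ)} {j : ℕ}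
    (hρ : ∀ i, 1 ≤ i → i < j → ∃ C, ∀ x, ‖ρ i x‖ ≤ C) : UniformO I (resonantShift ρ j) 1 := by
  refine UniformO.sum (s := Finset.Ico 1 j) (u := fun i ε x => ε ^ i • ρ i x) fun i hi => ?_
  obtain ⟨h1, h2⟩ := Finset.mem_Ico.1 hi
  obtain ⟨C, hC⟩ := hρ i h1 h2
  exact ((uniformO_const hC).pow_smul i).mono (by omega)

/-- A family that coincides up to `O(ε^{N+1})` with `∑_{i < N} ε^{i+1} F_i`. -/
def HasTaylor (I : Set ℝ) (u : ℝ → Torus d → (Fin d → ℝ)) (F : ℕ → Torus d → (Fin d → ℝ))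
    (N : ℕ) : Prop :=
  UniformO I (fun ε x => u ε x - nearIdentity F N ε x) (N + 1)

/-- The polynomial part of `u` gains one order as above, and the remainder is `O(ε^{N+1})` at both
points separately, so no Lipschitz bound for `u` itself is required. -/
theorem HasTaylor.uniformO_sub {u : ℝ → Torus d → (Fin d → ℝ)} {F : ℕ → Torus d → (Fin d → ℝ)}
    {N : ℕ} (hu : HasTaylor I u F N) (hF : ∀ i < N, IsTorusLipschitz (F i)) (hM : M ≤ N)
    {a b : ℝ → Torus d → (Fin d → ℝ)} (hab : UniformO I (fun ε x => a ε x - b ε x) M) :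
    UniformO I (fun ε x => u ε (x + torusProj (a ε x)) - u ε (x + torusProj (b ε x))) (M + 1) := by
  have h1 := (hu.mono (Nat.add_le_add_right hM 1)).comp fun ε x => x + torusProj (a ε x)
  have h2 := (hu.mono (Nat.add_le_add_right hM 1)).comp fun ε x => x + torusProj (b ε x)
  exact ((uniformO_nearIdentity_sub hF hab).add (h1.sub h2)).congr fun ε x => by abel

/-- In the averaging condition the term `ε^{j+1} p` sits inside the argument of `H^j`, while the
defect contains resonant terms only. The passage is free at this order: moving the argument by
`O(ε^{j+1})` changes the displacement of `H^j` by `O(ε^{j+2})`. -/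
theorem displace_defect {u : ℝ → Torus d → (Fin d → ℝ)} {Ω₀ : Fin d → ℝ}
    {h ρ : ℕ → Torus d → (Fin d → ℝ)} {j : ℕ} {p : Torus d → (Fin d → ℝ)}
    (hh : ∀ i < j, IsTorusLipschitz (h i)) (hp : ∃ C, ∀ x, ‖p x‖ ≤ C)
    (hdef : UniformO I (fun ε x => defect u Ω₀ h ρ j ε x - ε ^ (j + 1) • p x) (j + 2)) :
    UniformO I (fun ε x => nearIdentity h j ε x + u ε (x + torusProj (nearIdentity h j ε x))
      - (resonantShift ρ (j + 1) ε x + ε ^ (j + 1) • p x)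
      - nearIdentity h j ε (x + torusProj (Ω₀ + (resonantShift ρ (j + 1) ε x
        + ε ^ (j + 1) • p x)))) (j + 2) := by
  obtain ⟨C, hC⟩ := hp
  have h1 : UniformO I (fun ε x => (Ω₀ + (resonantShift ρ (j + 1) ε x + ε ^ (j + 1) • p x)) -
      (Ω₀ + resonantShift ρ (j + 1) ε x)) (j + 1) :=
    ((uniformO_const hC).pow_smul (j + 1)).congr fun ε x => by abel
  refine (hdef.sub (uniformO_nearIdentity_sub hh h1)).congr fun ε x => ?_
  simp only [defect]
  abel

/-- Adding the next term of the near-identity map improves the order of the defect by one. -/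
theorem uniformO_defect_succ {u : ℝ → Torus d → (Fin d → ℝ)} {Ω₀ : Fin d → ℝ}
    {F h ρ : ℕ → Torus d → (Fin d → ℝ)} {j N : ℕ} {p : Torus d → (Fin d → ℝ)}
    (hj : j + 1 ≤ N) (hu : HasTaylor I u F N) (hF : ∀ i < N, IsTorusLipschitz (F i))
    (hh : ∀ i ≤ j, IsTorusLipschitz (h i)) (hhb : ∃ C, ∀ x, ‖h j x‖ ≤ C)
    (hρ : ∀ i, 1 ≤ i → i < j + 2 → ∃ C, ∀ x, ‖ρ i x‖ ≤ C)
    (hdef : UniformO I (fun ε x => defect u Ω₀ h ρ j ε x - ε ^ (j + 1) • p x) (j + 2))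
    (hcoh : ∀ x, h j x - h j (x + torusProj Ω₀) + p x = ρ (j + 1) x) :
    UniformO I (defect u Ω₀ h ρ (j + 1)) (j + 2) := by
  obtain ⟨Ch, hCh⟩ := hhb
  obtain ⟨Cρ, hCρ⟩ := hρ (j + 1) (by omega) (by omega)
  have h1 : UniformO I (fun ε x => nearIdentity h (j + 1) ε x - nearIdentity h j ε x) (j + 1) :=
    ((uniformO_const hCh).pow_smul (j + 1)).congr fun ε x => by
      rw [nearIdentity_succ]; abel
  have h2 : UniformO I (fun ε x => (Ω₀ + resonantShift ρ (j + 2) ε x) -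
      (Ω₀ + resonantShift ρ (j + 1) ε x)) (j + 1) :=
    ((uniformO_const hCρ).pow_smul (j + 1)).congr fun ε x => by
      rw [resonantShift_succ ρ (by omega)]; abel
  have h3 : UniformO I (fun ε x => (Ω₀ + resonantShift ρ (j + 2) ε x) - Ω₀) 1 :=
    (uniformO_resonantShift (j := j + 2) hρ).congr fun ε x => by abel
  -- Three changes are negligible at order `j + 2`: the new term in the argument of `u` (`h4`), the
  -- new resonant term in the argument of the old displacement (`h5`), and the evaluation of `h j`
  -- at `x + Ω₀` instead of the fully shifted point (`h6`). What is left at order `j + 1` cancels by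
  -- the cohomology equation.
  have h4 := hu.uniformO_sub hF hj h1
  have h5 := uniformO_nearIdentity_sub (j := j) (fun i hi => hh i (by omega)) h2
  have h6 := ((hh j le_rfl).uniformO h3).pow_smul (j + 1)
  refine (((hdef.add h4).sub h5).sub h6).congr fun ε x => ?_
  have h7 := hcoh x
  have h8 : p x = ρ (j + 1) x - h j x + h j (x + torusProj Ω₀) := by
    rw [← h7]; abel
  simp only [defect, nearIdentity_succ h j]
  rw [resonantShift_succ ρ (j := j + 1) (by omega), h8]
  simp only [smul_sub, smul_add]
  abel

variable {W : (Fin d → ℤ) → ℝ} {t : ℝ}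

theorem nearIdentity_mem (hW : IsWeight W) (ht : 0 ≤ t) {h : ℕ → Torus d → (Fin d → ℝ)} {j : ℕ}
    (hh : ∀ i < j, VectorClass W t (h i)) (c : Fin d) :
    (fun ε x => ((nearIdentity h j ε x c : ℝ) : ℂ)) ∈ wienerExpansion I hW ht M := by
  have h1 : (fun ε x => ((nearIdentity h j ε x c : ℝ) : ℂ)) = ∑ i ∈ Finset.range j,
      (fun (ε : ℝ) _ => (ε : ℂ)) ^ (i + 1) * fun _ x => ((h i x c : ℝ) : ℂ) := by
    funext ε x
    simp [nearIdentity, Finset.sum_apply]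
  rw [h1]
  exact Subalgebra.sum_mem _ fun i hi => Subalgebra.mul_mem _
    (Subalgebra.pow_mem _ param_mem_expansionAlgebra _)
    (const_mem_expansionAlgebra (g := fun x => ((h i x c : ℝ) : ℂ))
      (hh i (Finset.mem_range.1 hi) c))

theorem resonantShift_mem (hW : IsWeight W) (ht : 0 ≤ t) {ρ : ℕ → Torus d → (Fin d → ℝ)} {j : ℕ}
    (hρ : ∀ i, 1 ≤ i → i < j → VectorClass W t (ρ i)) (c : Fin d) :
    (fun ε x => ((resonantShift ρ j ε x c : ℝ) : ℂ)) ∈ wienerExpansion I hW ht M := by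
  have h1 : (fun ε x => ((resonantShift ρ j ε x c : ℝ) : ℂ)) = ∑ i ∈ Finset.Ico 1 j,
      (fun (ε : ℝ) _ => (ε : ℂ)) ^ i * fun _ x => ((ρ i x c : ℝ) : ℂ) := by
    funext ε x
    simp [resonantShift, Finset.sum_apply]
  rw [h1]
  exact Subalgebra.sum_mem _ fun i hi => Subalgebra.mul_mem _
    (Subalgebra.pow_mem _ param_mem_expansionAlgebra _)
    (const_mem_expansionAlgebra (g := fun x => ((ρ i x c : ℝ) : ℂ))
      (hρ i (Finset.mem_Ico.1 hi).1 (Finset.mem_Ico.1 hi).2 c))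

/-- The prefactor `ε^{i+1}` shortens the expansion required of `h i`, so the number of derivatives
decreases with `i`. Later, rougher terms of `H` are therefore admissible. -/
theorem nearIdentity_comp_mem (hW : IsWeight W) (ht : 1 ≤ t) {h : ℕ → Torus d → (Fin d → ℝ)}
    {j : ℕ} (hh : ∀ i < j, VectorClass W (t + (M - (i + 2) : ℕ)) (h i))
    {v : ℝ → Torus d → (Fin d → ℝ)} (hv : ∀ i, (fun ε x => ((v ε x i : ℝ) : ℂ)) ∈
      wienerExpansion I hW (zero_le_one.trans ht) M) (hv1 : UniformO I v 1) (y : Torus d)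
    (c : Fin d) :
    (fun ε x => ((nearIdentity h j ε (x + torusProj (v ε x) + y) c : ℝ) : ℂ)) ∈
      wienerExpansion I hW (zero_le_one.trans ht) M := by
  have h1 : (fun ε x => ((nearIdentity h j ε (x + torusProj (v ε x) + y) c : ℝ) : ℂ)) =
      ∑ i ∈ Finset.range j, fun (ε : ℝ) x => (ε : ℂ) ^ (i + 1) *
        (fun x => ((h i (x + y) c : ℝ) : ℂ)) (x + torusProj (v ε x)) := by
    funext ε x
    simp [nearIdentity, Finset.sum_apply]
  rw [h1]
  exact Subalgebra.sum_mem _ fun i hi => pow_mul_comp_mem hW ht hv hv1 (i := i + 1)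
    (B := M - (i + 2)) (by omega) (WienerClass.translate hW (hh i (Finset.mem_range.1 hi) c) y)

/-- The leading coefficient of the defect, with its regularity. -/
theorem exists_defect_coefficient [(𝓝[I \ {0}] (0 : ℝ)).NeBot] (hW : IsWeight W) (ht : 1 ≤ t)
    {u : ℝ → Torus d → (Fin d → ℝ)} {Ω₀ : Fin d → ℝ} {F h ρ : ℕ → Torus d → (Fin d → ℝ)}
    {j N : ℕ} (hj : j + 1 ≤ N) (hu : HasTaylor I u F N)
    (hF : ∀ i < N, VectorClass W (t + (j - i : ℕ)) (F i))
    (hh : ∀ i < j, VectorClass W (t + (j - i : ℕ)) (h i))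
    (hρ : ∀ i, 1 ≤ i → i < j + 1 → VectorClass W t (ρ i))
    (hdef : UniformO I (defect u Ω₀ h ρ j) (j + 1)) :
    ∃ p : Torus d → (Fin d → ℝ), VectorClass W t p ∧
      UniformO I (fun ε x => defect u Ω₀ h ρ j ε x - ε ^ (j + 1) • p x) (j + 2) := by
  have ht0 : 0 ≤ t := zero_le_one.trans ht
  have hmono : ∀ {g : Torus d → (Fin d → ℝ)} {i : ℕ}, VectorClass W (t + (j - i : ℕ)) g →
      VectorClass W t g := fun hg => hg.mono hW (by simp)
  have hv := fun c => nearIdentity_mem (I := I) (M := j + 2) hW ht0 (fun i hi => hmono (hh i hi)) c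
  have hv1 : UniformO I (nearIdentity h j) 1 := uniformO_nearIdentity fun i hi =>
    let ⟨C, _, hC⟩ := (hmono (hh i hi)).bounded hW ht0
    ⟨C, hC⟩
  have hw := fun c => resonantShift_mem (I := I) (M := j + 2) hW ht0 hρ c
  have hw1 : UniformO I (resonantShift ρ (j + 1)) 1 := uniformO_resonantShift fun i h1 h2 =>
    let ⟨C, _, hC⟩ := (hρ i h1 h2).bounded hW ht0
    ⟨C, hC⟩
  have hmem : ∀ c, (fun ε x => ((defect u Ω₀ h ρ j ε x c : ℝ) : ℂ)) ∈
      wienerExpansion I hW ht0 (j + 2) := by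
    intro c
    have h1 := nearIdentity_comp_mem (M := j + 2) (h := F) (j := N) hW ht
      (fun i hi => by simpa using hF i hi) hv hv1 0 c
    -- Since `j + 1 ≤ N`, the Taylor remainder of `u` is of order `j + 2`. It belongs to the algebra
    -- by size alone, without any regularity in `x`.
    have h2 : (fun ε x => ((u ε (x + torusProj (nearIdentity h j ε x)) c -
        nearIdentity F N ε (x + torusProj (nearIdentity h j ε x)) c : ℝ) : ℂ)) ∈
        wienerExpansion I hW ht0 (j + 2) :=
      (uniformO_ofReal.2 (((hu.mono (by omega : j + 2 ≤ N + 1)).comp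
        fun ε x => x + torusProj (nearIdentity h j ε x)).apply c)).mem_expansionAlgebra
    have h3 := nearIdentity_comp_mem (M := j + 2) (h := h) (j := j) hW ht
      (fun i hi => by simpa using hh i hi) hw hw1 (torusProj Ω₀) c
    have h4 := Subalgebra.sub_mem _ (Subalgebra.sub_mem _ (Subalgebra.add_mem _ (hv c)
      (Subalgebra.add_mem _ h1 h2)) (hw c)) h3
    convert h4 using 1
    funext ε x
    simp only [defect, Pi.add_apply, Pi.sub_apply, torusProj_add, add_zero]
    rw [add_assoc x, add_comm (torusProj (resonantShift ρ (j + 1) ε x)) (torusProj Ω₀)]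
    push_cast
    ring
  choose p hp hpO using fun c => exists_leading_coefficient (hmem c)
    (uniformO_ofReal.2 (hdef.apply c))
  refine ⟨fun x c => (p c x).re, fun c => WienerClass.re hW ht0 (hp c), uniformO_pi fun c => ?_⟩
  refine (hpO c).re.congr fun ε x => ?_
  have h1 : ((ε : ℂ) ^ (j + 1) * p c x).re = ε ^ (j + 1) * (p c x).re := by
    rw [← Complex.ofReal_pow, Complex.re_ofReal_mul]
  simp only [Complex.sub_re, Complex.ofReal_re, h1, Pi.sub_apply, Pi.smul_apply, smul_eq_mul]

end Defect

/-! ### Induction over the averaging steps and the count of regularity. -/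

section Averaging

variable {r s : ℕ}

/-- One step of the averaging procedure, in the scale of Wiener classes. -/
structure IsAveragingStep (I : Set ℝ) (W : (Fin (r + s) → ℤ) → ℝ) (T τ : ℝ)
    (u : ℝ → Torus (r + s) → (Fin (r + s) → ℝ)) (Ω₀ : Fin (r + s) → ℝ)
    (A : Matrix.SpecialLinearGroup (Fin (r + s)) ℤ)
    (h p : ℕ → Torus (r + s) → (Fin (r + s) → ℝ)) (R : ℕ → Torus s → (Fin (r + s) → ℝ))
    (j : ℕ) : Prop where
  class_p : VectorClass W (T - j * (τ + 1)) (p (j + 1))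
  class_R : VectorClass W (T - j * (τ + 1)) fun x => R (j + 1) (sndBlock (torusMatrix A.1 x))
  class_h : VectorClass W (T - j * (τ + 1) - τ) (h j)
  coefficient : UniformO I (fun ε x => defect u Ω₀ h
    (fun i x => R i (sndBlock (torusMatrix A.1 x))) j ε x - ε ^ (j + 1) • p (j + 1) x) (j + 2)
  average : ∀ z : Torus s, R (j + 1) z =
    ∫ y : Torus r, p (j + 1) (torusMatrix (A⁻¹).1 (Fin.append y z)) ∂torusHaar r
  cohomology : ∀ x, h j x - h j (x + torusProj Ω₀) + p (j + 1) x =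
    R (j + 1) (sndBlock (torusMatrix A.1 x))
  normalization : ∀ z : Torus s,
    ∫ y : Torus r, h j (torusMatrix (A⁻¹).1 (Fin.append y z)) ∂torusHaar r = 0
  defect_next : UniformO I (defect u Ω₀ h
    (fun i x => R i (sndBlock (torusMatrix A.1 x))) (j + 1)) (j + 2)

variable {I : Set ℝ} {W : (Fin (r + s) → ℤ) → ℝ} {T τ : ℝ}
  {u : ℝ → Torus (r + s) → (Fin (r + s) → ℝ)} {Ω₀ : Fin (r + s) → ℝ}
  {A : Matrix.SpecialLinearGroup (Fin (r + s)) ℤ}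

/-- Step `j` involves only finitely many entries of the sequences, so the steps already made survive
when a further entry is filled in. -/
theorem IsAveragingStep.congr {h p h' p' : ℕ → Torus (r + s) → (Fin (r + s) → ℝ)}
    {R R' : ℕ → Torus s → (Fin (r + s) → ℝ)} {j : ℕ}
    (H : IsAveragingStep I W T τ u Ω₀ A h p R j) (hh : ∀ i ≤ j, h i = h' i)
    (hp : p (j + 1) = p' (j + 1)) (hR : ∀ i ≤ j + 1, R i = R' i) :
    IsAveragingStep I W T τ u Ω₀ A h' p' R' j := by
  have hd := defect_congr (u := u) (Ω₀ := Ω₀) (h := h) (h' := h')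
    (ρ := fun i x => R i (sndBlock (torusMatrix A.1 x)))
    (ρ' := fun i x => R' i (sndBlock (torusMatrix A.1 x))) (j := j)
    (fun i hi => hh i hi.le) (fun i _ hi => by rw [hR i hi.le])
  have hd' := defect_congr (u := u) (Ω₀ := Ω₀) (h := h) (h' := h')
    (ρ := fun i x => R i (sndBlock (torusMatrix A.1 x)))
    (ρ' := fun i x => R' i (sndBlock (torusMatrix A.1 x))) (j := j + 1)
    (fun i hi => hh i (by omega)) (fun i _ hi => by rw [hR i (by omega)])
  obtain ⟨h1, h2, h3, h4, h5, h6, h7, h8⟩ := H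
  rw [hd, hp] at h4
  rw [hd'] at h8
  rw [hp] at h1 h5 h6
  rw [hh j le_rfl] at h3 h6 h7
  rw [hR (j + 1) le_rfl] at h2 h5 h6
  exact ⟨h1, h2, h3, h4, h5, h6, h7, h8⟩

theorem VectorClass.isTorusLipschitz {d : ℕ} {W : (Fin d → ℤ) → ℝ} {t : ℝ}
    {g : Torus d → (Fin d → ℝ)} (hg : VectorClass W t g) (hW : IsWeight W) (ht : 1 ≤ t) :
    IsTorusLipschitz g := hg.lipschitz hW ht

theorem VectorClass.exists_bound {d : ℕ} {W : (Fin d → ℤ) → ℝ} {t : ℝ}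
    {g : Torus d → (Fin d → ℝ)} (hg : VectorClass W t g) (hW : IsWeight W) (ht : 0 ≤ t) :
    ∃ C, ∀ x, ‖g x‖ ≤ C :=
  let ⟨C, _, hC⟩ := hg.bounded hW ht
  ⟨C, hC⟩

/-- The averaging procedure can be carried out in the scale of Wiener classes. -/
theorem exists_averaging_steps [(𝓝[I \ {0}] (0 : ℝ)).NeBot] (hW : IsWeight W) (hτ : 0 ≤ τ)
    {N : ℕ} (hT : 1 ≤ T - N * τ - (N - 1 : ℝ)) (hdiv : SmallDivisorBound A W τ Ω₀)
    {F : ℕ → Torus (r + s) → (Fin (r + s) → ℝ)} (hu : HasTaylor I u F N)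
    (hF : ∀ i, VectorClass W T (F i)) : ∀ n ≤ N,
    ∃ (h p : ℕ → Torus (r + s) → (Fin (r + s) → ℝ)) (R : ℕ → Torus s → (Fin (r + s) → ℝ)),
      ∀ j < n, IsAveragingStep I W T τ u Ω₀ A h p R j := by
  intro n
  induction n with
  | zero => exact fun _ => ⟨0, 0, 0, fun j hj => absurd hj (Nat.not_lt_zero j)⟩
  | succ n ih =>
    intro hn
    obtain ⟨h, p, R, H⟩ := ih (by omega)
    have hnN : (n : ℝ) + 1 ≤ N := by exact_mod_cast hn
    -- The worst case `n = N - 1` is precisely the hypothesis on `T`.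
    have hbase : 1 ≤ T - n * (τ + 1) - τ := by nlinarith
    have hj : ∀ {j : ℕ}, j ≤ n → (n - j : ℕ) = (n : ℝ) - j ∧ (j : ℝ) ≤ n := fun hj =>
      ⟨Nat.cast_sub hj, by exact_mod_cast hj⟩
    have hle : ∀ {j : ℕ}, j ≤ n → 1 ≤ T - j * (τ + 1) - τ := fun h' => by
      nlinarith [(hj h').2]
    -- The class of `h i` exceeds the required exponent by `(n - i - 1) * τ`, which is nonnegative
    -- for `i < n`.
    have hclass_h : ∀ i < n, VectorClass W (T - n * (τ + 1) + (n - i : ℕ)) (h i) := by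
      intro i hi
      refine (H i hi).class_h.mono hW ?_
      rw [(hj hi.le).1]
      have : (i : ℝ) + 1 ≤ n := by exact_mod_cast hi
      nlinarith
    have hclass_R : ∀ i, 1 ≤ i → i < n + 1 → VectorClass W (T - n * (τ + 1))
        fun x => R i (sndBlock (torusMatrix A.1 x)) := by
      intro i h1 h2
      obtain ⟨k, rfl⟩ : ∃ k, i = k + 1 := ⟨i - 1, by omega⟩
      refine (H k (by omega)).class_R.mono hW ?_
      nlinarith [(hj (show k ≤ n by omega)).2]
    have hclass_F : ∀ i < N, VectorClass W (T - n * (τ + 1) + (n - i : ℕ)) (F i) := by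
      intro i _
      refine (hF i).mono hW ?_
      have : ((n - i : ℕ) : ℝ) ≤ n := by exact_mod_cast Nat.sub_le n i
      have : (0 : ℝ) ≤ n * τ := by positivity
      nlinarith
    have hFlip : ∀ i < N, IsTorusLipschitz (F i) := fun i _ =>
      (hF i).isTorusLipschitz hW (by nlinarith [mul_nonneg (Nat.cast_nonneg (α := ℝ) n) hτ])
    have hdef : UniformO I (defect u Ω₀ h
        (fun i x => R i (sndBlock (torusMatrix A.1 x))) n) (n + 1) := by
      -- At the start `H` is the identity and the defect is `u` itself, which is `O(ε)`.
      rcases n with _ | n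
      · have h1 : UniformO I u 1 := by
          refine ((hu.mono (by omega : 1 ≤ N + 1)).add (uniformO_nearIdentity (j := N)
            fun i _ => (hF i).exists_bound hW ?_)).congr fun ε x => by abel
          nlinarith
        refine h1.congr fun ε x => ?_
        simp [defect, nearIdentity, resonantShift, torusProj_zero]
      · exact (H n (by omega)).defect_next
    obtain ⟨pn, hpn, hpO⟩ := exists_defect_coefficient (t := T - n * (τ + 1)) hW (by linarith)
      hn hu hclass_F hclass_h hclass_R hdef
    obtain ⟨hnew, Rnew, hh1, hR1, havg, hcoh, hnorm⟩ := exists_cohomology_solution (A := A)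
      (t := T - n * (τ + 1) - τ) hW hτ (by linarith) hdiv (by rwa [sub_add_cancel])
    rw [sub_add_cancel] at hR1
    refine ⟨Function.update h n hnew, Function.update p (n + 1) pn,
      Function.update R (n + 1) Rnew, fun j hjn => ?_⟩
    rcases Nat.lt_succ_iff_lt_or_eq.1 hjn with hlt | rfl
    · exact (H j hlt).congr (fun i hi => (Function.update_of_ne (by omega) _ _).symm)
        (Function.update_of_ne (by omega) _ _).symm
        fun i hi => (Function.update_of_ne (by omega) _ _).symm
    · have hupd_h : ∀ i < j, h i = Function.update h j hnew i := fun i hi =>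
        (Function.update_of_ne (by omega) _ _).symm
      have hupd_R : ∀ i < j + 1, R i = Function.update R (j + 1) Rnew i := fun i hi =>
        (Function.update_of_ne (by omega) _ _).symm
      have hcoef : UniformO I (fun ε x => defect u Ω₀ (Function.update h j hnew)
          (fun i x => Function.update R (j + 1) Rnew i (sndBlock (torusMatrix A.1 x))) j ε x
            - ε ^ (j + 1) • pn x) (j + 2) := by
        rw [← defect_congr (h := h) (ρ := fun i x => R i (sndBlock (torusMatrix A.1 x))) hupd_h
          (fun i _ hi => by rw [hupd_R i hi])]
        exact hpO
      refine ⟨by simpa using hpn, by simpa using hR1, by simpa using hh1, by simpa using hcoef,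
        by simpa using havg, by simpa using hcoh, by simpa using hnorm, ?_⟩
      refine uniformO_defect_succ (F := F) (p := pn) hn hu hFlip (fun i hi => ?_) ?_
        (fun i h1 h2 => ?_) hcoef (by simpa using hcoh)
      · rcases hi.lt_or_eq with hlt | rfl
        · rw [← hupd_h i hlt]
          exact (H i hlt).class_h.isTorusLipschitz hW (hle hi)
        · rw [Function.update_self]
          exact hh1.isTorusLipschitz hW hbase
      · rw [Function.update_self]
        exact hh1.exists_bound hW (by linarith)
      · rcases Nat.lt_succ_iff_lt_or_eq.1 h2 with hlt | rfl
        · rw [← hupd_R i hlt]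
          exact (hclass_R i h1 hlt).exists_bound hW (by linarith)
        · simp only [Function.update_self]
          exact hR1.exists_bound hW (by linarith)

end Averaging

/-! ### Near-identity diffeomorphisms and conjugated displacements. -/

section Diffeo

variable {d : ℕ} {κ : WithTop ℕ∞}

theorem torusProj_displaceLift (u : Torus d → (Fin d → ℝ)) (y : Fin d → ℝ) :
    torusProj (displaceLift u y) = displace u (torusProj y) := by
  rw [displaceLift, torusProj_add]; rfl

theorem _root_.TorusContDiff.comp_displace {e : ℕ} {g : Torus d → (Fin e → ℝ)}
    {φ : Torus d → (Fin d → ℝ)} (hg : TorusContDiff κ g) (hφ : TorusContDiff κ φ) :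
    TorusContDiff κ fun x => g (x + torusProj (φ x)) := by
  have h : periodicLift (fun x => g (x + torusProj (φ x))) =
      periodicLift g ∘ fun y => y + periodicLift φ y := by
    funext y
    simp [periodicLift, torusProj_add]
  unfold TorusContDiff
  rw [h]
  exact ContDiff.comp hg (contDiff_id.add hφ)

theorem _root_.TorusContDiff.add {e : ℕ} {g φ : Torus d → (Fin e → ℝ)} (hg : TorusContDiff κ g)
    (hφ : TorusContDiff κ φ) : TorusContDiff κ fun x => g x + φ x := ContDiff.add hg hφ

theorem _root_.TorusContDiff.sub {e : ℕ} {g φ : Torus d → (Fin e → ℝ)} (hg : TorusContDiff κ g)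
    (hφ : TorusContDiff κ φ) : TorusContDiff κ fun x => g x - φ x := ContDiff.sub hg hφ

theorem torusContDiff_const {e : ℕ} (c : Fin e → ℝ) :
    TorusContDiff κ fun _ : Torus d => c := contDiff_const

theorem _root_.TorusContDiff.const_smul {e : ℕ} {g : Torus d → (Fin e → ℝ)} (hg : TorusContDiff κ g)
    (c : ℝ) : TorusContDiff κ fun x => c • g x := ContDiff.const_smul c hg

theorem _root_.TorusContDiff.sum {e : ℕ} {ι : Type*} {s : Finset ι} {g : ι → Torus d → (Fin e → ℝ)}
    (hg : ∀ i ∈ s, TorusContDiff κ (g i)) : TorusContDiff κ fun x => ∑ i ∈ s, g i x :=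
  ContDiff.sum hg

/-- The inverse of a near-identity diffeomorphism of the torus. -/
theorem exists_inverse_displacement (hκ : 1 ≤ κ) {v : Torus d → (Fin d → ℝ)}
    (hv : TorusContDiff κ v)
    (hlip : ∀ (x : Torus d) (a b : Fin d → ℝ),
      ‖v (x + torusProj a) - v (x + torusProj b)‖ ≤ 1 / 2 * ‖a - b‖) :
    ∃ k : Torus d → (Fin d → ℝ), TorusContDiff κ k ∧
      Function.LeftInverse (displace k) (displace v) ∧
      Function.RightInverse (displace k) (displace v) ∧
      (∀ a b, ‖displaceLift k a - displaceLift k b‖ ≤ 2 * ‖a - b‖) ∧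
      ∀ a, displaceLift k (displaceLift v a) = a := by
  have hlip' : ∀ a b : Fin d → ℝ, ‖periodicLift v a - periodicLift v b‖ ≤ 1 / 2 * ‖a - b‖ :=
    fun a b => by simpa [periodicLift] using hlip 0 a b
  have hsub : ∀ a b, displaceLift v a - displaceLift v b =
      (a - b) + (periodicLift v a - periodicLift v b) := fun a b => by
    simp only [displaceLift, periodicLift]; abel
  have happ : ApproximatesLinearOn (displaceLift v)
      ((ContinuousLinearEquiv.refl ℝ (Fin d → ℝ) : (Fin d → ℝ) ≃L[ℝ] (Fin d → ℝ)) :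
        (Fin d → ℝ) →L[ℝ] (Fin d → ℝ)) Set.univ (1 / 2) := by
    intro a _ b _
    rw [hsub]
    simpa using hlip' a b
  -- The case `d = 0` is separate, since the identity then has norm zero.
  have hc : Subsingleton (Fin d → ℝ) ∨ (1 / 2 : NNReal) <
      ‖((ContinuousLinearEquiv.refl ℝ (Fin d → ℝ)).symm :
        (Fin d → ℝ) →L[ℝ] (Fin d → ℝ))‖₊⁻¹ := by
    rcases subsingleton_or_nontrivial (Fin d → ℝ) with h | h
    · exact Or.inl h
    · right
      have h1 : ‖((ContinuousLinearEquiv.refl ℝ (Fin d → ℝ)).symm :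
        (Fin d → ℝ) →L[ℝ] (Fin d → ℝ))‖₊ = 1 := by
        apply NNReal.eq
        exact ContinuousLinearMap.norm_id
      rw [h1, inv_one]
      exact NNReal.half_lt_self one_ne_zero
  let Φ := happ.toHomeomorph (displaceLift v) hc
  have hΦ : ∀ a, Φ a = displaceLift v a := fun a => rfl
  -- By uniqueness of preimages the inverse lift commutes with integer translations, so its
  -- displacement descends to the torus.
  have hshift : ∀ (a : Fin d → ℝ) (m : Fin d → ℝ), torusProj m = 0 →
      Φ.symm (a + m) = Φ.symm a + m := by
    intro a m hm
    rw [Homeomorph.symm_apply_eq, hΦ, displaceLift, torusProj_add, hm, add_zero, add_right_comm]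
    congr 1
    exact (Φ.apply_symm_apply a).symm
  let k : Torus d → (Fin d → ℝ) := fun x => Φ.symm (torusSection x) - torusSection x
  have hk : ∀ y, displaceLift k y = Φ.symm y := by
    intro y
    have h0 : torusProj (torusSection (torusProj y) - y) = 0 := by
      rw [torusProj_sub, torusProj_section, sub_self]
    have h1 := hshift y _ h0
    rw [add_sub_cancel] at h1
    simp only [displaceLift, k]
    rw [h1]
    abel
  have hinv : ∀ a, displaceLift k (displaceLift v a) = a := fun a => by
    rw [hk]; exact Φ.symm_apply_apply a
  refine ⟨k, ?_, fun x => ?_, fun x => ?_, fun a b => ?_, hinv⟩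
  · have hd : ∀ a, HasFDerivAt (periodicLift v) (fderiv ℝ (periodicLift v) a) a := fun a =>
      (ContDiff.differentiable hv (by rintro rfl; simp at hκ)).differentiableAt.hasFDerivAt
    have hL : LipschitzWith (1 / 2) (periodicLift v) :=
      LipschitzWith.of_dist_le_mul fun a b => by
        rw [dist_eq_norm, dist_eq_norm]; simpa using hlip' a b
    -- The derivative of `v` has norm at most `1 / 2`, so the derivative of the lift is invertible
    -- by a Neumann series and the inverse is as regular as `v`.
    have hn : ∀ a, ‖-fderiv ℝ (periodicLift v) a‖ < 1 := fun a => by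
      rw [norm_neg]
      refine (norm_fderiv_le_of_lipschitz ℝ hL).trans_lt ?_
      norm_num
    have hΦ' : ∀ a, HasFDerivAt Φ ((ContinuousLinearEquiv.unitsEquiv ℝ (Fin d → ℝ)
        (Units.oneSub _ (hn a)) : (Fin d → ℝ) ≃L[ℝ] (Fin d → ℝ)) :
          (Fin d → ℝ) →L[ℝ] (Fin d → ℝ)) a := by
      intro a
      refine ((hasFDerivAt_id a).add (hd a)).congr_fderiv ?_
      ext w
      simp
    have h1 := Φ.contDiff_symm (n := κ) hΦ' (contDiff_id.add hv)
    have h2 : periodicLift k = fun y => Φ.symm y - y := by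
      funext y
      rw [← hk y, displaceLift, periodicLift]; abel
    unfold TorusContDiff
    rw [h2]
    exact h1.sub contDiff_id
  · obtain ⟨y, rfl⟩ := torusProj_surjective x
    rw [← torusProj_displaceLift, ← torusProj_displaceLift, hinv]
  · obtain ⟨y, rfl⟩ := torusProj_surjective x
    rw [← torusProj_displaceLift, ← torusProj_displaceLift, hk]
    exact congrArg torusProj (Φ.apply_symm_apply y)
  · rw [hk, hk]
    have h1 := hsub (Φ.symm a) (Φ.symm b)
    rw [← hΦ, ← hΦ, Φ.apply_symm_apply, Φ.apply_symm_apply] at h1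
    have h2 := hlip' (Φ.symm a) (Φ.symm b)
    -- The distance of the preimages is at most `‖a - b‖` plus half of itself, whence the factor
    -- `2`.
    have h3 : Φ.symm a - Φ.symm b = (a - b) -
      (periodicLift v (Φ.symm a) - periodicLift v (Φ.symm b)) := by rw [h1]; abel
    have h4 := norm_sub_le (a - b) (periodicLift v (Φ.symm a) - periodicLift v (Φ.symm b))
    rw [← h3] at h4
    linarith

/-- The displacement of `K ∘ F ∘ H` for torus maps with displacements `k`, `w`, `v`. -/
def compDisplacement (k w v : Torus d → (Fin d → ℝ)) (x : Torus d) : Fin d → ℝ :=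
  v x + w (displace v x) + k (displace w (displace v x))

theorem displace_comp (k w v : Torus d → (Fin d → ℝ)) (x : Torus d) :
    displace k (displace w (displace v x)) = displace (compDisplacement k w v) x := by
  simp only [displace, compDisplacement, torusProj_add]
  abel_nf

theorem displaceLift_comp (k w v : Torus d → (Fin d → ℝ)) (y : Fin d → ℝ) :
    displaceLift k (displaceLift w (displaceLift v y)) =
      y + compDisplacement k w v (torusProj y) := by
  conv_lhs => rw [displaceLift, torusProj_displaceLift, torusProj_displaceLift, displaceLift,
    torusProj_displaceLift, displaceLift]
  simp only [compDisplacement]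
  abel

theorem _root_.TorusContDiff.compDisplacement {k w v : Torus d → (Fin d → ℝ)} (hk : TorusContDiff κ k)
    (hw : TorusContDiff κ w) (hv : TorusContDiff κ v) :
    TorusContDiff κ (compDisplacement k w v) := by
  have h1 : TorusContDiff κ fun x => v x + w (displace v x) := hv.add (hw.comp_displace hv)
  have h2 := h1.add (hk.comp_displace h1)
  convert h2 using 2 with x
  simp only [ResonantAveraging.compDisplacement, displace, torusProj_add]
  rw [add_assoc x]

end Diffeo

/-! ### Regularity under linear maps and block projections. -/

section Linear

variable {d : ℕ} {κ : WithTop ℕ∞}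

/-- The action of an integer matrix on `ℝ^d` as a continuous linear map. -/
noncomputable def realMatrixCLM (B : Matrix (Fin d) (Fin d) ℤ) : (Fin d → ℝ) →L[ℝ] (Fin d → ℝ) :=
  LinearMap.toContinuousLinearMap (Matrix.mulVecLin (B.map fun a : ℤ => (a : ℝ)))

theorem realMatrixCLM_apply (B : Matrix (Fin d) (Fin d) ℤ) (v : Fin d → ℝ) :
    realMatrixCLM B v = realMatrix B v := by
  simp [realMatrixCLM, realMatrix]

theorem _root_.TorusContDiff.realMatrix_comp {e : ℕ} (B : Matrix (Fin e) (Fin e) ℤ)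
    {g : Torus d → (Fin e → ℝ)} (hg : TorusContDiff κ g) :
    TorusContDiff κ fun x => realMatrix B (g x) := by
  have h := (realMatrixCLM B).contDiff.comp hg
  have h2 : periodicLift (fun x => realMatrix B (g x)) = realMatrixCLM B ∘ periodicLift g := by
    funext y; exact (realMatrixCLM_apply _ _).symm
  unfold TorusContDiff
  rw [h2]; exact h

theorem _root_.TorusContDiff.comp_torusMatrix {e : ℕ} (B : Matrix (Fin d) (Fin d) ℤ)
    {g : Torus d → (Fin e → ℝ)} (hg : TorusContDiff κ g) :
    TorusContDiff κ fun x => g (torusMatrix B x) := by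
  have h := ContDiff.comp hg (realMatrixCLM B).contDiff
  have h2 : periodicLift (fun x => g (torusMatrix B x)) = periodicLift g ∘ realMatrixCLM B := by
    funext y; simp [periodicLift, torusMatrix_torusProj, realMatrixCLM_apply]
  unfold TorusContDiff
  rw [h2]; exact h

variable {r s : ℕ}

theorem contDiff_fstBlock : ContDiff ℝ κ (fstBlock : (Fin (r + s) → ℝ) → (Fin r → ℝ)) :=
  contDiff_pi.2 fun i => contDiff_apply ℝ ℝ (Fin.castAdd s i)

theorem contDiff_sndBlock : ContDiff ℝ κ (sndBlock : (Fin (r + s) → ℝ) → (Fin s → ℝ)) :=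
  contDiff_pi.2 fun i => contDiff_apply ℝ ℝ (Fin.natAdd r i)

theorem _root_.TorusContDiff.fstBlock {g : Torus d → (Fin (r + s) → ℝ)} (hg : TorusContDiff κ g) :
    TorusContDiff κ fun x => fstBlock (g x) := contDiff_fstBlock.comp hg

theorem _root_.TorusContDiff.sndBlock {g : Torus d → (Fin (r + s) → ℝ)} (hg : TorusContDiff κ g) :
    TorusContDiff κ fun x => sndBlock (g x) := contDiff_sndBlock.comp hg


theorem _root_.TorusContDiff.comp_sndBlock {e : ℕ} {g : Torus s → (Fin e → ℝ)} (hg : TorusContDiff κ g) :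
    TorusContDiff κ fun x : Torus (r + s) => g (_root_.sndBlock x) :=
  ContDiff.comp (g := periodicLift g) hg contDiff_sndBlock

/-- A function of the resonant variables is as regular as its pullback to the torus. -/
theorem torusContDiff_of_pullback {e : ℕ} (A : Matrix.SpecialLinearGroup (Fin (r + s)) ℤ)
    {g : Torus s → (Fin e → ℝ)}
    (hg : TorusContDiff κ fun x : Torus (r + s) => g (_root_.sndBlock (torusMatrix A.1 x))) :
    TorusContDiff κ g := by
  have h1 := hg.comp_torusMatrix (A⁻¹).1
  simp only [torusMatrix_apply_inv] at h1
  have h2 : ContDiff ℝ κ fun y : Fin s → ℝ => (Fin.append (0 : Fin r → ℝ) y : Fin (r + s) → ℝ) := by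
    refine contDiff_pi.2 fun i => ?_
    refine Fin.addCases (fun j => ?_) (fun j => ?_) i
    · simpa using contDiff_const
    · simpa using contDiff_apply ℝ ℝ j
  have h3 := ContDiff.comp h1 h2
  have h4 : periodicLift g = (periodicLift fun x : Torus (r + s) => g (_root_.sndBlock x)) ∘
      fun y : Fin s → ℝ => (Fin.append (0 : Fin r → ℝ) y : Fin (r + s) → ℝ) := by
    funext y
    simp only [periodicLift, Function.comp]
    congr 1
    funext j
    simp [_root_.sndBlock, torusProj]
  unfold TorusContDiff
  rw [h4]
  exact h3

theorem norm_sndBlock_le (v : Fin (r + s) → ℝ) : ‖_root_.sndBlock v‖ ≤ ‖v‖ :=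
  (pi_norm_le_iff_of_nonneg (norm_nonneg _)).2 fun i => norm_le_pi_norm v (Fin.natAdd r i)

theorem norm_fstBlock_le' (v : Fin (r + s) → ℝ) : ‖_root_.fstBlock v‖ ≤ ‖v‖ :=
  (pi_norm_le_iff_of_nonneg (norm_nonneg _)).2 fun i => norm_le_pi_norm v (Fin.castAdd s i)

theorem append_add_torusProj (x₁ : Torus r) (x₂ : Torus s) (V : Fin (r + s) → ℝ) :
    (Fin.append x₁ x₂ : Torus (r + s)) + torusProj V =
      Fin.append (x₁ + torusProj (_root_.fstBlock V)) (x₂ + torusProj (_root_.sndBlock V)) := by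
  funext i
  refine Fin.addCases (fun j => ?_) (fun j => ?_) i <;>
    simp [_root_.fstBlock, _root_.sndBlock, torusProj]

end Linear

/-! ### From the defect to the averaging conditions and the normal form. -/

section Assembly

variable {r s : ℕ} {I : Set ℝ} {f : ℝ → Torus (r + s) → (Fin (r + s) → ℝ)}
  {Ω₀ : Fin (r + s) → ℝ} {A : Matrix.SpecialLinearGroup (Fin (r + s)) ℤ}
  {h p : ℕ → Torus (r + s) → (Fin (r + s) → ℝ)} {R : ℕ → Torus s → (Fin (r + s) → ℝ)}

/-- This matches the defect on lifts, as in the averaging condition, with the defect as a function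
on the torus, where Fourier series apply. -/
theorem displaceLift_defect (Ω₀ : Fin (r + s) → ℝ) (v w : Torus (r + s) → (Fin (r + s) → ℝ))
    (ε : ℝ) (y : Fin (r + s) → ℝ) :
    displaceLift (torusFamily f Ω₀ ε) (displaceLift v y) -
        displaceLift v (y + Ω₀ + w (torusProj y)) =
      v (torusProj y) + ε • f ε (torusProj y + torusProj (v (torusProj y))) - w (torusProj y) -
        v (torusProj y + torusProj (Ω₀ + w (torusProj y))) := by
  simp only [displaceLift, torusFamily, torusProj_add, add_assoc]
  abel

/-- A uniform `O(ε^{i+2})` is in particular a pointwise `o(ε^{i+1})`. Indices shift by one, because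
`p` and `R` start at `1` and `h` at `0`. -/
theorem isAveraging_of_steps {N : ℕ} (hh : ∀ j < N, IsTorusLipschitz (h j))
    (hp : ∀ j < N, ∃ C, ∀ x, ‖p (j + 1) x‖ ≤ C)
    (hcoef : ∀ j < N, UniformO I (fun ε x => defect (fun ε x => ε • f ε x) Ω₀ h
      (fun i x => R i (sndBlock (torusMatrix A.1 x))) j ε x - ε ^ (j + 1) • p (j + 1) x) (j + 2))
    (havg : ∀ j < N, ∀ z : Torus s, R (j + 1) z =
      ∫ y : Torus r, p (j + 1) (torusMatrix (A⁻¹).1 (Fin.append y z)) ∂torusHaar r)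
    (hcoh : ∀ j < N, ∀ x, h j x - h j (x + torusProj Ω₀) + p (j + 1) x =
      R (j + 1) (sndBlock (torusMatrix A.1 x)))
    (hnorm : ∀ j < N, ∀ z : Torus s,
      ∫ y : Torus r, h j (torusMatrix (A⁻¹).1 (Fin.append y z)) ∂torusHaar r = 0) :
    IsAveraging I f Ω₀ A N h p R where
  coefficient := by
    intro j h1 h2 x
    obtain ⟨i, rfl⟩ : ∃ i, j = i + 1 := ⟨j - 1, by omega⟩
    have h3 := displace_defect (fun k hk => hh k (by omega)) (hp i (by omega)) (hcoef i (by omega))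
    have h4 : Tendsto (fun ε : ℝ => (ε, torusProj x)) (𝓝[I] (0 : ℝ)) (𝓝[I] 0 ×ˢ ⊤) :=
      tendsto_id.prodMk tendsto_top
    have h5 := IsBigO.comp_tendsto h3 h4
    have h6 : (fun ε : ℝ => ε ^ (i + 2)) =o[𝓝[I] 0] fun ε : ℝ => ε ^ (i + 1) :=
      (isLittleO_pow_pow (by omega)).mono nhdsWithin_le_nhds
    refine (h5.trans_isLittleO h6).congr (fun ε => ?_) fun ε => rfl
    rw [add_tsub_cancel_right]
    exact ((congrArg _ (congrArg _ (by simp only [resonantShift, add_assoc]))).trans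
      (displaceLift_defect Ω₀ (nearIdentity h i ε) (fun x => resonantShift
        (fun i x => R i (sndBlock (torusMatrix A.1 x))) (i + 1) ε x + ε ^ (i + 1) • p (i + 1) x)
        ε x)).symm
  average := by
    intro j h1 h2
    obtain ⟨i, rfl⟩ : ∃ i, j = i + 1 := ⟨j - 1, by omega⟩
    exact havg i (by omega)
  cohomology := by
    intro j h1 h2
    obtain ⟨i, rfl⟩ : ∃ i, j = i + 1 := ⟨j - 1, by omega⟩
    exact hcoh i (by omega)
  normalization := by
    intro j h1 h2
    obtain ⟨i, rfl⟩ : ∃ i, j = i + 1 := ⟨j - 1, by omega⟩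
    exact hnorm i (by omega)

theorem exists_small_lipschitz {d : ℕ} {h : ℕ → Torus d → (Fin d → ℝ)} {N : ℕ}
    (hh : ∀ j < N, IsTorusLipschitz (h j)) :
    ∃ δ > 0, ∀ ε : ℝ, |ε| < δ → ∀ (x : Torus d) (a b : Fin d → ℝ),
      ‖nearIdentity h N ε (x + torusProj a) - nearIdentity h N ε (x + torusProj b)‖
        ≤ 1 / 2 * ‖a - b‖ := by
  have hh' : ∀ j, ∃ K, 0 ≤ K ∧ (j < N → ∀ (x : Torus d) (v w : Fin d → ℝ),
      ‖h j (x + torusProj v) - h j (x + torusProj w)‖ ≤ K * ‖v - w‖) := fun j => by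
    by_cases hj : j < N
    · obtain ⟨K, h1, h2⟩ := hh j hj
      exact ⟨K, h1, fun _ => h2⟩
    · exact ⟨0, le_rfl, fun h => absurd h hj⟩
  choose K hK0 hK using hh'
  set S := ∑ j ∈ Finset.range N, K j
  have hS : 0 ≤ S := Finset.sum_nonneg fun j _ => hK0 j
  -- For such `ε` one has `|ε| ≤ 1`, so each power is at most `|ε|`, and `|ε| * S ≤ 1 / 2`.
  refine ⟨1 / (2 * (S + 1)), by positivity, fun ε hε x a b => ?_⟩
  have hε1 : |ε| ≤ 1 := hε.le.trans (by rw [div_le_one (by positivity)]; linarith)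
  simp only [nearIdentity, ← Finset.sum_sub_distrib, ← smul_sub]
  refine (norm_sum_le _ _).trans ?_
  calc ∑ j ∈ Finset.range N, ‖ε ^ (j + 1) • (h j (x + torusProj a) - h j (x + torusProj b))‖
      ≤ ∑ j ∈ Finset.range N, |ε| * (K j * ‖a - b‖) := by
        refine Finset.sum_le_sum fun j hj => ?_
        rw [norm_smul, norm_pow, Real.norm_eq_abs, pow_succ']
        have h1 := hK j (Finset.mem_range.1 hj) x a b
        have h2 : |ε| * |ε| ^ j ≤ |ε| :=
          mul_le_of_le_one_right (abs_nonneg _) (pow_le_one₀ (abs_nonneg _) hε1)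
        exact mul_le_mul h2 h1 (norm_nonneg _) (abs_nonneg _)
    _ = |ε| * S * ‖a - b‖ := by rw [← Finset.mul_sum, ← Finset.sum_mul]; ring
    _ ≤ 1 / 2 * ‖a - b‖ := by
        gcongr
        have h1 : |ε| * (2 * (S + 1)) < 1 := by rwa [lt_div_iff₀ (by positivity)] at hε
        nlinarith [abs_nonneg ε]

variable {κ : WithTop ℕ∞} {n m : ℕ} {ω : Fin r → ℝ} {L : Fin (r + s) → ℤ}

theorem resonantShift_eq_resonantTerms (hn : 1 ≤ n)
    (hR : ∀ j, 1 ≤ j → j < n → R j = 0) (ε : ℝ) (x : Torus (r + s)) :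
    realMatrix A.1 (resonantShift (fun i x => R i (sndBlock (torusMatrix A.1 x))) (n + m) ε x) =
      ε ^ n • resonantTerms A n m R ε (sndBlock (torusMatrix A.1 x)) := by
  rw [resonantTerms, ← realMatrixCLM_apply, ← realMatrixCLM_apply, ← map_smul]
  congr 1
  rw [resonantShift, ← Finset.sum_Ico_consecutive _ hn (Nat.le_add_right n m),
    Finset.sum_eq_zero, zero_add, Finset.smul_sum]
  · refine Finset.sum_congr rfl fun j hj => ?_
    rw [smul_smul, ← pow_add, Nat.add_sub_cancel' (Finset.mem_Ico.1 hj).1]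
  · intro j hj
    obtain ⟨h1, h2⟩ := Finset.mem_Ico.1 hj
    simp [hR j h1 h2]

/-- The normal form, from the estimate of the defect of order `n + m - 1`. -/
theorem hasResonantNormalForm (hκ : 1 ≤ κ) (hn : 1 ≤ n)
    (hω : IsIntrinsicFrequency Ω₀ ω A L)
    (hf : ∀ ε ∈ I, TorusContDiff κ fun x => ε • f ε x)
    (hh : ∀ j < n + m - 1, TorusContDiff κ (h j))
    (hlip : ∀ j < n + m - 1, IsTorusLipschitz (h j))
    (hR : ∀ j, 1 ≤ j → j ≤ n + m - 1 → TorusContDiff κ (R j))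
    (hdef : UniformO I (defect (fun ε x => ε • f ε x) Ω₀ h
      (fun i x => R i (sndBlock (torusMatrix A.1 x))) (n + m - 1)) (n + m))
    (hR0 : ∀ j, 1 ≤ j → j < n → R j = 0) :
    HasResonantNormalForm κ I f Ω₀ ω A n m h
      (fun ε x₂ => fstBlock (resonantTerms A n m R ε x₂))
      (fun ε x₂ => sndBlock (resonantTerms A n m R ε x₂)) := by
  obtain ⟨δ, hδ, hsmall⟩ := exists_small_lipschitz hlip
  obtain ⟨K, hK, δ', hδ', hdefect⟩ := uniformO_iff.1 hdef
  have hvC : ∀ ε, TorusContDiff κ (nearIdentity h (n + m - 1) ε) := fun ε =>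
    TorusContDiff.sum fun j hj => (hh j (Finset.mem_range.1 hj)).const_smul _
  have hkex : ∀ ε : ℝ, ∃ k : Torus (r + s) → (Fin (r + s) → ℝ), |ε| < δ → TorusContDiff κ k ∧
      Function.LeftInverse (displace k) (displace (nearIdentity h (n + m - 1) ε)) ∧
      Function.RightInverse (displace k) (displace (nearIdentity h (n + m - 1) ε)) ∧
      (∀ a b, ‖displaceLift k a - displaceLift k b‖ ≤ 2 * ‖a - b‖) ∧
      ∀ a, displaceLift k (displaceLift (nearIdentity h (n + m - 1) ε) a) = a := fun ε => by
    by_cases hε : |ε| < δ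
    · obtain ⟨k, hk⟩ := exists_inverse_displacement hκ (hvC ε) (hsmall ε hε)
      exact ⟨k, fun _ => hk⟩
    · exact ⟨0, fun h => absurd h hε⟩
  choose k hk using hkex
  let ρ : ℕ → Torus (r + s) → (Fin (r + s) → ℝ) := fun i x => R i (sndBlock (torusMatrix A.1 x))
  let U : (Fin (r + s) → ℝ) → ℝ → Torus (r + s) → (Fin (r + s) → ℝ) := fun Ω ε =>
    compDisplacement (k ε) (torusFamily f Ω ε) (nearIdentity h (n + m - 1) ε)
  -- At `ε = 0` the inverse is zero by convention. This does no harm: the bracket vanishes there by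
  -- the defect estimate, so the normal form still holds.
  let res : ℝ → Torus (r + s) → (Fin (r + s) → ℝ) := fun ε x =>
    realMatrix A.1 ((ε ^ (n + m))⁻¹ • (U Ω₀ ε (torusMatrix (A⁻¹).1 x) - Ω₀ -
      resonantShift ρ (n + m) ε (torusMatrix (A⁻¹).1 x)))
  let Δ : (Fin (r + s) → ℝ) → ℝ → Torus (r + s) → (Fin (r + s) → ℝ) := fun Ω ε x =>
    realMatrix A.1 (U Ω ε (torusMatrix (A⁻¹).1 x) - U Ω₀ ε (torusMatrix (A⁻¹).1 x))
  have hUC : ∀ Ω, ∀ ε ∈ I, |ε| < δ → TorusContDiff κ (U Ω ε) := fun Ω ε hε hεδ =>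
    (hk ε hεδ).1.compDisplacement ((torusContDiff_const Ω).add (hf ε hε)) (hvC ε)
  have hρC : ∀ j, 1 ≤ j → j ≤ n + m - 1 → TorusContDiff κ (ρ j) := fun j h1 h2 =>
    ((hR j h1 h2).comp_sndBlock).comp_torusMatrix A.1
  have hwC : ∀ ε, TorusContDiff κ (resonantShift ρ (n + m) ε) := fun ε =>
    TorusContDiff.sum fun j hj => (hρC j (Finset.mem_Ico.1 hj).1
      (by have := (Finset.mem_Ico.1 hj).2; omega)).const_smul _
  -- The two sides of the conjugacy, `F ∘ H` and `H` after the averaged map, differ by the defect;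
  -- the `2`-Lipschitz inverse lift carries this bound over to the conjugated map.
  have hdef0 : ∀ ε ∈ I, |ε| < δ → |ε| < δ' → ∀ x,
      ‖U Ω₀ ε x - Ω₀ - resonantShift ρ (n + m) ε x‖ ≤ 2 * (K * |ε| ^ (n + m)) := by
    intro ε hε hεδ hεδ' x
    obtain ⟨y, rfl⟩ := torusProj_surjective x
    obtain ⟨-, -, -, hk1, hk2⟩ := hk ε hεδ
    have h1 := displaceLift_comp (k ε) (torusFamily f Ω₀ ε) (nearIdentity h (n + m - 1) ε) y
    have h2 := hk2 (y + Ω₀ + resonantShift ρ (n + m) ε (torusProj y))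
    have h3 := hk1 (displaceLift (torusFamily f Ω₀ ε)
      (displaceLift (nearIdentity h (n + m - 1) ε) y))
      (displaceLift (nearIdentity h (n + m - 1) ε)
        (y + Ω₀ + resonantShift ρ (n + m) ε (torusProj y)))
    rw [h1, h2, displaceLift_defect Ω₀ (nearIdentity h (n + m - 1) ε)
      (resonantShift ρ (n + m) ε) ε y] at h3
    have h4 := hdefect ε hε hεδ' (torusProj y)
    rw [defect, Nat.sub_add_cancel (by omega)] at h4
    have h5 : U Ω₀ ε (torusProj y) - Ω₀ - resonantShift ρ (n + m) ε (torusProj y) =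
      y + compDisplacement (k ε) (torusFamily f Ω₀ ε) (nearIdentity h (n + m - 1) ε) (torusProj y) -
        (y + Ω₀ + resonantShift ρ (n + m) ε (torusProj y)) := by
      simp only [U]; abel
    rw [h5]
    exact h3.trans (mul_le_mul_of_nonneg_left h4 zero_le_two)
  -- The maps at `Ω` and `Ω₀` differ by a constant, which the inverse lift at most doubles.
  have hΔ0 : ∀ Ω ε, |ε| < δ → ∀ x, ‖U Ω ε x - U Ω₀ ε x‖ ≤ 2 * ‖Ω - Ω₀‖ := by
    intro Ω ε hεδ x
    obtain ⟨y, rfl⟩ := torusProj_surjective x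
    obtain ⟨-, -, -, hk1, -⟩ := hk ε hεδ
    have h1 := displaceLift_comp (k ε) (torusFamily f Ω₀ ε) (nearIdentity h (n + m - 1) ε) y
    have h2 := displaceLift_comp (k ε) (torusFamily f Ω ε) (nearIdentity h (n + m - 1) ε) y
    have h3 := hk1 (displaceLift (torusFamily f Ω ε)
      (displaceLift (nearIdentity h (n + m - 1) ε) y)) (displaceLift (torusFamily f Ω₀ ε)
      (displaceLift (nearIdentity h (n + m - 1) ε) y))
    rw [h1, h2] at h3
    have h4 : displaceLift (torusFamily f Ω ε) (displaceLift (nearIdentity h (n + m - 1) ε) y) -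
        displaceLift (torusFamily f Ω₀ ε) (displaceLift (nearIdentity h (n + m - 1) ε) y) =
        Ω - Ω₀ := by
      simp only [displaceLift, torusFamily]; abel
    rw [h4] at h3
    refine le_trans (le_of_eq ?_) h3
    congr 1
    simp only [U]; abel
  set B := ‖realMatrixCLM A.1‖
  have hB : ∀ v, ‖realMatrix A.1 v‖ ≤ B * ‖v‖ := fun v => by
    rw [← realMatrixCLM_apply]; exact (realMatrixCLM A.1).le_opNorm v
  have hB0 : 0 ≤ B := norm_nonneg _
  -- The first summand of the constant bounds the remainder, the second the effect of `Ω - Ω₀`; `B`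
  -- is the norm of the linear map given by `A`.
  refine ⟨min δ δ', lt_min hδ hδ', B * 2 * K + B * 2, k, fun ε x => fstBlock (res ε x),
    fun ε x => sndBlock (res ε x), fun Ω ε x => fstBlock (Δ Ω ε x),
    fun Ω ε x => sndBlock (Δ Ω ε x), fun ε hε hεδ => ?_⟩
  obtain ⟨hεδ, hεδ'⟩ := lt_min_iff.1 hεδ
  obtain ⟨hkC, hkl, hkr, -, -⟩ := hk ε hεδ
  have hresC : TorusContDiff κ (res ε) :=
    (TorusContDiff.comp_torusMatrix (A⁻¹).1 ((((hUC Ω₀ ε hε hεδ).sub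
      (torusContDiff_const Ω₀)).sub (hwC ε)).const_smul _)).realMatrix_comp A.1
  have htermC : TorusContDiff κ (resonantTerms A n m R ε) :=
    (TorusContDiff.sum fun j hj => (hR j (hn.trans (Finset.mem_Ico.1 hj).1)
      (by have := (Finset.mem_Ico.1 hj).2; omega)).const_smul _).realMatrix_comp A.1
  have hresB : ∀ x, ‖res ε x‖ ≤ B * 2 * K + B * 2 := by
    intro x
    refine (hB _).trans ?_
    rw [norm_smul, norm_inv, norm_pow, Real.norm_eq_abs]
    have h1 := hdef0 ε hε hεδ hεδ' (torusMatrix (A⁻¹).1 x)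
    have h2 : (|ε| ^ (n + m))⁻¹ * ‖U Ω₀ ε (torusMatrix (A⁻¹).1 x) - Ω₀ -
        resonantShift ρ (n + m) ε (torusMatrix (A⁻¹).1 x)‖ ≤ 2 * K := by
      have h0 : 0 ≤ |ε| ^ (n + m) := by positivity
      calc _ ≤ (|ε| ^ (n + m))⁻¹ * (2 * (K * |ε| ^ (n + m))) := by gcongr
        _ = 2 * K * ((|ε| ^ (n + m))⁻¹ * |ε| ^ (n + m)) := by ring
        _ ≤ 2 * K * 1 := by
            gcongr
            exact inv_mul_le_one
        _ = 2 * K := mul_one _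
    calc B * _ ≤ B * (2 * K) := by gcongr
      _ ≤ _ := by linarith
  refine ⟨⟨hvC ε, hkC, hkl, hkr⟩, ⟨htermC.fstBlock, htermC.sndBlock⟩,
    ⟨hresC.fstBlock, hresC.sndBlock⟩, fun x => ⟨(norm_fstBlock_le' _).trans (hresB x),
      (norm_sndBlock_le _).trans (hresB x)⟩, fun Ω => ?_⟩
  have hΔC : TorusContDiff κ (Δ Ω ε) :=
    (TorusContDiff.comp_torusMatrix (A⁻¹).1
      ((hUC Ω ε hε hεδ).sub (hUC Ω₀ ε hε hεδ))).realMatrix_comp A.1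
  have hΔB : ∀ x, ‖Δ Ω ε x‖ ≤ (B * 2 * K + B * 2) * ‖Ω - Ω₀‖ := by
    intro x
    refine (hB _).trans ?_
    calc B * _ ≤ B * (2 * ‖Ω - Ω₀‖) := by gcongr; exact hΔ0 Ω ε hεδ _
      _ = (0 + B * 2) * ‖Ω - Ω₀‖ := by ring
      _ ≤ _ := by gcongr; positivity
  refine ⟨⟨hΔC.fstBlock, hΔC.sndBlock⟩, fun x => ⟨(norm_fstBlock_le' _).trans (hΔB x),
      (norm_sndBlock_le _).trans (hΔB x)⟩, fun x₁ x₂ => ?_⟩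
  set X : Torus (r + s) := Fin.append x₁ x₂ with hX
  have hAX := torusMatrix_apply_inv A X
  have hsnd : sndBlock X = x₂ := by funext i; simp [hX, sndBlock]
  have hpow : ε ^ (n + m) • res ε X = realMatrix A.1 (U Ω₀ ε (torusMatrix (A⁻¹).1 X) - Ω₀ -
      resonantShift ρ (n + m) ε (torusMatrix (A⁻¹).1 X)) := by
    simp only [res]
    rw [← realMatrixCLM_apply, ← realMatrixCLM_apply, ← map_smul]
    congr 1
    by_cases h0 : ε ^ (n + m) = 0
    · have h1 := hdef0 ε hε hεδ hεδ' (torusMatrix (A⁻¹).1 X)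
      rw [← abs_pow, h0, abs_zero, mul_zero, mul_zero] at h1
      rw [norm_le_zero_iff.1 h1]
      simp
    · rw [smul_inv_smul₀ h0]
  have hshift := resonantShift_eq_resonantTerms (A := A) (m := m) hn hR0 ε (torusMatrix (A⁻¹).1 X)
  rw [hAX, hsnd] at hshift
  -- Computed with representatives in `ℝ^d`, the identity carries the integer vector `L`, which
  -- disappears on the torus.
  have htotal : realMatrix A.1 (U Ω ε (torusMatrix (A⁻¹).1 X)) =
      (Fin.append ω (0 : Fin s → ℝ) + ε ^ n • resonantTerms A n m R ε x₂ +
        ε ^ (n + m) • res ε X + Δ Ω ε X) + fun i => (L i : ℝ) := by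
    rw [hpow, ← hshift]
    have h1 : (fun i => (L i : ℝ)) = realMatrix A.1 Ω₀ - Fin.append ω (0 : Fin s → ℝ) := by
      rw [hω.1]; abel
    rw [h1]
    simp only [Δ, ← realMatrixCLM_apply, map_sub]
    abel
  rw [displace_comp, displace, torusMatrix_add, hAX, torusMatrix_torusProj]
  rw [show realMatrix A.1 (compDisplacement (k ε) (torusFamily f Ω ε)
    (nearIdentity h (n + m - 1) ε) (torusMatrix (A⁻¹).1 X)) = _ from htotal]
  rw [torusProj_add, torusProj_intCast, add_zero, hX, append_add_torusProj]
  congr 3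
  · funext i; simp [fstBlock]
  · funext i; simp [sndBlock]

end Assembly

/-! ### Fourier coefficients and finite differences. -/

section Fourier

variable {d : ℕ} {u : Torus d → ℂ} {M : ℝ}

theorem mFourierCoeff_eq (u : Torus d → ℂ) (k : Fin d → ℤ) :
    mFourierCoeff u k = ∫ x, mFourier (-k) x * u x ∂torusHaar d := rfl

/-- Bessel's inequality, with the `L²` norm bounded by the sup norm on a probability space. -/
theorem sum_sq_mFourierCoeff_le (hu : Continuous u) (hM : ∀ x, ‖u x‖ ≤ M)
    (F : Finset (Fin d → ℤ)) : ∑ k ∈ F, ‖mFourierCoeff u k‖ ^ 2 ≤ M ^ 2 := by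
  set f : Lp ℂ 2 (torusHaar d) := ContinuousMap.toLp (E := ℂ) 2 (torusHaar d) ℂ ⟨u, hu⟩
  have hf : f =ᵐ[torusHaar d] u := ContinuousMap.coeFn_toLp (torusHaar d) ⟨u, hu⟩
  have h1 : HasSum (fun k => ‖mFourierCoeff f k‖ ^ 2) (∫ t, ‖f t‖ ^ 2 ∂torusHaar d) :=
    hasSum_sq_mFourierCoeff f
  have h2 : ∀ k, mFourierCoeff f k = mFourierCoeff u k := fun k => by
    rw [mFourierCoeff_eq, mFourierCoeff_eq]
    refine integral_congr_ae ?_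
    filter_upwards [hf] with x hx
    rw [hx]
  have h3 : ∫ t, ‖f t‖ ^ 2 ∂torusHaar d = ∫ t, ‖u t‖ ^ 2 ∂torusHaar d := by
    refine integral_congr_ae ?_
    filter_upwards [hf] with x hx
    rw [hx]
  simp only [h2, h3] at h1
  have h4 : ∫ t, ‖u t‖ ^ 2 ∂torusHaar d ≤ ∫ _t, M ^ 2 ∂torusHaar d := by
    refine integral_mono (integrable_torusHaar (by fun_prop)) (integrable_const _) fun x => ?_
    exact pow_le_pow_left₀ (norm_nonneg _) (hM x) 2
  rw [integral_const, probReal_univ, one_smul] at h4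
  exact (sum_le_hasSum F (fun _ _ => by positivity) h1).trans h4

theorem continuous_fwdDiff_iter (hu : Continuous u) (a : Torus d) (b : ℕ) :
    Continuous ((fwdDiff a)^[b] u) := by
  induction b with
  | zero => exact hu
  | succ b ih =>
    rw [Function.iterate_succ_apply']
    exact (ih.comp (continuous_id.add continuous_const)).sub ih

/-- Translation invariance makes a difference act as a multiplier on coefficients. Differences take
the place of derivatives, so no integration by parts is needed. -/
theorem mFourierCoeff_fwdDiff (hu : Continuous u) (a : Torus d) (k : Fin d → ℤ) :
    mFourierCoeff (fwdDiff a u) k = (mFourier k a - 1) * mFourierCoeff u k := by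
  have hc : ∀ b, Integrable (fun x => mFourier (-k) x * u (x + b)) (torusHaar d) := fun b =>
    integrable_torusHaar (by fun_prop)
  have h1 : ∫ x, mFourier (-k) x * u (x + a) ∂torusHaar d = mFourier k a * mFourierCoeff u k := by
    rw [mFourierCoeff_eq, ← integral_add_left_eq_self (fun x => mFourier (-k) x * u x) a, ← integral_const_mul]
    congr 1; funext x
    have : mFourier k a * mFourier (-k) a = 1 := by
      rw [← mFourier_add, add_neg_cancel, mFourier_zero]; rfl
    rw [mFourier_add_apply, add_comm a x]
    linear_combination (-(mFourier (-k) x * u (x + a))) * this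
  rw [mFourierCoeff_eq]
  simp only [fwdDiff, mul_sub]
  rw [integral_sub (hc a) (by simpa using hc 0), h1, mFourierCoeff_eq, sub_mul, one_mul]

theorem mFourierCoeff_fwdDiff_iter (hu : Continuous u) (a : Torus d) (k : Fin d → ℤ) (b : ℕ) :
    mFourierCoeff ((fwdDiff a)^[b] u) k = (mFourier k a - 1) ^ b * mFourierCoeff u k := by
  induction b with
  | zero => simp
  | succ b ih =>
    rw [Function.iterate_succ_apply', mFourierCoeff_fwdDiff (continuous_fwdDiff_iter hu a b), ih,
      pow_succ]
    ring

theorem phase_single (k : Fin d → ℤ) (i : Fin d) (s : ℝ) :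
    phase k (Pi.single i s) = 2 * Real.pi * k i * s := by
  rw [phase_apply, Finset.sum_eq_single i]
  · rw [Pi.single_eq_same]
  · intro j _ hj; rw [Pi.single_eq_of_ne hj, mul_zero]
  · simp

theorem tendsto_norm_mFourier_single_sub_one_div (k : Fin d → ℤ) (i : Fin d) :
    Tendsto (fun s : ℝ => ‖mFourier k (torusProj (Pi.single i s)) - 1‖ / |s|) (𝓝[≠] 0)
      (𝓝 (2 * Real.pi * |(k i : ℝ)|)) := by
  have h : HasDerivAt (fun s : ℝ => Complex.exp (Complex.I * ((2 * Real.pi * k i : ℝ) * (s : ℂ))))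
      (Complex.I * (2 * Real.pi * k i : ℝ)) 0 := by
    have := (((hasDerivAt_id (0 : ℂ)).const_mul ((2 * Real.pi * k i : ℝ) : ℂ)).const_mul
      Complex.I).cexp
    simpa using this.comp_ofReal (z := 0)
  have h2 := (hasDerivAt_iff_tendsto_slope_zero.1 h).norm
  have h3 : ‖Complex.I * ((2 * Real.pi * k i : ℝ) : ℂ)‖ = 2 * Real.pi * |(k i : ℝ)| := by
    rw [norm_mul, Complex.norm_I, one_mul, Complex.norm_real, Real.norm_eq_abs, abs_mul,
      abs_of_pos Real.two_pi_pos]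
  rw [h3] at h2
  refine h2.congr fun s => ?_
  rw [norm_smul, norm_inv, Real.norm_eq_abs, mFourier_torusProj, phase_single, div_eq_inv_mul]
  congr 2
  simp

/-- A function whose iterated differences in the direction `i` satisfy `|Δ_s^b u| ≤ M |s|^b` has
weighted square-summable Fourier coefficients. -/
theorem sum_sq_pow_mul_mFourierCoeff_le (hu : Continuous u) (i : Fin d) (b : ℕ)
    (hM : ∀ (s : ℝ) x, ‖(fwdDiff (torusProj (Pi.single i s)))^[b] u x‖ ≤ M * |s| ^ b)
    (F : Finset (Fin d → ℤ)) :
    ∑ k ∈ F, ((2 * Real.pi * |(k i : ℝ)|) ^ b * ‖mFourierCoeff u k‖) ^ 2 ≤ M ^ 2 := by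
  -- For each `s ≠ 0` Bessel's inequality applies to the `b`-th difference divided by `|s| ^ b`. As
  -- `s → 0` the multiplier tends in modulus to the symbol of the derivative, and the finite sum
  -- passes to the limit.
  have h1 : Tendsto (fun s : ℝ => ∑ k ∈ F,
      ((‖mFourier k (torusProj (Pi.single i s)) - 1‖ / |s|) ^ b * ‖mFourierCoeff u k‖) ^ 2) (𝓝[≠] 0)
      (𝓝 (∑ k ∈ F, ((2 * Real.pi * |(k i : ℝ)|) ^ b * ‖mFourierCoeff u k‖) ^ 2)) :=
    tendsto_finsetSum _ fun k _ =>
      (((tendsto_norm_mFourier_single_sub_one_div k i).pow b).mul_const _).pow 2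
  refine le_of_tendsto h1 ?_
  filter_upwards [self_mem_nhdsWithin] with s hs
  have hs' : 0 < |s| := abs_pos.2 hs
  have h2 := sum_sq_mFourierCoeff_le (continuous_fwdDiff_iter hu (torusProj (Pi.single i s)) b)
    (hM s) F
  have h3 : ∀ k, ((‖mFourier k (torusProj (Pi.single i s)) - 1‖ / |s|) ^ b
      * ‖mFourierCoeff u k‖) ^ 2
      = ‖mFourierCoeff ((fwdDiff (torusProj (Pi.single i s)))^[b] u) k‖ ^ 2 / (|s| ^ b) ^ 2 := by
    intro k
    rw [mFourierCoeff_fwdDiff_iter hu, norm_mul, norm_pow, div_pow, ← div_pow]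
    ring
  simp only [h3, ← Finset.sum_div]
  rw [div_le_iff₀ (by positivity), ← mul_pow]
  exact h2

theorem fourierSum_mFourierCoeff (hu : Continuous u) (h : Summable fun k => ‖mFourierCoeff u k‖) :
    u = fourierSum (mFourierCoeff u) := by
  funext x
  have := hasSum_mFourier_series_apply_of_summable (f := ⟨u, hu⟩) h.of_norm x
  exact (this.tsum_eq).symm.trans (tsum_congr fun k => by simp [smul_eq_mul])

end Fourier

/-! ### Finite differences bounded by derivatives. -/

section Differences

/-- Along a chain of derivatives, the `b`-th forward difference is bounded by the `b`-th derivative. -/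
theorem norm_fwdDiff_iter_le (s : ℝ) (b : ℕ) : ∀ {ψ : ℕ → ℝ → ℂ} {M : ℝ},
    (∀ j < b, ∀ t, HasDerivAt (ψ j) (ψ (j + 1) t) t) → (∀ t, ‖ψ b t‖ ≤ M) → ∀ t,
      ‖(fwdDiff s)^[b] (ψ 0) t‖ ≤ M * |s| ^ b := by
  induction b with
  | zero => intro ψ M _ hM t; simpa using hM t
  | succ b ih =>
    intro ψ M hψ hM t
    have h1 : ∀ j < b, ∀ t, HasDerivAt (fwdDiff s (ψ j)) (fwdDiff s (ψ (j + 1)) t) t := by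
      intro j hj t
      exact ((hψ j (by omega) (t + s)).comp_add_const t s).sub (hψ j (by omega) t)
    have h2 : ∀ t, ‖fwdDiff s (ψ b) t‖ ≤ M * |s| := by
      intro t
      have := Convex.norm_image_sub_le_of_norm_hasDerivWithin_le (s := Set.univ) (f := ψ b)
        (fun x _ => (hψ b (by omega) x).hasDerivWithinAt) (fun x _ => hM x) convex_univ
        (Set.mem_univ t) (Set.mem_univ (t + s))
      simpa [fwdDiff] using this
    have h3 := ih (ψ := fun j => fwdDiff s (ψ j)) h1 h2 t
    rw [Function.iterate_succ_apply]
    refine h3.trans (le_of_eq ?_)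
    rw [pow_succ]; ring

variable {d : ℕ}

/-- Differences on the torus become differences of a function of one real variable, where the mean
value inequality is available. -/
theorem fwdDiff_iter_line (u : Torus d → ℂ) (w v : Fin d → ℝ) (s : ℝ) (b : ℕ) (t : ℝ) :
    (fwdDiff (torusProj (s • w)))^[b] u (torusProj (v + t • w))
      = (fwdDiff s)^[b] (fun t => u (torusProj (v + t • w))) t := by
  induction b generalizing u with
  | zero => rfl
  | succ b ih =>
    rw [Function.iterate_succ_apply, Function.iterate_succ_apply, ih]
    refine congrArg (fun g => (fwdDiff s)^[b] g t) (funext fun t => ?_)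
    simp only [fwdDiff]
    rw [← torusProj_add, add_smul, add_assoc]

/-- If the restrictions of `u` to lines in the direction `i` have `b` derivatives, the last one
bounded by `M`, then `|Δ_s^b u| ≤ M |s|^b`. -/
theorem norm_fwdDiff_iter_torus_le {u : Torus d → ℂ} {i : Fin d} {b : ℕ} {M : ℝ}
    (h : ∀ v : Fin d → ℝ, ∃ ψ : ℕ → ℝ → ℂ,
      (∀ t, ψ 0 t = u (torusProj (v + t • Pi.single i 1))) ∧
      (∀ j < b, ∀ t, HasDerivAt (ψ j) (ψ (j + 1) t) t) ∧ ∀ t, ‖ψ b t‖ ≤ M) (s : ℝ) (x : Torus d) :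
    ‖(fwdDiff (torusProj (Pi.single i s)))^[b] u x‖ ≤ M * |s| ^ b := by
  obtain ⟨v, rfl⟩ := torusProj_surjective x
  obtain ⟨ψ, h0, h1, h2⟩ := h v
  have h3 := norm_fwdDiff_iter_le s b h1 h2 0
  have h4 := fwdDiff_iter_line u (Pi.single i 1) v s b 0
  rw [← Pi.single_smul, smul_eq_mul, mul_one, zero_smul, add_zero] at h4
  rw [h4, ← funext h0]
  exact h3

end Differences

/-! ### Decay of Fourier coefficients and membership in Wiener classes. -/

section Decay

variable {d : ℕ} {u : Torus d → ℂ} {M : ℝ}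

/-- A finite set of indices lies in a box, and over a box the sum of products is the product of
sums. -/
theorem summable_prod_apply {g : ℤ → ℝ} (hg0 : ∀ n, 0 ≤ g n) (hg : Summable g) (d : ℕ) :
    Summable fun k : Fin d → ℤ => ∏ i, g (k i) := by
  classical
  refine summable_of_sum_le (c := (∑' n, g n) ^ d)
    (fun k => Finset.prod_nonneg fun i _ => hg0 _) fun F => ?_
  set S : Fin d → Finset ℤ := fun i => F.image fun k => k i
  have h1 : F ⊆ Fintype.piFinset S := fun k hk =>
    Fintype.mem_piFinset.2 fun i => Finset.mem_image_of_mem _ hk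
  refine (Finset.sum_le_sum_of_subset_of_nonneg h1
    fun k _ _ => Finset.prod_nonneg fun i _ => hg0 _).trans ?_
  rw [← Finset.prod_univ_sum]
  calc ∏ i, ∑ n ∈ S i, g n ≤ ∏ _i : Fin d, ∑' n, g n :=
        Finset.prod_le_prod (fun i _ => Finset.sum_nonneg fun n _ => hg0 n)
          fun i _ => hg.sum_le_tsum _ fun n _ => hg0 n
    _ = (∑' n, g n) ^ d := by simp

theorem summable_inv_one_add_abs_sq : Summable fun n : ℤ => ((1 + |(n : ℝ)|) ^ 2)⁻¹ := by
  refine Summable.of_norm_bounded_eventually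
    (Real.summable_one_div_int_pow.2 one_lt_two) ?_
  rw [Filter.eventually_cofinite]
  refine (Set.finite_singleton (0 : ℤ)).subset fun n hn => ?_
  by_contra h0
  refine hn ?_
  have h1 : (0 : ℝ) < |(n : ℝ)| := by
    rw [abs_pos]; exact_mod_cast h0
  rw [norm_inv, norm_pow, one_div, Real.norm_of_nonneg (by positivity), ← sq_abs (n : ℝ)]
  gcongr
  linarith

/-- `(1 + ‖k‖) ^ (2 * d)` dominates the product of the factors `(1 + |k i|) ^ 2`, one convergent
series for each coordinate. -/
theorem summable_inv_one_add_norm_pow (d : ℕ) :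
    Summable fun k : Fin d → ℤ => ((1 + ‖k‖) ^ (2 * d))⁻¹ := by
  refine Summable.of_nonneg_of_le (fun k => by positivity) (fun k => ?_)
    (summable_prod_apply (fun n => by positivity) summable_inv_one_add_abs_sq d)
  rw [Finset.prod_inv_distrib]
  refine inv_anti₀ (Finset.prod_pos fun i _ => by positivity) ?_
  rw [pow_mul]
  calc ∏ i, (1 + |(k i : ℝ)|) ^ 2 ≤ ∏ _i : Fin d, (1 + ‖k‖) ^ 2 := by
        refine Finset.prod_le_prod (fun i _ => by positivity) fun i _ => ?_
        gcongr
        exact abs_coord_le_norm k i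
    _ = ((1 + ‖k‖) ^ 2) ^ d := by simp

theorem exists_abs_coord_eq_norm (hd : 0 < d) (k : Fin d → ℤ) : ∃ i, |(k i : ℝ)| = ‖k‖ := by
  have : Nonempty (Fin d) := ⟨⟨0, hd⟩⟩
  obtain ⟨i, hi⟩ := Finite.exists_max fun i => ‖k i‖
  exact ⟨i, le_antisymm (abs_coord_le_norm k i) ((pi_norm_le_iff_of_nonneg (abs_nonneg _)).2 hi)⟩

/-- Fourier coefficients of a function with bounded `p`-th difference quotients. -/
theorem hasDecay_polyWeight (hd : 0 < d) (p : ℕ) (hu : Continuous u)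
    (hM : ∀ (b : ℕ), b ≤ p → ∀ i (s : ℝ) x,
      ‖(fwdDiff (torusProj (Pi.single i s)))^[b] u x‖ ≤ M * |s| ^ b) :
    HasDecay (polyWeight d) ((p : ℝ) - d) (mFourierCoeff u) := by
  set a := mFourierCoeff u with ha
  have h0 : Summable fun k => ‖a k‖ ^ 2 :=
    summable_of_sum_le (fun k => by positivity) fun F =>
      sum_sq_mFourierCoeff_le hu (fun x => by simpa using hM 0 (Nat.zero_le _) ⟨0, hd⟩ 0 x) F
  have h1 : ∀ i, Summable fun k : Fin d → ℤ =>
      ((2 * Real.pi * |(k i : ℝ)|) ^ p * ‖a k‖) ^ 2 := fun i =>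
    summable_of_sum_le (fun k => by positivity) fun F =>
      sum_sq_pow_mul_mFourierCoeff_le hu i p (hM p le_rfl i) F
  have h2 : Summable fun k : Fin d → ℤ => ((1 + ‖k‖) ^ p * ‖a k‖) ^ 2 := by
    refine Summable.of_nonneg_of_le (fun k => by positivity) (fun k => ?_)
      ((h0.add (summable_sum fun i (_ : i ∈ Finset.univ) => h1 i)).mul_left (((2 : ℝ) ^ p) ^ 2))
    obtain ⟨i, hi⟩ := exists_abs_coord_eq_norm hd k
    have h3 : ((2 * Real.pi * |(k i : ℝ)|) ^ p * ‖a k‖) ^ 2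
        ≤ ∑ i, ((2 * Real.pi * |(k i : ℝ)|) ^ p * ‖a k‖) ^ 2 :=
      Finset.single_le_sum (f := fun i => ((2 * Real.pi * |(k i : ℝ)|) ^ p * ‖a k‖) ^ 2)
        (fun i _ => by positivity) (Finset.mem_univ i)
    have h4 : (‖k‖ ^ p * ‖a k‖) ^ 2 ≤ ((2 * Real.pi * |(k i : ℝ)|) ^ p * ‖a k‖) ^ 2 := by
      rw [hi]
      gcongr
      nlinarith [norm_nonneg k, Real.pi_gt_three]
    -- The differences control `‖k‖ ^ p` only. To have `1 + ‖k‖`, the plain square-summability of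
    -- `a` is used for `‖k‖ ≤ 1`.
    have h5 : ((1 + ‖k‖) ^ p * ‖a k‖) ^ 2 ≤ (2 ^ p) ^ 2 * (‖a k‖ ^ 2 + (‖k‖ ^ p * ‖a k‖) ^ 2) := by
      rcases le_total ‖k‖ 1 with h | h
      · have : (1 + ‖k‖) ^ p ≤ 2 ^ p := by gcongr; linarith
        calc ((1 + ‖k‖) ^ p * ‖a k‖) ^ 2 ≤ (2 ^ p * ‖a k‖) ^ 2 := by gcongr
          _ ≤ _ := by rw [mul_pow]; gcongr; linarith [sq_nonneg (‖k‖ ^ p * ‖a k‖)]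
      · have : (1 + ‖k‖) ^ p ≤ 2 ^ p * ‖k‖ ^ p := by rw [← mul_pow]; gcongr; linarith
        calc ((1 + ‖k‖) ^ p * ‖a k‖) ^ 2 ≤ (2 ^ p * ‖k‖ ^ p * ‖a k‖) ^ 2 := by gcongr
          _ ≤ _ := by rw [mul_assoc, mul_pow]; gcongr; linarith [sq_nonneg ‖a k‖]
    refine h5.trans ?_
    gcongr
    exact h4.trans h3
  refine Summable.of_nonneg_of_le (fun k => ?_) (fun k => ?_)
    (h2.add (summable_inv_one_add_norm_pow d))
  · exact mul_nonneg (Real.rpow_nonneg (by simp only [polyWeight]; positivity) _) (norm_nonneg _)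
  · have hw : 0 < 1 + ‖k‖ := by positivity
    simp only [polyWeight]
    rw [Real.rpow_sub hw, Real.rpow_natCast, Real.rpow_natCast, pow_mul', ← inv_pow]
    -- The square-summable factor `(1 + ‖k‖) ^ (-d)` converts `ℓ²` into `ℓ¹`; this is the loss of
    -- `d` in the exponent.
    have h6 := two_mul_le_add_sq ((1 + ‖k‖) ^ p * ‖a k‖) (((1 + ‖k‖) ^ d)⁻¹)
    have h7 : 0 ≤ (1 + ‖k‖) ^ p * ‖a k‖ * ((1 + ‖k‖) ^ d)⁻¹ := by positivity
    calc (1 + ‖k‖) ^ p / (1 + ‖k‖) ^ d * ‖a k‖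
        = (1 + ‖k‖) ^ p * ‖a k‖ * ((1 + ‖k‖) ^ d)⁻¹ := by ring
      _ ≤ _ := by linarith

/-- Exponential decay of Fourier coefficients from Cauchy estimates on all differences. -/
theorem norm_mFourierCoeff_le_exp (hd : 0 < d) (hu : Continuous u) {δ : ℝ} (hδ : 0 < δ)
    (hM : ∀ (b : ℕ) i (s : ℝ) x,
      ‖(fwdDiff (torusProj (Pi.single i s)))^[b] u x‖ ≤ (b.factorial * M / δ ^ b) * |s| ^ b)
    (k : Fin d → ℤ) :
    ‖mFourierCoeff u k‖ ≤ 2 * M * Real.exp (-(Real.pi * δ * ‖k‖)) := by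
  obtain ⟨i, hi⟩ := exists_abs_coord_eq_norm hd k
  have hM0 : 0 ≤ M := (norm_nonneg _).trans (by simpa using hM 0 i 0 0)
  have h1 : ∀ b : ℕ, (2 * Real.pi * ‖k‖) ^ b * ‖mFourierCoeff u k‖ ≤ b.factorial * M / δ ^ b := by
    intro b
    have h := sum_sq_pow_mul_mFourierCoeff_le hu i b (hM b i) {k}
    rw [Finset.sum_singleton, hi] at h
    exact le_of_sq_le_sq h (by positivity)
  -- Using half of the rate `2 * π * δ` leaves a factor `2 ^ (-b)` in the `b`-th term, so the
  -- exponential series can be compared with a geometric one of sum `2 * M`.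
  have h2 : HasSum (fun b : ℕ => (Real.pi * δ * ‖k‖) ^ b / b.factorial * ‖mFourierCoeff u k‖)
      (Real.exp (Real.pi * δ * ‖k‖) * ‖mFourierCoeff u k‖) := by
    rw [Real.exp_eq_exp_ℝ]
    exact (NormedSpace.expSeries_div_hasSum_exp (Real.pi * δ * ‖k‖)).mul_right _
  have h3 : HasSum (fun b : ℕ => (1 / 2 : ℝ) ^ b * M) (2 * M) := hasSum_geometric_two.mul_right M
  have h4 := hasSum_le (fun b => ?_) h2 h3
  · rw [Real.exp_neg, ← div_eq_mul_inv, le_div_iff₀ (Real.exp_pos _)]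
    linarith
  · have h5 := h1 b
    have hb : (0 : ℝ) < b.factorial := by exact_mod_cast b.factorial_pos
    rw [le_div_iff₀ (by positivity)] at h5
    have h6 : (Real.pi * δ * ‖k‖) ^ b / b.factorial * ‖mFourierCoeff u k‖
        = (1 / 2) ^ b * (((2 * Real.pi * ‖k‖) ^ b * ‖mFourierCoeff u k‖ * δ ^ b) / b.factorial) := by
      have : (Real.pi * δ * ‖k‖) ^ b = (1 / 2) ^ b * ((2 * Real.pi * ‖k‖) ^ b * δ ^ b) := by
        rw [← mul_pow, ← mul_pow]; congr 1; ring
      rw [this]; ring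
    rw [h6]
    gcongr
    rw [div_le_iff₀ hb]
    linarith

/-- The gap `c₀ - c * T` leaves an exponential factor, which is smaller than a multiple of the
summable `(1 + ‖k‖) ^ (-2 d)`. -/
theorem hasDecay_expWeight {a : (Fin d → ℤ) → ℂ} {C c₀ c T : ℝ}
    (ha : ∀ k, ‖a k‖ ≤ C * Real.exp (-(c₀ * ‖k‖))) (hc : c * T < c₀) :
    HasDecay (expWeight d c) T a := by
  set e := c₀ - c * T with he
  have he0 : 0 < e := sub_pos.2 hc
  have hC : 0 ≤ C := by
    have := (norm_nonneg _).trans (ha 0)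
    simpa using this
  refine Summable.of_nonneg_of_le
    (fun k => mul_nonneg (Real.rpow_nonneg (Real.exp_pos _).le _) (norm_nonneg _)) (fun k => ?_)
    ((summable_inv_one_add_norm_pow d).mul_left
      (C * (Real.exp e * (2 * d).factorial / e ^ (2 * d))))
  have h1 := Real.pow_div_factorial_le_exp (e * (1 + ‖k‖)) (by positivity) (2 * d)
  have hf : (0 : ℝ) < (2 * d).factorial := by exact_mod_cast (2 * d).factorial_pos
  have h2 : Real.exp (-(e * ‖k‖))
      ≤ Real.exp e * (2 * d).factorial / e ^ (2 * d) * ((1 + ‖k‖) ^ (2 * d))⁻¹ := by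
    rw [mul_pow, div_le_iff₀ hf, mul_add, mul_one, Real.exp_add] at h1
    rw [Real.exp_neg, ← div_eq_mul_inv, inv_eq_one_div, div_div,
      div_le_div_iff₀ (Real.exp_pos _) (by positivity)]
    linarith
  calc expWeight d c k ^ T * ‖a k‖
      ≤ Real.exp (c * ‖k‖ * T) * (C * Real.exp (-(c₀ * ‖k‖))) := by
        rw [expWeight, ← Real.exp_mul]; gcongr; exact ha k
    _ = C * Real.exp (-(e * ‖k‖)) := by
        rw [mul_left_comm, ← Real.exp_add]; congr 2; rw [he]; ring
    _ ≤ C * (Real.exp e * (2 * d).factorial / e ^ (2 * d) * ((1 + ‖k‖) ^ (2 * d))⁻¹) := by gcongr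
    _ = _ := by ring

end Decay

/-! ### Taylor coefficients of curves in a function space. -/

section Taylor

variable {E : Type} [NormedAddCommGroup E] [NormedSpace ℝ E] {I : Set ℝ}

/-- A derivative is a limit of difference quotients, so it lies in the closed span of the values;
the subspace itself need not be closed. -/
theorem iteratedDerivWithin_mem_topologicalClosure {G : ℝ → E} (S : Submodule ℝ E)
    (hG : ∀ ε ∈ I, G ε ∈ S) (n : ℕ) : ∀ ε ∈ I, iteratedDerivWithin n G I ε ∈ S.topologicalClosure := by
  induction n with
  | zero =>
    intro ε hε
    rw [iteratedDerivWithin_zero]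
    exact S.le_topologicalClosure (hG ε hε)
  | succ n ih =>
    intro ε _
    rw [iteratedDerivWithin_succ]
    have h := range_derivWithin_subset_closure_span_image (iteratedDerivWithin n G I)
      (s := I) (t := I) (by rw [Set.inter_self]; exact subset_closure)
    have h2 : Submodule.span ℝ (iteratedDerivWithin n G I '' I) ≤ S.topologicalClosure :=
      Submodule.span_le.2 (Set.image_subset_iff.2 ih)
    exact closure_minimal h2 S.isClosed_topologicalClosure (h ⟨ε, rfl⟩)

/-- The Taylor coefficients of a `C^{N+1}` curve that takes its values in a subspace lie in the
closure of this subspace. -/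
theorem exists_hasTaylor {d N : ℕ} (hI : Convex ℝ I) (hI0 : (0 : ℝ) ∈ I) {G : ℝ → E}
    (hG : ContDiffOn ℝ (N + 1 : ℕ) G I) (S : Submodule ℝ E) (hS : ∀ ε ∈ I, G ε ∈ S)
    {u : ℝ → Torus d → (Fin d → ℝ)} (ev : Torus d → E →ₗ[ℝ] (Fin d → ℝ))
    (hev : ∀ x v, ‖ev x v‖ ≤ ‖v‖) (hu : ∀ ε ∈ I, ∀ x, u ε x = ev x (G ε)) (hu0 : ∀ x, u 0 x = 0) :
    ∃ c : ℕ → E, (∀ i, c i ∈ S.topologicalClosure) ∧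
      HasTaylor I u (fun i x => ev x (c i)) N := by
  set D : ℕ → E := fun k => ((k.factorial : ℝ)⁻¹) • iteratedDerivWithin k G I 0 with hD
  refine ⟨fun i => D (i + 1), fun i => Submodule.smul_mem _ _
    (iteratedDerivWithin_mem_topologicalClosure S hS _ _ hI0), ?_⟩
  have h1 := taylor_isLittleO hI hI0 hG
  obtain ⟨δ, hδ, h2⟩ : ∃ δ > 0, ∀ ε ∈ I, |ε| < δ →
      ‖G ε - taylorWithinEval G (N + 1) I 0 ε‖ ≤ 1 * |ε| ^ (N + 1) := by
    have := h1.bound one_pos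
    rw [Filter.Eventually, mem_nhdsWithin_iff_exists_mem_nhds_inter] at this
    obtain ⟨V, hV, h⟩ := this
    obtain ⟨δ, hδ, hb⟩ := Metric.mem_nhds_iff.1 hV
    refine ⟨δ, hδ, fun ε hε he => ?_⟩
    have := h ⟨hb (by simpa using he), hε⟩
    simpa [abs_pow] using this
  -- The curve is expanded to degree `N + 1`, and the last term is absorbed into the error of order
  -- `N + 1`.
  refine uniformO_iff.2 ⟨1 + ‖D (N + 1)‖, by positivity, δ, hδ, fun ε hε he x => ?_⟩
  have h3 : taylorWithinEval G (N + 1) I 0 ε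
      = G 0 + ∑ i ∈ Finset.range N, ε ^ (i + 1) • D (i + 1) + ε ^ (N + 1) • D (N + 1) := by
    rw [taylor_within_apply, Finset.sum_range_succ, Finset.sum_range_succ']
    simp only [hD, sub_zero, smul_smul, mul_comm]
    simp [add_comm]
  have h4 : u ε x - nearIdentity (fun i x => ev x (D (i + 1))) N ε x
      = ev x (G ε - taylorWithinEval G (N + 1) I 0 ε) + ev x (ε ^ (N + 1) • D (N + 1)) := by
    rw [h3, nearIdentity, hu ε hε]
    have : ev x (G 0) = 0 := by rw [← hu 0 hI0, hu0]
    simp only [map_sub, map_add, map_sum, map_smul, this]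
    abel
  rw [h4]
  refine (norm_add_le _ _).trans ?_
  rw [add_mul]
  refine add_le_add ((hev _ _).trans (h2 ε hε he)) ((hev _ _).trans ?_)
  rw [norm_smul, norm_pow, Real.norm_eq_abs, mul_comm]

end Taylor

/-! ### Families of class `C^p`. -/

section Jets

variable {d p : ℕ}

/-- On a line in the direction `i`, the terms of the Taylor series evaluated at copies of the unit
vector form a chain of derivatives bounded by `M`. -/
theorem norm_fwdDiff_iter_le_of_hasFTaylorSeriesUpTo {e : ℕ} {f : Torus d → (Fin e → ℝ)} {M : ℝ}
    {P : (Fin d → ℝ) → FormalMultilinearSeries ℝ (Fin d → ℝ) (Fin e → ℝ)}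
    (h : HasFTaylorSeriesUpTo p (periodicLift f) P) (hM : ∀ k ≤ p, ∀ x, ‖P x k‖ ≤ M)
    (c : Fin e) (b : ℕ) (hb : b ≤ p) (i : Fin d) (s : ℝ) (x : Torus d) :
    ‖(fwdDiff (torusProj (Pi.single i s)))^[b] (fun x => ((f x c : ℝ) : ℂ)) x‖ ≤ M * |s| ^ b := by
  refine norm_fwdDiff_iter_torus_le (fun v => ?_) s x
  set w : Fin d → ℝ := Pi.single i 1
  refine ⟨fun j t => ((P (v + t • w) j (fun _ => w) c : ℝ) : ℂ), fun t => ?_, fun j hj t => ?_,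
    fun t => ?_⟩
  · have := h.zero_eq (v + t • w)
    rw [ContinuousMultilinearMap.curry0] at this
    simp only [periodicLift] at this
    rw [← this]
    change ((P (v + t • w) 0 (fun _ => w) c : ℝ) : ℂ) = ((P (v + t • w) 0 0 c : ℝ) : ℂ)
    rw [Subsingleton.elim (fun _ : Fin 0 => w) 0]
  · have h1 := h.fderiv j (by exact_mod_cast hj.trans_le hb) (v + t • w)
    have h2 : HasDerivAt (fun t : ℝ => v + t • w) w t := by
      simpa using ((hasDerivAt_id t).smul_const w).const_add v
    have h3 := h1.comp_hasDerivAt t h2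
    have h4 := (ContinuousMultilinearMap.apply ℝ (fun _ : Fin j => Fin d → ℝ) (Fin e → ℝ)
      (fun _ => w)).hasFDerivAt.comp_hasDerivAt t h3
    have h5 := (hasDerivAt_pi.1 h4 c).ofReal_comp
    convert! h5 using 1
    have h6 : (fun _ : Fin (j + 1) => w) = Fin.cons w (fun _ => w) := by
      funext l; refine Fin.cases rfl (fun _ => rfl) l
    change ((P (v + t • w) (j + 1) (fun _ => w) c : ℝ) : ℂ)
      = ((P (v + t • w) (j + 1) (Fin.cons w fun _ => w) c : ℝ) : ℂ)
    rw [h6]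
  · rw [Complex.norm_real]
    refine (norm_le_pi_norm _ c).trans (((P (v + t • w) b).le_opNorm _).trans ?_)
    have hw : ‖w‖ = 1 := by simp [w, Pi.norm_single]
    simpa [hw] using hM b hb (v + t • w)

/-- Families of bounded continuous functions that may serve as derivatives of order at most `p`. -/
abbrev JetSpace (d p : ℕ) : Type :=
  (k : Fin (p + 1)) → ((Fin d → ℝ) →ᵇ ((Fin d → ℝ) [×k]→L[ℝ] (Fin d → ℝ)))

/-- The derivatives of order at most `p` of the `C^p` functions on the torus. -/
def jets (d p : ℕ) : Submodule ℝ (JetSpace d p) where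
  carrier := {v | ∃ w : Torus d → (Fin d → ℝ), TorusContDiff p w ∧
    ∀ k x, v k x = iteratedFDeriv ℝ k (periodicLift w) x}
  zero_mem' := ⟨fun _ => 0, contDiff_const, fun k x => by
    have : periodicLift (fun _ : Torus d => (0 : Fin d → ℝ)) = fun _ => 0 := rfl
    rw [this, iteratedFDeriv_fun_zero]; rfl⟩
  add_mem' := by
    rintro v v' ⟨w, hw, h⟩ ⟨w', hw', h'⟩
    refine ⟨w + w', hw.add hw', fun k x => ?_⟩
    have hk : ((k : ℕ) : WithTop ℕ∞) ≤ p := by exact_mod_cast Nat.lt_succ_iff.1 k.2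
    have : periodicLift (w + w') = periodicLift w + periodicLift w' := rfl
    rw [this, iteratedFDeriv_add_apply (hw.of_le hk).contDiffAt (hw'.of_le hk).contDiffAt, ← h, ← h']
    rfl
  smul_mem' := by
    rintro c v ⟨w, hw, h⟩
    refine ⟨c • w, hw.const_smul c, fun k x => ?_⟩
    have hk : ((k : ℕ) : WithTop ℕ∞) ≤ p := by exact_mod_cast Nat.lt_succ_iff.1 k.2
    have : periodicLift (c • w) = c • periodicLift w := rfl
    rw [this, iteratedFDeriv_const_smul_apply (hw.of_le hk).contDiffAt, ← h]
    rfl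

/-- Evaluation of the function underlying a jet. -/
noncomputable def jetEval (x : Torus d) : JetSpace d p →ₗ[ℝ] (Fin d → ℝ) where
  toFun v := v 0 (torusSection x) 0
  map_add' _ _ := rfl
  map_smul' _ _ := rfl

theorem norm_jetEval_le (x : Torus d) (v : JetSpace d p) : ‖jetEval x v‖ ≤ ‖v‖ := by
  have h : ‖jetEval x v‖ ≤ ‖v 0 (torusSection x)‖ * ∏ _i : Fin 0, ‖(0 : Fin d → ℝ)‖ :=
    (v 0 (torusSection x)).le_opNorm 0
  rw [Finset.univ_eq_empty, Finset.prod_empty, mul_one] at h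
  exact h.trans (((v 0).norm_coe_le_norm (torusSection x)).trans (norm_le_pi_norm v 0))

/-- The formal Taylor series of a jet. -/
noncomputable def jetSeries (v : JetSpace d p) (x : Fin d → ℝ) :
    FormalMultilinearSeries ℝ (Fin d → ℝ) (Fin d → ℝ) :=
  fun k => if h : k < p + 1 then v ⟨k, h⟩ x else 0

theorem jetSeries_apply (v : JetSpace d p) (x : Fin d → ℝ) {k : ℕ} (h : k < p + 1) :
    jetSeries v x k = v ⟨k, h⟩ x := dif_pos h

theorem norm_jetSeries_le (v : JetSpace d p) (x : Fin d → ℝ) {k : ℕ} (h : k ≤ p) :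
    ‖jetSeries v x k‖ ≤ ‖v‖ := by
  rw [jetSeries_apply v x (Nat.lt_succ_of_le h)]
  exact ((v _).norm_coe_le_norm x).trans (norm_le_pi_norm v _)

/-- Convergence of jets is uniform convergence of every derivative up to order `p`, and uniform
convergence of derivatives allows the limit to be differentiated. -/
theorem hasFTaylorSeriesUpTo_of_mem_closure {v : JetSpace d p}
    (hv : v ∈ (jets d p).topologicalClosure) :
    HasFTaylorSeriesUpTo p (periodicLift fun x => jetEval x v) (jetSeries v) := by
  obtain ⟨V, hV, hlim⟩ := mem_closure_iff_seq_limit.1 hv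
  choose w hw hVw using hV
  have hunif : ∀ k, TendstoUniformly (fun n => ⇑(V n k)) (v k) atTop := fun k =>
    tendsto_iff_tendstoUniformly.1 (tendsto_pi_nhds.1 hlim k)
  constructor
  · intro x
    have h1 : ∀ y, Tendsto (fun n => V n 0 y 0) atTop (𝓝 (v 0 y 0)) := fun y =>
      ((ContinuousMultilinearMap.apply ℝ (fun _ : Fin 0 => Fin d → ℝ) (Fin d → ℝ) 0).continuous.tendsto
        _).comp ((hunif 0).tendsto_at y)
    have h2 : ∀ n y, V n 0 y 0 = w n (torusProj y) := fun n y => by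
      rw [hVw]; exact iteratedFDeriv_zero_apply _
    -- The values at `x` and at the chosen representative of its class are limits of the same
    -- sequence.
    have h3 := h1 (torusSection (torusProj x))
    simp only [h2, torusProj_section] at h3
    have h4 := h1 x
    simp only [h2] at h4
    exact tendsto_nhds_unique h4 h3
  · intro m hm x
    have hm : m < p := by exact_mod_cast hm
    have e1 : (fun y => jetSeries v y m) = v ⟨m, by omega⟩ :=
      funext fun y => jetSeries_apply v y (by omega)
    rw [e1, jetSeries_apply v x (by omega : m + 1 < p + 1)]
    refine hasFDerivAt_of_tendstoUniformly (l := atTop) (f := fun n => ⇑(V n ⟨m, by omega⟩))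
      (f' := fun n y => (V n ⟨m + 1, by omega⟩ y).curryLeft)
      (g' := fun y => (v ⟨m + 1, by omega⟩ y).curryLeft) ?_ ?_ ?_ x
    · exact (continuousMultilinearCurryLeftEquiv ℝ (fun _ : Fin (m + 1) => Fin d → ℝ)
        (Fin d → ℝ)).isometry.uniformContinuous.comp_tendstoUniformly (hunif ⟨m + 1, by omega⟩)
    · intro n y
      have h1 := (contDiff_iff_ftaylorSeries.1 (hw n)).fderiv m (by exact_mod_cast hm) y
      have e2 : ⇑(V n ⟨m, by omega⟩) = fun y => ftaylorSeries ℝ (periodicLift (w n)) y m :=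
        funext fun y => hVw n _ y
      have e3 : V n ⟨m + 1, by omega⟩ y = ftaylorSeries ℝ (periodicLift (w n)) y (m + 1) := hVw n _ y
      rw [e2, e3]
      exact h1
    · exact fun y => (hunif _).tendsto_at y
  · intro m hm
    have hm : m ≤ p := by exact_mod_cast hm
    have e1 : (fun y => jetSeries v y m) = v ⟨m, by omega⟩ :=
      funext fun y => jetSeries_apply v y (by omega)
    rw [e1]
    exact (v _).continuous

theorem torusContDiff_jetEval {v : JetSpace d p} (hv : v ∈ (jets d p).topologicalClosure) :
    TorusContDiff p fun x => jetEval x v :=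
  (hasFTaylorSeriesUpTo_of_mem_closure hv).contDiff

/-- The entry of `C^p` into the Wiener scale, where the dimension is lost once and for all. -/
theorem vectorClass_polyWeight_jetEval (hd : 0 < d) (hp : d ≤ p) {v : JetSpace d p}
    (hv : v ∈ (jets d p).topologicalClosure) :
    VectorClass (polyWeight d) ((p : ℝ) - d) fun x => jetEval x v := by
  intro c
  have hs := hasFTaylorSeriesUpTo_of_mem_closure hv
  have hu : Continuous fun x : Torus d => ((jetEval x v c : ℝ) : ℂ) :=
    Complex.continuous_ofReal.comp ((continuous_apply c).comp (torusContDiff_jetEval hv).continuous)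
  have h := hasDecay_polyWeight hd p hu fun b hb i s x =>
    norm_fwdDiff_iter_le_of_hasFTaylorSeriesUpTo hs (fun k hk x => norm_jetSeries_le v x hk) c b hb
      i s x
  have hp' : (0 : ℝ) ≤ (p : ℝ) - d := sub_nonneg.2 (by exact_mod_cast hp)
  exact ⟨_, h, fourierSum_mFourierCoeff hu (h.summable_norm isWeight_polyWeight hp')⟩

/-- Taylor expansion of a `C^{N+1}` curve in `C^p(𝕋^d, ℝ^d)`. -/
theorem _root_.IsCkFamily.exists_hasTaylor {N : ℕ} {I : Set ℝ} (hI : Convex ℝ I) (hI0 : (0 : ℝ) ∈ I)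
    {u : ℝ → Torus d → (Fin d → ℝ)} (hu : IsCkFamily (N + 1) p I u) (hu0 : ∀ x, u 0 x = 0) :
    ∃ v : ℕ → JetSpace d p, (∀ i, v i ∈ (jets d p).topologicalClosure) ∧
      HasTaylor I u (fun i x => jetEval x (v i)) N := by
  obtain ⟨hu1, hu2⟩ := hu
  choose G hG hGc using hu2
  let J : ℝ → JetSpace d p := fun ε k => G k (Nat.lt_succ_iff.1 k.2) ε
  have h1 : ContDiffOn ℝ (N + 1 : ℕ) J I := contDiffOn_pi.2 fun k => hGc k _
  have h2 : ∀ ε ∈ I, J ε ∈ jets d p := fun ε hε => ⟨u ε, hu1 ε hε, fun k x => hG k _ ε hε x⟩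
  have h3 : ∀ ε ∈ I, ∀ x, u ε x = jetEval x (J ε) := by
    intro ε hε x
    have h := congrArg (fun L => L 0) (hG 0 (Nat.zero_le _) ε hε (torusSection x))
    simp only [iteratedFDeriv_zero_apply, periodicLift, torusProj_section] at h
    exact h.symm
  obtain ⟨c, hc1, hc2⟩ := ResonantAveraging.exists_hasTaylor hI hI0 h1 (jets d p) h2 jetEval
    norm_jetEval_le h3 hu0
  exact ⟨c, hc1, hc2⟩

end Jets

/-! ### Families holomorphic in a complex strip. -/

section Strip

variable {d : ℕ} {ρ : ℝ}

/-- Points of `ℝ^d` as points of the complex strip. -/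
def stripPoint (hρ : 0 < ρ) (x : Fin d → ℝ) : complexStrip d ρ :=
  ⟨fun i => (x i : ℂ), fun i => by simpa using hρ⟩

/-- Bounded continuous functions on the complex strip. -/
abbrev StripSpace (d : ℕ) (ρ : ℝ) : Type := complexStrip d ρ →ᵇ (Fin d → ℂ)

/-- The bounded holomorphic functions on the strip that restrict to real functions on the torus. -/
def stripFunctions (d : ℕ) (ρ : ℝ) : Submodule ℝ (StripSpace d ρ) where
  carrier := {v | ∃ (w : Torus d → (Fin d → ℝ)) (g : (Fin d → ℂ) → (Fin d → ℂ)),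
    AnalyticOnNhd ℂ g (complexStrip d ρ) ∧ (∀ z : complexStrip d ρ, v z = g z) ∧
    ∀ x : Fin d → ℝ, g (fun i => (x i : ℂ)) = fun i => ((w (torusProj x) i : ℝ) : ℂ)}
  zero_mem' := ⟨0, 0, analyticOnNhd_const, fun _ => rfl, fun x => by funext i; simp⟩
  add_mem' := by
    rintro v v' ⟨w, g, hg, h, hw⟩ ⟨w', g', hg', h', hw'⟩
    refine ⟨w + w', g + g', hg.add hg', fun z => ?_, fun x => ?_⟩
    · rw [BoundedContinuousFunction.add_apply, h, h', Pi.add_apply]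
    · rw [Pi.add_apply, hw, hw']
      funext i; simp
  smul_mem' := by
    rintro c v ⟨w, g, hg, h, hw⟩
    refine ⟨c • w, (c : ℂ) • g, hg.const_smul, fun z => ?_, fun x => ?_⟩
    · rw [BoundedContinuousFunction.smul_apply, h, Pi.smul_apply, Complex.coe_smul]
    · rw [Pi.smul_apply, hw]
      funext i; simp

/-- Evaluation at a point of the torus. -/
noncomputable def stripEval (hρ : 0 < ρ) (x : Torus d) : StripSpace d ρ →ₗ[ℝ] (Fin d → ℝ) where
  toFun v := fun c => (v (stripPoint hρ (torusSection x)) c).re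
  map_add' _ _ := by funext c; simp
  map_smul' _ _ := by funext c; simp

theorem norm_stripEval_le (hρ : 0 < ρ) (x : Torus d) (v : StripSpace d ρ) :
    ‖stripEval hρ x v‖ ≤ ‖v‖ :=
  (pi_norm_le_iff_of_nonneg (norm_nonneg _)).2 fun c => (Complex.abs_re_le_norm _).trans
    ((norm_le_pi_norm _ c).trans (v.norm_coe_le_norm _))

theorem continuous_stripEval (hρ : 0 < ρ) (x : Torus d) : Continuous (stripEval hρ x) :=
  AddMonoidHomClass.continuous_of_bound (stripEval hρ x) 1 fun v => by
    simpa using norm_stripEval_le hρ x v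

theorem stripEval_eq (hρ : 0 < ρ) {v : StripSpace d ρ} {w : Torus d → (Fin d → ℝ)}
    (h : ∀ x : Fin d → ℝ, v (stripPoint hρ x) = fun i => ((w (torusProj x) i : ℝ) : ℂ)) (x : Torus d) :
    stripEval hρ x v = w x := by
  funext c
  change (v (stripPoint hρ (torusSection x)) c).re = w x c
  rw [h, torusProj_section, Complex.ofReal_re]

/-- Along a complexified coordinate line the function is holomorphic for `|Im z| < ρ`, so Cauchy's
estimate applies on discs of radius `ρ / 2` about real points. -/
theorem norm_fwdDiff_iter_stripEval_le (hρ : 0 < ρ) {v : StripSpace d ρ} (hv : v ∈ stripFunctions d ρ)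
    (c : Fin d) (b : ℕ) (i : Fin d) (s : ℝ) (x : Torus d) :
    ‖(fwdDiff (torusProj (Pi.single i s)))^[b] (fun x => ((stripEval hρ x v c : ℝ) : ℂ)) x‖
      ≤ (b.factorial * ‖v‖ / (ρ / 2) ^ b) * |s| ^ b := by
  obtain ⟨w, g, hg, hvg, hw⟩ := hv
  have hev := stripEval_eq hρ (v := v) (w := w) fun x => (hvg _).trans (hw x)
  simp only [hev]
  refine norm_fwdDiff_iter_torus_le (fun y => ?_) s x
  set e : Fin d → ℂ := Pi.single i 1 with he
  set a : Fin d → ℂ := fun j => (y j : ℂ) with ha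
  set Φ : ℂ → ℂ := fun z => g (a + z • e) c with hΦ
  have hmem : ∀ z : ℂ, |z.im| < ρ → a + z • e ∈ complexStrip d ρ := by
    intro z hz j
    by_cases hj : j = i
    · subst hj; simpa [ha, he] using hz
    · simpa [ha, he, Pi.single_eq_of_ne hj] using hρ
  have hΦa : ∀ z : ℂ, |z.im| < ρ → AnalyticAt ℂ Φ z := by
    intro z hz
    have h1 : AnalyticAt ℂ (fun z : ℂ => a + z • e) z :=
      analyticAt_const.add (analyticAt_id.smul analyticAt_const)
    exact analyticAt_pi_iff.1 (AnalyticAt.fun_comp (f := fun z : ℂ => a + z • e) (hg _ (hmem z hz)) h1) c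
  refine ⟨fun j t => iteratedDeriv j Φ t, fun t => ?_, fun j _ t => ?_, fun t => ?_⟩
  · have h1 : a + (t : ℂ) • e = fun j => (((y + t • (Pi.single i 1 : Fin d → ℝ)) j : ℝ) : ℂ) := by
      funext j
      by_cases hj : j = i
      · subst hj; simp [ha, he]
      · simp [ha, he, Pi.single_eq_of_ne hj]
    simp only [iteratedDeriv_zero, hΦ]
    rw [h1, hw]
  · have h1 := ((hΦa t (by simpa using hρ)).iterated_deriv j).differentiableAt.hasDerivAt
    rw [← iteratedDeriv_eq_iterate, ← iteratedDeriv_succ] at h1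
    exact h1.comp_ofReal
  · have him : ∀ z ∈ Metric.closedBall (t : ℂ) (ρ / 2), |z.im| < ρ := by
      intro z hz
      rw [Metric.mem_closedBall, dist_eq_norm] at hz
      have h1 := (Complex.abs_im_le_norm (z - t)).trans hz
      rw [Complex.sub_im, Complex.ofReal_im, sub_zero] at h1
      linarith
    refine Complex.norm_iteratedDeriv_le_of_forall_mem_sphere_norm_le b (half_pos hρ) ?_ fun z hz => ?_
    · refine DifferentiableOn.diffContOnCl fun z hz => ?_
      rw [closure_ball _ (half_pos hρ).ne'] at hz
      exact (hΦa z (him z hz)).differentiableAt.differentiableWithinAt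
    · have h1 := hmem z (him z (Metric.sphere_subset_closedBall hz))
      refine (norm_le_pi_norm (g (a + z • e)) c).trans ?_
      rw [← hvg ⟨_, h1⟩]
      exact v.norm_coe_le_norm _

theorem continuous_stripEval_left (hρ : 0 < ρ) {v : StripSpace d ρ} (hv : v ∈ stripFunctions d ρ) :
    Continuous fun x : Torus d => stripEval hρ x v := by
  obtain ⟨w, g, hg, hvg, hw⟩ := hv
  have h : ∀ x : Fin d → ℝ, v (stripPoint hρ x) = fun i => ((w (torusProj x) i : ℝ) : ℂ) :=
    fun x => (hvg _).trans (hw x)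
  simp only [stripEval_eq hρ h]
  refine continuous_iff_periodicLift.2 (continuous_pi fun c => ?_)
  have h1 : ∀ x, periodicLift w x c = (v (stripPoint hρ x) c).re := fun x => by
    rw [h, Complex.ofReal_re]; rfl
  simp only [h1]
  have h2 : Continuous (stripPoint (d := d) hρ) := Continuous.subtype_mk (by fun_prop) _
  exact Complex.continuous_re.comp ((continuous_apply c).comp (v.continuous.comp h2))

/-- The difference bounds survive uniform limits, so elements of the closure are covered without
showing that the limit is holomorphic. -/
theorem vectorClass_expWeight_stripEval (hd : 0 < d) (hρ : 0 < ρ) {v : StripSpace d ρ}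
    (hv : v ∈ (stripFunctions d ρ).topologicalClosure) {c T : ℝ} (hc : 0 < c) (hT : 0 ≤ T)
    (hcT : c * T < Real.pi * (ρ / 2)) :
    VectorClass (expWeight d c) T fun x => stripEval hρ x v := by
  obtain ⟨V, hV, hlim⟩ := mem_closure_iff_seq_limit.1 hv
  intro l
  have hu : Continuous fun x : Torus d => ((stripEval hρ x v l : ℝ) : ℂ) := by
    have h1 : TendstoUniformly (fun n (x : Torus d) => stripEval hρ x (V n))
        (fun x => stripEval hρ x v) atTop := by
      rw [Metric.tendstoUniformly_iff]
      intro ε hε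
      filter_upwards [Metric.tendsto_nhds.1 hlim ε hε] with n hn x
      rw [dist_eq_norm] at hn
      rw [dist_comm, dist_eq_norm, ← map_sub]
      exact (norm_stripEval_le hρ x _).trans_lt hn
    exact Complex.continuous_ofReal.comp ((continuous_apply l).comp
      (h1.continuous (Frequently.of_forall fun n => continuous_stripEval_left hρ (hV n))))
  have hM : ∀ (b : ℕ) i (s : ℝ) x, ‖(fwdDiff (torusProj (Pi.single i s)))^[b]
      (fun x => ((stripEval hρ x v l : ℝ) : ℂ)) x‖
        ≤ (b.factorial * ‖v‖ / (ρ / 2) ^ b) * |s| ^ b := by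
    intro b i s x
    have h1 : ∀ x, Tendsto (fun n => ((stripEval hρ x (V n) l : ℝ) : ℂ)) atTop
        (𝓝 ((stripEval hρ x v l : ℝ) : ℂ)) := fun x =>
      ((Complex.continuous_ofReal.comp ((continuous_apply l).comp
        (continuous_stripEval hρ x))).tendsto v).comp hlim
    refine le_of_tendsto_of_tendsto' (b := atTop)
      (f := fun n => ‖(fwdDiff (torusProj (Pi.single i s)))^[b]
        (fun x => ((stripEval hρ x (V n) l : ℝ) : ℂ)) x‖)
      (g := fun n => (b.factorial * ‖V n‖ / (ρ / 2) ^ b) * |s| ^ b) ?_ ?_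
      fun n => norm_fwdDiff_iter_stripEval_le hρ (hV n) l b i s x
    · simp only [fwdDiff_iter_eq_sum_shift]
      exact (tendsto_finsetSum _ fun j _ => (h1 _).const_smul _).norm
    · exact ((hlim.norm.const_mul _).div_const _).mul_const _
  have h := hasDecay_expWeight (norm_mFourierCoeff_le_exp hd hu (half_pos hρ) hM) hcT
  exact ⟨_, h, fourierSum_mFourierCoeff hu (h.summable_norm (isWeight_expWeight hc) hT)⟩

/-- Taylor expansion of an analytic family, with coefficients and values in a common weighted
Wiener class of prescribed exponent. -/
theorem _root_.IsAnalyticFamily.exists_hasTaylor (hd : 0 < d) {N : ℕ} {I : Set ℝ} (hI : Convex ℝ I)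
    (hI0 : (0 : ℝ) ∈ I) {u : ℝ → Torus d → (Fin d → ℝ)} (hu : IsAnalyticFamily (N + 1) I u)
    (hu0 : ∀ x, u 0 x = 0) {T : ℝ} (hT : 0 < T) :
    ∃ c > 0, (∀ ε ∈ I, VectorClass (expWeight d c) T (u ε)) ∧
      ∃ F : ℕ → Torus d → (Fin d → ℝ), (∀ i, VectorClass (expWeight d c) T (F i)) ∧
        HasTaylor I u F N := by
  obtain ⟨ρ, hρ, G, hG, hGc⟩ := hu
  have hS : ∀ ε ∈ I, G ε ∈ stripFunctions d ρ := fun ε hε => by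
    obtain ⟨g, h1, h2, h3⟩ := hG ε hε
    exact ⟨u ε, g, h1, h2, h3⟩
  have hev : ∀ ε ∈ I, ∀ x, u ε x = stripEval hρ x (G ε) := fun ε hε x => by
    obtain ⟨g, h1, h2, h3⟩ := hG ε hε
    exact (stripEval_eq hρ (fun x => (h2 _).trans (h3 x)) x).symm
  obtain ⟨v, hv, hT'⟩ := ResonantAveraging.exists_hasTaylor hI hI0 hGc (stripFunctions d ρ) hS
    (stripEval hρ) (norm_stripEval_le hρ) hev hu0
  have hpos : 0 < Real.pi * (ρ / 2) := by positivity
  -- With this choice `c * T` is half of the available decay rate.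
  set c := Real.pi * (ρ / 2) / (2 * T)
  have hc : 0 < c := by positivity
  have hcT : c * T < Real.pi * (ρ / 2) := by
    have : c * T = Real.pi * (ρ / 2) / 2 := by simp only [c]; field_simp
    rw [this]; linarith
  refine ⟨c, hc, fun ε hε => ?_, _,
    fun i => vectorClass_expWeight_stripEval hd hρ (hv i) hc hT.le hcT, hT'⟩
  rw [funext (hev ε hε)]
  exact vectorClass_expWeight_stripEval hd hρ
    ((stripFunctions d ρ).le_topologicalClosure (hS ε hε)) hc hT.le hcT

end Strip

/-! ### The two regularity cases and the case without frequencies. -/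

section Assembly

variable {r s n m : ℕ} {I : Set ℝ} {f : ℝ → Torus (r + s) → (Fin (r + s) → ℝ)}
  {Ω₀ : Fin (r + s) → ℝ} {ω : Fin r → ℝ} {A : Matrix.SpecialLinearGroup (Fin (r + s)) ℤ}
  {L : Fin (r + s) → ℤ} {κ : WithTop ℕ∞}

/-- Normal form from small divisors in a scale of Wiener classes. -/
theorem averagesToNormalForm_of_hasTaylor [(𝓝[I \ {0}] (0 : ℝ)).NeBot] (hκ : 1 ≤ κ) (hn : 1 ≤ n)
    (hm : 1 ≤ m) (hω : IsIntrinsicFrequency Ω₀ ω A L) (hf : ∀ ε ∈ I, TorusContDiff κ fun x => ε • f ε x)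
    {W : (Fin (r + s) → ℤ) → ℝ} (hW : IsWeight W) {τ : ℝ} (hτ : 0 ≤ τ) {N : ℕ} (hN : n + m = N + 1)
    {T : ℝ} (hT : 1 ≤ T - N * τ - (N - 1 : ℝ)) (hdiv : SmallDivisorBound A W τ Ω₀)
    {F : ℕ → Torus (r + s) → (Fin (r + s) → ℝ)} (hu : HasTaylor I (fun ε x => ε • f ε x) F N)
    (hF : ∀ i, VectorClass W T (F i))
    (hclass : ∀ g : Torus (r + s) → (Fin (r + s) → ℝ),
      VectorClass W (T - N * τ - (N - 1 : ℝ)) g → TorusContDiff κ g) :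
    AveragesToNormalForm κ I f Ω₀ ω A n m := by
  obtain ⟨h, p, R, H⟩ := exists_averaging_steps hW hτ hT hdiv hu hF N le_rfl
  have hN' : n + m - 1 = N := by omega
  have hle : ∀ j < N, T - N * τ - (N - 1 : ℝ) ≤ T - j * (τ + 1) - τ := by
    intro j hj
    have : (j : ℝ) + 1 ≤ N := by exact_mod_cast hj
    nlinarith
  have hh : ∀ j < N, VectorClass W (T - N * τ - (N - 1 : ℝ)) (h j) := fun j hj =>
    (H j hj).class_h.mono hW (hle j hj)
  have hp : ∀ j < N, VectorClass W (T - N * τ - (N - 1 : ℝ)) (p (j + 1)) := fun j hj =>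
    (H j hj).class_p.mono hW ((hle j hj).trans (by linarith))
  have hR : ∀ j, 1 ≤ j → j ≤ N → TorusContDiff κ (R j) := by
    intro j h1 h2
    obtain ⟨i, rfl⟩ : ∃ i, j = i + 1 := ⟨j - 1, by omega⟩
    exact torusContDiff_of_pullback A (hclass _
      ((H i (by omega)).class_R.mono hW ((hle i (by omega)).trans (by linarith))))
  have hlip : ∀ j < N, IsTorusLipschitz (h j) := fun j hj => (hh j hj).isTorusLipschitz hW hT
  refine ⟨h, p, R, ?_, ?_, ?_, fun hR0 => ?_⟩
  · rw [hN']
    exact isAveraging_of_steps hlip (fun j hj => (hp j hj).exists_bound hW (zero_le_one.trans hT))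
      (fun j hj => (H j hj).coefficient) (fun j hj => (H j hj).average)
      (fun j hj => (H j hj).cohomology) (fun j hj => (H j hj).normalization)
  · rw [hN']
    exact fun j hj => hclass _ (hh j hj)
  · rw [hN']
    intro j h1 h2
    obtain ⟨i, rfl⟩ : ∃ i, j = i + 1 := ⟨j - 1, by omega⟩
    exact ⟨hclass _ (hp i (by omega)), hR _ h1 h2⟩
  · refine hasResonantNormalForm hκ hn hω hf ?_ ?_ ?_ ?_ hR0
    · rw [hN']
      exact fun j hj => hclass _ (hh j hj)
    · rwa [hN']
    · rwa [hN']
    · have h1 := (H (N - 1) (by omega)).defect_next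
      rwa [show N - 1 + 1 = n + m - 1 by omega, show N - 1 + 2 = n + m by omega] at h1

/-- The omitted terms have bounded coefficients and order at least `M + 1`. -/
theorem HasTaylor.mono {d : ℕ} {u : ℝ → Torus d → (Fin d → ℝ)} {F : ℕ → Torus d → (Fin d → ℝ)}
    (hF : ∀ i, ∃ C, ∀ x, ‖F i x‖ ≤ C) {M N : ℕ} (hMN : M ≤ N) (hu : HasTaylor I u F N) :
    HasTaylor I u F M := by
  induction hMN with
  | refl => exact hu
  | @step N _ ih =>
    refine ih ?_
    obtain ⟨C, hC⟩ := hF N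
    refine ((UniformO.mono hu (Nat.le_succ (N + 1))).add ((uniformO_const hC).pow_smul (N + 1))).congr
      fun ε x => ?_
    rw [nearIdentity, nearIdentity, Finset.sum_range_succ]
    abel

theorem integral_torus_zero {E : Type*} [NormedAddCommGroup E] [NormedSpace ℝ E] [CompleteSpace E]
    (g : Torus 0 → E) : ∫ y, g y ∂torusHaar 0 = g 0 := by
  have : g = fun _ => g 0 := funext fun y => by rw [Subsingleton.elim y 0]
  rw [this, integral_const, probReal_univ, one_smul]

/-- When no frequency is left, every term is resonant and nothing has to be averaged out. -/
theorem averagesToNormalForm_of_no_frequency {s : ℕ} {f : ℝ → Torus (0 + s) → (Fin (0 + s) → ℝ)}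
    {Ω₀ : Fin (0 + s) → ℝ} {ω : Fin 0 → ℝ} {A : Matrix.SpecialLinearGroup (Fin (0 + s)) ℤ}
    {L : Fin (0 + s) → ℤ} (hκ : 1 ≤ κ) (hn : 1 ≤ n) (hω : IsIntrinsicFrequency Ω₀ ω A L)
    (hf : ∀ ε ∈ I, TorusContDiff κ fun x => ε • f ε x) {N : ℕ} (hN : n + m = N + 1)
    {F : ℕ → Torus (0 + s) → (Fin (0 + s) → ℝ)} (hu : HasTaylor I (fun ε x => ε • f ε x) F N)
    (hF : ∀ i, TorusContDiff κ (F i)) :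
    AveragesToNormalForm κ I f Ω₀ ω A n m := by
  have hN' : n + m - 1 = N := by omega
  have hbound : ∀ i, ∃ C, ∀ x, ‖F i x‖ ≤ C := fun i =>
    let ⟨C, hC⟩ := isCompact_univ.exists_bound_of_continuousOn (hF i).continuous.continuousOn
    ⟨C, fun x => hC x (Set.mem_univ x)⟩
  set R : ℕ → Torus s → (Fin (0 + s) → ℝ) := fun j z =>
    F (j - 1) (torusMatrix (A⁻¹).1 (Fin.append 0 z)) with hRdef
  have hRF : ∀ j x, R j (sndBlock (torusMatrix A.1 x)) = F (j - 1) x := by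
    intro j x
    have h1 := append_blocks (torusMatrix A.1 x)
    rw [Subsingleton.elim (fstBlock (torusMatrix A.1 x)) 0] at h1
    rw [hRdef]
    dsimp only
    rw [h1, torusMatrix_inv_apply]
  have hRc : ∀ j, TorusContDiff κ (R j) := fun j =>
    torusContDiff_of_pullback A (by simp only [hRF]; exact hF _)
  have hnear : ∀ j ε, nearIdentity (0 : ℕ → Torus (0 + s) → (Fin (0 + s) → ℝ)) j ε = fun _ => 0 :=
    fun j ε => funext fun x => by simp [nearIdentity]
  -- With `H` the identity and the Taylor coefficients themselves as resonant terms, the defect is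
  -- just the Taylor remainder.
  have hdef : ∀ j ε x, defect (fun ε x => ε • f ε x) Ω₀ 0
      (fun i x => R i (sndBlock (torusMatrix A.1 x))) j ε x = ε • f ε x - nearIdentity F j ε x := by
    intro j ε x
    simp only [defect, hnear, torusProj_zero, add_zero, zero_add, sub_zero, resonantShift, hRF]
    rw [Finset.sum_Ico_eq_sum_range, nearIdentity]
    simp [add_comm 1]
  have hlip : ∀ j < N, IsTorusLipschitz ((0 : ℕ → Torus (0 + s) → (Fin (0 + s) → ℝ)) j) :=
    fun j _ => ⟨0, le_rfl, fun x v w => by simp⟩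
  refine ⟨0, fun j => F (j - 1), R, ?_, fun j _ => torusContDiff_const 0, fun j _ _ => ⟨hF _, hRc j⟩,
    fun hR0 => ?_⟩
  · rw [hN']
    refine isAveraging_of_steps hlip (fun j _ => hbound _) (fun j hj => ?_) (fun j _ z => ?_)
      (fun j _ x => ?_) (fun j _ z => ?_)
    · refine UniformO.congr (hu.mono hbound (M := j + 1) hj) fun ε x => ?_
      rw [hdef, nearIdentity, nearIdentity, Finset.sum_range_succ, add_tsub_cancel_right]
      abel
    · rw [integral_torus_zero]
    · rw [hRF]; simp
    · simp
  · refine hasResonantNormalForm hκ hn hω hf (fun j _ => torusContDiff_const 0) ?_ (fun j _ _ => hRc j)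
      ?_ hR0
    · rwa [hN']
    · rw [hN', hN]
      exact UniformO.congr hu fun ε x => (hdef N ε x).symm

/-- Nonzero parameters must accumulate at `0`; otherwise order estimates in `ε` would not determine
coefficients. -/
theorem neBot_nhdsWithin_diff_singleton (hI : Convex ℝ I) (hI0 : (0 : ℝ) ∈ I) (hInt : I.Nontrivial) :
    (𝓝[I \ {0}] (0 : ℝ)).NeBot := by
  have h := (hI.isPreconnected.preperfect_of_nontrivial hInt) 0 hI0
  rw [accPt_iff_nhds] at h
  rw [← mem_closure_iff_nhdsWithin_neBot, mem_closure_iff_nhds]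
  intro U hU
  obtain ⟨y, hy, hy0⟩ := h U hU
  exact ⟨y, hy.1, hy.2, hy0⟩

theorem averagesToNormalForm_analytic (hn : 1 ≤ n) (hm : 1 ≤ m) (hΩ₀ : IsResonant Ω₀)
    (hω : IsIntrinsicFrequency Ω₀ ω A L) {ν τ : ℝ} (hν : 0 < ν) (hD : IsDiophantine ν τ ω)
    (hI : Convex ℝ I) (hI0 : (0 : ℝ) ∈ I) (hInt : I.Nontrivial)
    (hu : IsAnalyticFamily (n + m) I fun ε x => ε • f ε x) :
    AveragesToNormalForm ⊤ I f Ω₀ ω A n m := by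
  have := neBot_nhdsWithin_diff_singleton hI hI0 hInt
  -- Resonance gives `s > 0`, so the dimension is positive even when `r = 0`, as the decay estimates
  -- require.
  have hs := hω.pos_of_resonant hΩ₀
  -- For `r = 0` the Diophantine condition is vacuous and `τ` may be negative; the exponent `0` then
  -- serves instead.
  obtain ⟨σ, hσ, hDσ⟩ : ∃ σ, 0 ≤ σ ∧ IsDiophantine ν σ ω := by
    rcases Nat.eq_zero_or_pos r with rfl | hr
    · exact ⟨0, le_rfl, fun k hk => absurd (Subsingleton.elim k 0) hk⟩
    · exact ⟨τ, hD.exponent_nonneg hν hr, hD⟩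
  obtain ⟨N, hN⟩ : ∃ N, n + m = N + 1 := ⟨n + m - 1, by omega⟩
  rw [hN] at hu
  -- Starting from this exponent, `2` remains at the end. Any exponent is available, because the
  -- rate `c` is chosen afterwards and a loss of exponent only narrows the strip.
  have hT : 0 < (N : ℝ) * σ + N + 1 := by positivity
  obtain ⟨c, hc, huc, F, hF, hTaylor⟩ :=
    hu.exists_hasTaylor (by omega) hI hI0 (fun x => zero_smul ℝ _) hT
  have hone : 1 ≤ (N : ℝ) * σ + N + 1 - N * σ - (N - 1 : ℝ) := by linarith
  exact averagesToNormalForm_of_hasTaylor le_top hn hm hω (fun ε hε => (huc ε hε).analytic hc hT)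
    (isWeight_expWeight hc) hσ hN hone (smallDivisorBound hω hν hσ hDσ (isWeight_expWeight hc))
    hTaylor hF fun g hg => hg.analytic hc (zero_lt_one.trans_le hone)

theorem averagesToNormalForm_finite (hn : 1 ≤ n) (hm : 1 ≤ m) (hΩ₀ : IsResonant Ω₀)
    (hω : IsIntrinsicFrequency Ω₀ ω A L) {ν τ : ℝ} (hν : 0 < ν) (hD : IsDiophantine ν τ ω)
    (hI : Convex ℝ I) (hI0 : (0 : ℝ) ∈ I) (hInt : I.Nontrivial) {p q : ℕ} (hqp : q < p)
    (hq : ((n + m - 1 : ℕ) : ℝ) * (((r + s : ℕ) : ℝ) + τ) ≤ q)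
    (hu : IsCkFamily (n + m) p I fun ε x => ε • f ε x) :
    AveragesToNormalForm ((p - q : ℕ) : WithTop ℕ∞) I f Ω₀ ω A n m := by
  have := neBot_nhdsWithin_diff_singleton hI hI0 hInt
  have hs := hω.pos_of_resonant hΩ₀
  obtain ⟨N, hN⟩ : ∃ N, n + m = N + 1 := ⟨n + m - 1, by omega⟩
  have hκ : (1 : WithTop ℕ∞) ≤ ((p - q : ℕ) : WithTop ℕ∞) := by exact_mod_cast Nat.sub_pos_of_lt hqp
  have hle : ((p - q : ℕ) : WithTop ℕ∞) ≤ p := by exact_mod_cast Nat.sub_le p q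
  rw [hN] at hu
  obtain ⟨v, hv, hTaylor⟩ := hu.exists_hasTaylor hI hI0 fun x => zero_smul ℝ _
  have hf : ∀ ε ∈ I, TorusContDiff ((p - q : ℕ) : WithTop ℕ∞) fun x => ε • f ε x :=
    fun ε hε => (hu.1 ε hε).of_le hle
  -- For `r = 0` a negative `τ` lets `q` be as small as `0`, so even the loss of `d` in the Fourier
  -- estimates could not be afforded. The direct argument loses nothing.
  rcases Nat.eq_zero_or_pos r with rfl | hr
  · exact averagesToNormalForm_of_no_frequency hκ hn hω hf hN hTaylor
      fun i => (torusContDiff_jetEval (hv i)).of_le hle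
  · have hτ := hD.exponent_nonneg hν hr
    rw [show n + m - 1 = N by omega] at hq
    have hN1 : (1 : ℝ) ≤ N := by exact_mod_cast (by omega : 1 ≤ N)
    have hd1 : (1 : ℝ) ≤ (r + s : ℕ) := by exact_mod_cast (by omega : 1 ≤ r + s)
    have hpq : ((p - q : ℕ) : ℝ) = p - q := Nat.cast_sub hqp.le
    -- The total loss `d + N * τ + N - 1` is at most `N * (d + τ)`, since `(N - 1) * (d - 1) ≥ 0`.
    have hexp : ((p - q : ℕ) : ℝ) ≤ (p : ℝ) - (r + s : ℕ) - N * τ - (N - 1 : ℝ) := by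
      rw [hpq]; nlinarith
    have hone : (1 : ℝ) ≤ ((p - q : ℕ) : ℝ) := by exact_mod_cast Nat.sub_pos_of_lt hqp
    have hdp : r + s ≤ p := by
      have h1 : ((r + s : ℕ) : ℝ) ≤ q := by nlinarith
      have h2 : r + s ≤ q := by exact_mod_cast h1
      omega
    exact averagesToNormalForm_of_hasTaylor hκ hn hm hω hf isWeight_polyWeight hτ hN
      (hone.trans hexp) (smallDivisorBound hω hν hτ hD isWeight_polyWeight) hTaylor
      (fun i => vectorClass_polyWeight_jetEval (by omega) hdp (hv i))
      fun g hg => hg.torusContDiff isWeight_polyWeight hexp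

end Assembly

end ResonantAveraging

theorem theoremA1 (r s : ℕ) (n m : ℕ) (hn : 1 ≤ n) (hm : 1 ≤ m)
    (Ω₀ : Fin (r + s) → ℝ) (hΩ₀ : IsResonant Ω₀)
    (ω : Fin r → ℝ) (A : Matrix.SpecialLinearGroup (Fin (r + s)) ℤ) (L : Fin (r + s) → ℤ)
    (hω : IsIntrinsicFrequency Ω₀ ω A L)
    (ν τ : ℝ) (hν : 0 < ν) (hDioph : IsDiophantine ν τ ω)
    (I : Set ℝ) (hI : Convex ℝ I) (hI0 : (0 : ℝ) ∈ I) (hInt : I.Nontrivial)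
    (f : ℝ → Torus (r + s) → (Fin (r + s) → ℝ)) :
    (IsAnalyticFamily (n + m) I (fun ε x => ε • f ε x) →
      AveragesToNormalForm (⊤ : WithTop ℕ∞) I f Ω₀ ω A n m) ∧
    (∀ p q : ℕ, q < p → ((n + m - 1 : ℕ) : ℝ) * (((r + s : ℕ) : ℝ) + τ) ≤ (q : ℝ) →
      IsCkFamily (n + m) p I (fun ε x => ε • f ε x) →
      AveragesToNormalForm ((p - q : ℕ) : WithTop ℕ∞) I f Ω₀ ω A n m) := by
  exact ⟨fun h => ResonantAveraging.averagesToNormalForm_analytic hn hm hΩ₀ hω hν hDioph hI hI0 hInt h,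
    fun p q hqp hq h => ResonantAveraging.averagesToNormalForm_finite hn hm hΩ₀ hω hν hDioph hI hI0
      hInt hqp hq h⟩
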